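/- Conventions. All spaces are over a field $K$; algebras are associative with non-degenerate product, not necessarily unital; $M(X)$ is the multiplier algebra of $X$. A multiplier Hopf algebra is such an algebra $X$ with a homomorphism $\Delta: X\to M(X\otimes X)$ such that $\Delta(a)(1\otimes b)$ and $(a\otimes 1)\Delta(b)$ lie in $X\otimes X$, $\Delta$ is coassociative, i.e. $(a\otimes 1\otimes 1)(\Delta\otimes\iota)(\Delta(b)(1\otimes c))=(\iota\otimes\Delta)((a\otimes 1)\Delta(b))(1\otimes 1\otimes c)$, and the maps $a\otimes b\mapsto \Delta(a)(1\otimes b)$, $a\otimes b\mapsto (a\otimes 1)\Delta(b)$ are bijections of $X\otimes X$; it is regular if $(X,\Delta^{cop})$ is one too. Then it has a unique counit $\varepsilon$ and a unique, bijective antipode $S$. Sweedler notation $\Delta(a)=a_{(1)}\otimes a_{(2)}$ is used in the usual covered sense. A pairing of regular multiplier Hopf algebras $A$, $B$ is a non-degenerate bilinear form $\langle\cdot,\cdot\rangle: A\times B\to K$ such that the multipliers $$b\blacktriangleright a=\langle a_{(2)},b\rangle a_{(1)},\quad a\blacktriangleleft b=\langle a_{(1)},b\rangle a_{(2)},\quad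 a\blacktriangleright b=\langle a,b_{(2)}\rangle b_{(1)},\quad b\blacktriangleleft a=\langle a,b_{(1)}\rangle b_{(2)}$$ lie in $A$, $A$, $B$, $B$ respectively, and $$\langle a,bb'\rangle=\langle b'\blacktriangleright a,b\rangle=\langle a\blacktriangleleft b,b'\rangle,\qquad \langle aa',b\rangle=\langle a,a'\blacktriangleright b\rangle=\langle a',b\blacktriangleleft a\rangle .$$ Theorem. Let $\langle A,B\rangle$ be a pairing of regular multiplier Hopf algebras. The maps $B\otimes A\to A\otimes B$ given by $$R(b\otimes a)=b_{(1)}\blacktriangleright a\otimes b_{(2)},\qquad T(b\otimes a)=b_{(1)}\blacktriangleright a\blacktriangleleft S^{-1}(b_{(3)})\otimes b_{(2)}$$ and the map $a\otimes b\mapsto b\blacktriangleleft S^{-1}(a_{(1)})\otimes a_{(2)}$ from $A\otimes B$ to $B\otimes A$ are well defined, and $T$ is bijective. The space $A\otimes B$ with the product $(m_A\otimes m_B)(\iota\otimes T\otimes\iota)$ and the comultiplication $\Delta(a\bowtie b)=\Delta_A^{cop}(a)\Delta_B(b)$ is a regular multiplier Hopf algebra $\mathscr D=A\bowtie B$ (the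 Drinfel'd double), and with the product $$(a\# b)(a'\# b')=a(b_{(1)}\blacktriangleright a')\# b_{(2)}b'$$ it is an algebra $\mathscr H=A\# B$ with non-degenerate product (the Heisenberg double). Let $$(a\bowtie b)\cdot(a'\# b')=a_{(3)}(b_{(1)}\blacktriangleright a')S^{-1}(a_{(2)})\ \#\ \big(b_{(2)}b'S(b_{(3)})\big)\blacktriangleleft S^{-1}(a_{(1)}),\tag{3.2}$$ and let $M_0(\mathscr D\otimes\mathscr H)$ be the completed module of the elements $x$ with $x(d\otimes 1)$, $(d\otimes 1)x\in\mathscr D\otimes\mathscr H$ for all $d\in\mathscr D$ (that is, pairs of linear maps $l,r:\mathscr D\to\mathscr D\otimes\mathscr H$ with $(d\otimes 1)\,l(d')=r(d)(d'\otimes 1)$, where $l(d)=x(d\otimes 1)$ and $r(d)=(d\otimes 1)x$). There is a linear map $\Gamma:\mathscr H\to M_0(\mathscr D\otimes\mathscr H)$ with $$((a'\bowtie b')\otimes 1)\Gamma(a\# b)=(a'\bowtie b')(a_{(2)}\bowtie b_{(1)})\otimes a_{(1)}\# b_{(2)},\tag{3.3}$$ and with (3.2) and (3.3) $\mathscr H$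 is a left-left Yetter–Drinfel'd $\mathscr D$-module algebra. That is, writing $\Gamma(v)=v_{(-1)}\otimes v_{(0)}$: 1. $\mathscr H$ is a $\mathscr D$-module algebra: $(dd')\cdot v=d\cdot(d'\cdot v)$, $\mathscr D\cdot\mathscr H=\mathscr H$, and $d\cdot(vw)=(d_{(1)}\cdot v)(d_{(2)}\cdot w)$; 2. $\mathscr H$ is a left $\mathscr D$-comodule algebra: $\Gamma$ is injective, $(\Delta\otimes\iota)\Gamma=(\iota\otimes\Gamma)\Gamma$, $(\varepsilon\otimes\iota)\Gamma=\iota$, and $\Gamma(vw)=\Gamma(v)\Gamma(w)$; 3. for all $d,d'\in\mathscr D$ and $v\in\mathscr H$, $$(d_{(1)}\cdot v)_{(-1)}d_{(2)}d'\otimes(d_{(1)}\cdot v)_{(0)}=d_{(1)}v_{(-1)}d'\otimes d_{(2)}\cdot v_{(0)}.\tag{2.3}$$ -/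

import Mathlib

open scoped TensorProduct

noncomputable section

namespace MHA

/-! ### Algebras with non-degenerate product, multiplier algebras -/

/-- A (possibly non-unital) associative algebra over `K` on the space `V` whose product is
non-degenerate. The product is a field, since two different products on the same space occur. -/
structure NondegenerateAlgebra (K V : Type*) [Field K] [AddCommGroup V] [Module K V] where
  mul : V →ₗ[K] V →ₗ[K] V
  mul_assoc : ∀ x y z, mul (mul x y) z = mul x (mul y z)
  nondeg_left : ∀ x, (∀ y, mul x y = 0) → x = 0
  nondeg_right : ∀ y, (∀ x, mul x y = 0) → y = 0

section Multipliers

variable {K V : Type*} [Field K] [AddCommGroup V] [Module K V]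

/-- The product `(x ⊗ y)(x' ⊗ y') = xx' ⊗ yy'` on `V ⊗ V`. -/
def tensorMul (m : V →ₗ[K] V →ₗ[K] V) : V ⊗[K] V →ₗ[K] V ⊗[K] V →ₗ[K] V ⊗[K] V :=
  TensorProduct.map₂ m m

/-- The multiplier algebra of an algebra with product `m`: pairs `(L, R)` of linear maps with
`v L(w) = R(v) w`, where `L` is left and `R` right multiplication by the multiplier. (For a
non-degenerate product, `L (v w) = L(v) w` and `R (v w) = v R(w)` follow.) -/
def multiplierAlgebra (m : V →ₗ[K] V →ₗ[K] V) :
    Subalgebra K (Module.End K V × (Module.End K V)ᵐᵒᵖ) where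
  carrier := {x | ∀ v w, m v (x.1 w) = m (x.2.unop v) w}
  mul_mem' := by
    intro x y hx hy v w
    have h1 := hx v (y.1 w)
    have h2 := hy (x.2.unop v) w
    simpa using h1.trans h2
  add_mem' := by
    intro x y hx hy v w
    simpa using congrArg₂ (· + ·) (hx v w) (hy v w)
  algebraMap_mem' := by
    intro c v w
    simp [Prod.algebraMap_apply, MulOpposite.algebraMap_apply, Module.algebraMap_end_apply]

/-- `z ↦ x z` for a multiplier `x`. -/
def multL {m : V →ₗ[K] V →ₗ[K] V} (x : multiplierAlgebra m) : V →ₗ[K] V := x.1.1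

/-- `z ↦ z x` for a multiplier `x`. -/
def multR {m : V →ₗ[K] V →ₗ[K] V} (x : multiplierAlgebra m) : V →ₗ[K] V := x.1.2.unop

end Multipliers

/-! ### Regular multiplier Hopf algebras -/

/-- A multiplier Hopf algebra. `T₁ (a ⊗ b)` is the element `Δ(a)(1 ⊗ b)` of `V ⊗ V` and
`T₂ (a ⊗ b)` is the element `(a ⊗ 1)Δ(b)`; both maps are bijective. An element `t` of `V ⊗ V`
equals a given multiplier as soon as both have the same left (or the same right) multiplication,
so the fields `T₁_spec`, `T₂_spec` say exactly this. -/
structure MultiplierHopfAlgebra (K V : Type*) [Field K] [AddCommGroup V] [Module K V] extends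
    NondegenerateAlgebra K V where
  comul : V →ₗ[K] multiplierAlgebra (tensorMul mul)
  comul_mul : ∀ a b, comul (mul a b) = comul a * comul b
  T₁ : V ⊗[K] V ≃ₗ[K] V ⊗[K] V
  T₁_spec : ∀ a b z, tensorMul mul (T₁ (a ⊗ₜ b)) z = multL (comul a) ((mul b).lTensor V z)
  T₂ : V ⊗[K] V ≃ₗ[K] V ⊗[K] V
  T₂_spec : ∀ a b z, tensorMul mul z (T₂ (a ⊗ₜ b)) = multR (comul b) ((mul.flip a).rTensor V z)
  /-- `(a ⊗ 1 ⊗ 1)(Δ ⊗ ι)(Δ(b)(1 ⊗ c)) = (ι ⊗ Δ)((a ⊗ 1)Δ(b))(1 ⊗ 1 ⊗ c)`. -/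
  coassoc : ∀ a b c,
    TensorProduct.assoc K V V V
        (T₂.toLinearMap.rTensor V ((TensorProduct.assoc K V V V).symm (a ⊗ₜ T₁ (b ⊗ₜ c)))) =
      T₁.toLinearMap.lTensor V (TensorProduct.assoc K V V V (T₂ (a ⊗ₜ b) ⊗ₜ c))

/-- A regular multiplier Hopf algebra: the co-opposite comultiplication `Δᶜᵒᵖ` also makes the
algebra a multiplier Hopf algebra. Up to the flip, its two canonical maps are
`T₃ (a ⊗ b) = Δ(a)(b ⊗ 1)` and `T₄ (a ⊗ b) = (1 ⊗ a)Δ(b)`, and `Δᶜᵒᵖ` is automatically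
multiplicative and coassociative. -/
structure RegularMultiplierHopfAlgebra (K V : Type*) [Field K] [AddCommGroup V] [Module K V]
    extends MultiplierHopfAlgebra K V where
  T₃ : V ⊗[K] V ≃ₗ[K] V ⊗[K] V
  T₃_spec : ∀ a b z, tensorMul mul (T₃ (a ⊗ₜ b)) z = multL (comul a) ((mul b).rTensor V z)
  T₄ : V ⊗[K] V ≃ₗ[K] V ⊗[K] V
  T₄_spec : ∀ a b z, tensorMul mul z (T₄ (a ⊗ₜ b)) = multR (comul b) ((mul.flip a).lTensor V z)

namespace RegularMultiplierHopfAlgebra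

variable {K X V : Type*} [Field K] [AddCommGroup X] [Module K X] [AddCommGroup V] [Module K V]
  (H : RegularMultiplierHopfAlgebra K X)

/-- `(ε ⊗ ι)(Δ(a)(1 ⊗ b)) = ab` and `(ι ⊗ ε)((a ⊗ 1)Δ(b)) = ab`. -/
def IsCounit (ε : X →ₗ[K] K) : Prop :=
  (∀ a b, TensorProduct.lid K X (ε.rTensor X (H.T₁ (a ⊗ₜ b))) = H.mul a b) ∧
  (∀ a b, TensorProduct.rid K X (ε.lTensor X (H.T₂ (a ⊗ₜ b))) = H.mul a b)

/-- The counit, the unique map with the property `IsCounit`. -/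
def counit : X →ₗ[K] K := Classical.epsilon H.IsCounit

/-- `m(S ⊗ ι)(Δ(a)(1 ⊗ b)) = ε(a) b` and `m(ι ⊗ S)((a ⊗ 1)Δ(b)) = ε(b) a`. -/
def IsAntipode (S : X ≃ₗ[K] X) : Prop :=
  (∀ a b, TensorProduct.lift (H.mul ∘ₗ S.toLinearMap) (H.T₁ (a ⊗ₜ b)) = H.counit a • b) ∧
  (∀ a b, TensorProduct.lift (H.mul.compl₂ S.toLinearMap) (H.T₂ (a ⊗ₜ b)) = H.counit b • a)

/-- The antipode (bijective, by regularity), the unique map with the property `IsAntipode`. -/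
def antipode : X ≃ₗ[K] X := @Classical.epsilon _ ⟨LinearEquiv.refl K X⟩ H.IsAntipode

/-- `R (x ⊗ v) = x₍₁₎·v ⊗ x₍₂₎`, that is, `R (x ⊗ v)(1 ⊗ y) = x₍₁₎·v ⊗ x₍₂₎y` for all `y`,
for a bilinear map `act x v = x·v`. -/
def IsTwist (act : X →ₗ[K] V →ₗ[K] V) (R : X ⊗[K] V →ₗ[K] V ⊗[K] X) : Prop :=
  ∀ x v y, (H.mul.flip y).lTensor V (R (x ⊗ₜ v)) = (act.flip v).rTensor X (H.T₁ (x ⊗ₜ y))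

/-- The unique map `x ⊗ v ↦ x₍₁₎·v ⊗ x₍₂₎`; it exists when `act` is a unital left action. -/
def twist (act : X →ₗ[K] V →ₗ[K] V) : X ⊗[K] V →ₗ[K] V ⊗[K] X :=
  Classical.epsilon (H.IsTwist act)

/-- `R (x ⊗ v) = x₍₂₎·v ⊗ x₍₁₎`, that is, `R (x ⊗ v)(1 ⊗ y) = x₍₂₎·v ⊗ x₍₁₎y` for all `y`. -/
def IsCotwist (act : X →ₗ[K] V →ₗ[K] V) (R : X ⊗[K] V →ₗ[K] V ⊗[K] X) : Prop :=
  ∀ x v y, (H.mul.flip y).lTensor V (R (x ⊗ₜ v)) =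
    (act.flip v).rTensor X (TensorProduct.comm K X X (H.T₃ (x ⊗ₜ y)))

/-- The unique map `x ⊗ v ↦ x₍₂₎·v ⊗ x₍₁₎`; it exists when `act` is a unital left action. -/
def cotwist (act : X →ₗ[K] V →ₗ[K] V) : X ⊗[K] V →ₗ[K] V ⊗[K] X :=
  Classical.epsilon (H.IsCotwist act)

/-- `x ⊗ y ↦ x₍₁₎ y S(x₍₂₎)`. -/
def adj : X →ₗ[K] X →ₗ[K] X :=
  TensorProduct.curry
    (TensorProduct.lift (H.mul.compl₂ H.antipode.toLinearMap) ∘ₗ H.T₃.toLinearMap)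

/-- `x ⊗ y ↦ x₍₂₎ y S⁻¹(x₍₁₎)`. -/
def coadj : X →ₗ[K] X →ₗ[K] X :=
  TensorProduct.curry
    (TensorProduct.lift (H.mul.flip ∘ₗ H.antipode.symm.toLinearMap) ∘ₗ H.T₁.toLinearMap)

end RegularMultiplierHopfAlgebra

/-! ### Yetter-Drinfel'd module algebras -/

section YetterDrinfeld

variable {K D V : Type*} [Field K] [AddCommGroup D] [Module K D] [AddCommGroup V] [Module K V]

/-- The completed module `M₀(D ⊗ V)` of the `D`-bimodule `D ⊗ V` (with `D` acting on the first
leg): pairs `(l, r)` of linear maps `D → D ⊗ V` with `d l(d') = r(d) d'`. An element `x` is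
thought of as `l(d) = x (d ⊗ 1)` and `r(d) = (d ⊗ 1) x`. -/
def completedModule (m : D →ₗ[K] D →ₗ[K] D) (V : Type*) [AddCommGroup V] [Module K V] :
    Submodule K ((D →ₗ[K] D ⊗[K] V) × (D →ₗ[K] D ⊗[K] V)) where
  carrier := {x | ∀ d d', (m d).rTensor V (x.1 d') = (m.flip d').rTensor V (x.2 d)}
  add_mem' := by
    intro x y hx hy d d'
    simpa using congrArg₂ (· + ·) (hx d d') (hy d d')
  zero_mem' := by
    intro d d'
    simp
  smul_mem' := by
    intro c x hx d d'
    simpa using congrArg (c • ·) (hx d d')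

/-- `rightCover Γ v d = Γ(v)(d ⊗ 1)`. -/
def rightCover {m : D →ₗ[K] D →ₗ[K] D} (Γ : V →ₗ[K] completedModule m V) :
    V →ₗ[K] D →ₗ[K] D ⊗[K] V :=
  LinearMap.fst K _ _ ∘ₗ (completedModule m V).subtype ∘ₗ Γ

/-- `leftCover Γ v d = (d ⊗ 1)Γ(v)`. -/
def leftCover {m : D →ₗ[K] D →ₗ[K] D} (Γ : V →ₗ[K] completedModule m V) :
    V →ₗ[K] D →ₗ[K] D ⊗[K] V :=
  LinearMap.snd K _ _ ∘ₗ (completedModule m V).subtype ∘ₗ Γ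

/-- `V` is a unital left `D`-module. -/
structure IsUnitalModule (𝒟 : RegularMultiplierHopfAlgebra K D) (act : D →ₗ[K] V →ₗ[K] V) :
    Prop where
  mul_act : ∀ d d' v, act (𝒟.mul d d') v = act d (act d' v)
  unital : Submodule.span K {w | ∃ d v, act d v = w} = ⊤

/-- The algebra `ℋ` is a left `𝒟`-module algebra: `d·(xy) = (d₍₁₎·x)(d₍₂₎·y)`. The right side
is given its meaning by writing the first factor (a sum of) `d'·x`, so that `d₍₁₎d' ⊗ d₍₂₎` lies in
`D ⊗ D`. -/
structure IsModuleAlgebra (𝒟 : RegularMultiplierHopfAlgebra K D) (ℋ : NondegenerateAlgebra K V)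
    (act : D →ₗ[K] V →ₗ[K] V) : Prop extends IsUnitalModule 𝒟 act where
  act_mul : ∀ d d' x y, act d (ℋ.mul (act d' x) y) =
    TensorProduct.lift (ℋ.mul.compl₁₂ (act.flip x) (act.flip y)) (𝒟.T₃ (d ⊗ₜ d'))

/-- `V` is a left `𝒟`-comodule with coaction `Γ`. -/
structure IsComodule (𝒟 : RegularMultiplierHopfAlgebra K D)
    (Γ : V →ₗ[K] completedModule 𝒟.mul V) : Prop where
  injective : Function.Injective Γ
  /-- `(Δ ⊗ ι)Γ = (ι ⊗ Γ)Γ`, multiplied on the right by `Δ(d)(1 ⊗ d') ⊗ 1` (these elements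
  span `D ⊗ D ⊗ 1`): the left side is `(Δ ⊗ ι)(Γ(v)(d ⊗ 1))(1 ⊗ d' ⊗ 1)`, the right side is the
  sum of the `(ι ⊗ Γ)(Γ(v)(p ⊗ 1))(1 ⊗ q ⊗ 1)` for `Δ(d)(1 ⊗ d') = ∑ p ⊗ q`. -/
  coassoc : ∀ v d d',
    TensorProduct.assoc K D D V
        ((𝒟.T₁.toLinearMap ∘ₗ (TensorProduct.mk K D D).flip d').rTensor V (rightCover Γ v d)) =
      TensorProduct.lift
        ((LinearMap.lTensorHom D ∘ₗ (rightCover Γ).flip).flip ∘ₗ rightCover Γ v) (𝒟.T₁ (d ⊗ₜ d'))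
  /-- `(ε ⊗ ι)Γ(v) = v`. -/
  counit : ∀ v d,
    TensorProduct.lid K V (𝒟.counit.rTensor V (rightCover Γ v d)) = 𝒟.counit d • v

/-- The algebra `ℋ` is a left `𝒟`-comodule algebra: moreover `Γ(xy) = Γ(x)Γ(y)`. -/
structure IsComoduleAlgebra (𝒟 : RegularMultiplierHopfAlgebra K D)
    (ℋ : NondegenerateAlgebra K V) (Γ : V →ₗ[K] completedModule 𝒟.mul V) : Prop
    extends IsComodule 𝒟 Γ where
  /-- `Γ(xy)(d ⊗ 1) = ∑ Γ(x)(p ⊗ 1)(1 ⊗ y')` for `Γ(y)(d ⊗ 1) = ∑ p ⊗ y'`. -/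
  rightCover_mul : ∀ x y d, rightCover Γ (ℋ.mul x y) d =
    TensorProduct.lift ((LinearMap.lTensorHom D ∘ₗ ℋ.mul.flip).flip ∘ₗ rightCover Γ x)
      (rightCover Γ y d)
  /-- `(d ⊗ 1)Γ(xy) = ∑ (1 ⊗ x')(p ⊗ 1)Γ(y)` for `(d ⊗ 1)Γ(x) = ∑ p ⊗ x'`. -/
  leftCover_mul : ∀ x y d, leftCover Γ (ℋ.mul x y) d =
    TensorProduct.lift ((LinearMap.lTensorHom D ∘ₗ ℋ.mul).flip ∘ₗ leftCover Γ y)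
      (leftCover Γ x d)

/-- The algebra `ℋ` is a left-left Yetter-Drinfel'd `𝒟`-module algebra: a module algebra and a
comodule algebra with
`(d₍₁₎·v)₍₋₁₎ d₍₂₎ d' ⊗ (d₍₁₎·v)₍₀₎ = d₍₁₎ v₍₋₁₎ d' ⊗ d₍₂₎·v₍₀₎`. -/
structure IsYetterDrinfeldModuleAlgebra (𝒟 : RegularMultiplierHopfAlgebra K D)
    (ℋ : NondegenerateAlgebra K V) (act : D →ₗ[K] V →ₗ[K] V)
    (Γ : V →ₗ[K] completedModule 𝒟.mul V) : Prop where
  moduleAlgebra : IsModuleAlgebra 𝒟 ℋ act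
  comoduleAlgebra : IsComoduleAlgebra 𝒟 ℋ Γ
  compatible : ∀ d d' v,
    TensorProduct.lift (rightCover Γ ∘ₗ act.flip v) (𝒟.T₁ (d ⊗ₜ d')) =
      TensorProduct.lift
        ((LinearMap.lTensorHom D ∘ₗ act.flip).flip ∘ₗ 𝒟.T₃.toLinearMap ∘ₗ
          TensorProduct.mk K D D d)
        (rightCover Γ v d')

end YetterDrinfeld

/-! ### Pairings, the Drinfel'd double and the Heisenberg double -/

/-- A pairing of two regular multiplier Hopf algebras. The regularity condition is the existence
in `A` of the elements `lA b a = b ▶ a = ⟨a₍₂₎, b⟩ a₍₁₎` and `rA a b = a ◀ b = ⟨a₍₁₎, b⟩ a₍₂₎`, and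
the existence in `B` of `lB a b = a ▶ b = ⟨a, b₍₂₎⟩ b₍₁₎` and `rB b a = b ◀ a = ⟨a, b₍₁₎⟩ b₍₂₎`
(they are unique, as the products are non-degenerate). The last four fields say that the products
are dual to the coproducts. -/
structure Pairing {K A B : Type*} [Field K] [AddCommGroup A] [Module K A] [AddCommGroup B]
    [Module K B] (𝒜 : RegularMultiplierHopfAlgebra K A)
    (ℬ : RegularMultiplierHopfAlgebra K B) where
  pair : A →ₗ[K] B →ₗ[K] K
  nondegenerate : pair.Nondegenerate
  lA : B →ₗ[K] A →ₗ[K] A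
  lA_spec : ∀ b a a', 𝒜.mul (lA b a) a' =
    TensorProduct.rid K A ((pair.flip b).lTensor A (𝒜.T₃ (a ⊗ₜ a')))
  rA : A →ₗ[K] B →ₗ[K] A
  rA_spec : ∀ a b a', 𝒜.mul (rA a b) a' =
    TensorProduct.lid K A ((pair.flip b).rTensor A (𝒜.T₁ (a ⊗ₜ a')))
  lB : A →ₗ[K] B →ₗ[K] B
  lB_spec : ∀ a b b', ℬ.mul (lB a b) b' =
    TensorProduct.rid K B ((pair a).lTensor B (ℬ.T₃ (b ⊗ₜ b')))
  rB : B →ₗ[K] A →ₗ[K] B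
  rB_spec : ∀ b a b', ℬ.mul (rB b a) b' =
    TensorProduct.lid K B ((pair a).rTensor B (ℬ.T₁ (b ⊗ₜ b')))
  pair_lA : ∀ a b b', pair (lA b' a) b = pair a (ℬ.mul b b')
  pair_rA : ∀ a b b', pair (rA a b) b' = pair a (ℬ.mul b b')
  pair_lB : ∀ a a' b, pair a (lB a' b) = pair (𝒜.mul a a') b
  pair_rB : ∀ a a' b, pair a' (rB b a) = pair (𝒜.mul a a') b

section Maps

variable {K A B : Type*} [Field K] [AddCommGroup A] [Module K A] [AddCommGroup B] [Module K B]

/-- `(ι ⊗ R ⊗ ι)(a ⊗ b ⊗ a' ⊗ b')`. -/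
def middleTwist (R : B ⊗[K] A →ₗ[K] A ⊗[K] B) :
    (A ⊗[K] B) ⊗[K] (A ⊗[K] B) →ₗ[K] A ⊗[K] (A ⊗[K] (B ⊗[K] B)) :=
  ((TensorProduct.assoc K A B B).toLinearMap ∘ₗ R.rTensor B ∘ₗ
      (TensorProduct.assoc K B A B).symm.toLinearMap).lTensor A ∘ₗ
    (TensorProduct.assoc K A B (A ⊗[K] B)).toLinearMap

/-- The twisted tensor product `(m_A ⊗ m_B)(ι ⊗ R ⊗ ι)`. -/
def twistedMul (mA : A →ₗ[K] A →ₗ[K] A) (mB : B →ₗ[K] B →ₗ[K] B)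
    (R : B ⊗[K] A →ₗ[K] A ⊗[K] B) : A ⊗[K] B →ₗ[K] A ⊗[K] B →ₗ[K] A ⊗[K] B :=
  TensorProduct.curry (TensorProduct.map (TensorProduct.lift mA) (TensorProduct.lift mB) ∘ₗ
    (TensorProduct.assoc K A A (B ⊗[K] B)).symm.toLinearMap ∘ₗ middleTwist R)

/-- Apply `f` to the first and third legs. -/
def onFirstLegs (f : A ⊗[K] A →ₗ[K] A ⊗[K] A) :
    (A ⊗[K] B) ⊗[K] (A ⊗[K] B) →ₗ[K] (A ⊗[K] B) ⊗[K] (A ⊗[K] B) :=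
  (TensorProduct.tensorTensorTensorComm K A B A B).symm.toLinearMap ∘ₗ f.rTensor (B ⊗[K] B) ∘ₗ
    (TensorProduct.tensorTensorTensorComm K A B A B).toLinearMap

end Maps

namespace Pairing

variable {K A B : Type*} [Field K] [AddCommGroup A] [Module K A] [AddCommGroup B] [Module K B]
  {𝒜 : RegularMultiplierHopfAlgebra K A} {ℬ : RegularMultiplierHopfAlgebra K B}
  (P : Pairing 𝒜 ℬ)

/-- The left action `a · b = b ◀ S⁻¹(a)` of `A` on `B`. -/
def invB : A →ₗ[K] B →ₗ[K] B := P.rB.flip ∘ₗ 𝒜.antipode.symm.toLinearMap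

/-- The left action `b · a = a ◀ S⁻¹(b)` of `B` on `A`. -/
def invA : B →ₗ[K] A →ₗ[K] A := P.rA.flip ∘ₗ ℬ.antipode.symm.toLinearMap

/-- `b ⊗ a ↦ b₍₁₎ ▶ a ⊗ b₍₂₎`. -/
def smashTwist : B ⊗[K] A →ₗ[K] A ⊗[K] B := ℬ.twist P.lA

/-- `T(b ⊗ a) = b₍₁₎ ▶ a ◀ S⁻¹(b₍₃₎) ⊗ b₍₂₎`. -/
def doubleTwist : B ⊗[K] A →ₗ[K] A ⊗[K] B :=
  ℬ.cotwist P.invA ∘ₗ (TensorProduct.comm K A B).toLinearMap ∘ₗ P.smashTwist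

/-- The product `(a # b)(a' # b') = a(b₍₁₎ ▶ a') # b₍₂₎b'` of the Heisenberg double. -/
def heisenbergMul : A ⊗[K] B →ₗ[K] A ⊗[K] B →ₗ[K] A ⊗[K] B :=
  twistedMul 𝒜.mul ℬ.mul P.smashTwist

/-- The product `(a ⋈ b)(a' ⋈ b') = (m_A ⊗ m_B)(ι ⊗ T ⊗ ι)(a ⊗ b ⊗ a' ⊗ b')` of the Drinfel'd
double. -/
def drinfeldMul : A ⊗[K] B →ₗ[K] A ⊗[K] B →ₗ[K] A ⊗[K] B :=
  twistedMul 𝒜.mul ℬ.mul P.doubleTwist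

/-- The action
`(a ⋈ b)·(a' # b') = a₍₃₎ (b₍₁₎ ▶ a') S⁻¹(a₍₂₎) # (b₍₂₎ b' S(b₍₃₎)) ◀ S⁻¹(a₍₁₎)`, as the composite of
`a ⊗ b ⊗ a' ⊗ b' ↦ a ⊗ x ⊗ y ⊗ b'` with `x ⊗ y = b₍₁₎ ▶ a' ⊗ b₍₂₎`,
`a ⊗ x ⊗ y ⊗ b' ↦ x ⊗ a ⊗ z` with `z = y₍₁₎ b' S(y₍₂₎)`,
`x ⊗ a ⊗ z ↦ x ⊗ w ⊗ u` with `w ⊗ u = z ◀ S⁻¹(a₍₁₎) ⊗ a₍₂₎`, and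
`x ⊗ w ⊗ u ↦ u₍₂₎ x S⁻¹(u₍₁₎) ⊗ w`. -/
def heisenbergAction : A ⊗[K] B →ₗ[K] A ⊗[K] B →ₗ[K] A ⊗[K] B :=
  TensorProduct.curry
    ((TensorProduct.comm K B A).toLinearMap ∘ₗ
      (TensorProduct.lift 𝒜.coadj.flip).lTensor B ∘ₗ
      (TensorProduct.leftComm K A B A).toLinearMap ∘ₗ
      (𝒜.twist P.invB).lTensor A ∘ₗ
      (TensorProduct.leftComm K A A B).toLinearMap ∘ₗ
      ((TensorProduct.lift ℬ.adj).lTensor A).lTensor A ∘ₗ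
      middleTwist P.smashTwist)

/-- The maps out of which the two doubles and the action are built exist (with the properties that
determine them), and `T` is invertible. -/
structure WellDefined : Prop where
  antipodeA : 𝒜.IsCounit 𝒜.counit ∧ 𝒜.IsAntipode 𝒜.antipode
  antipodeB : ℬ.IsCounit ℬ.counit ∧ ℬ.IsAntipode ℬ.antipode
  smashTwist : ℬ.IsTwist P.lA P.smashTwist
  twistB : 𝒜.IsTwist P.invB (𝒜.twist P.invB)
  cotwistA : ℬ.IsCotwist P.invA (ℬ.cotwist P.invA)
  bijective : Function.Bijective P.doubleTwist

/-- `𝒟` is the Drinfel'd double: the product is `drinfeldMul` and `Δ(a ⋈ b) = Δᶜᵒᵖ(a)Δ(b)`, a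
product in `M(D ⊗ D)` under the embeddings of `A` and `B` in `M(D)`. As
`(a ⋈ 1)(p ⋈ q) = ap ⋈ q` and `(1 ⋈ b)T(q ⊗ p) = T(bq ⊗ p)`, the multiplier `Δᶜᵒᵖ(a)` acts from the
left on the two `A`-legs of `D ⊗ D`, and `Δ(b)` on the two `B`-legs of the preimage under `T ⊗ T`. -/
structure IsDrinfeldDouble (𝒟 : RegularMultiplierHopfAlgebra K (A ⊗[K] B)) : Prop where
  mul_eq : 𝒟.mul = P.drinfeldMul
  comul_eq : ∀ a b (z : (B ⊗[K] A) ⊗[K] (B ⊗[K] A)),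
    multL (𝒟.comul (a ⊗ₜ b)) (TensorProduct.map P.doubleTwist P.doubleTwist z) =
      onFirstLegs
        ((TensorProduct.comm K A A).toLinearMap ∘ₗ multL (𝒜.comul a) ∘ₗ
          (TensorProduct.comm K A A).toLinearMap)
        (TensorProduct.map P.doubleTwist P.doubleTwist (onFirstLegs (multL (ℬ.comul b)) z))

end Pairing

/-- `((a' ⋈ b') ⊗ 1)Γ(a # b) = (a' ⋈ b')(a₍₂₎ ⋈ b₍₁₎) ⊗ a₍₁₎ # b₍₂₎`, where the second leg is
multiplied by arbitrary `x ∈ A` from the left and `y ∈ B` from the right: with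
`(x ⊗ 1)Δ(a) = xa₍₁₎ ⊗ a₍₂₎` and `Δ(b)(1 ⊗ y) = b₍₁₎ ⊗ b₍₂₎y` in the algebraic tensor products. -/
def IsHeisenbergCoaction {K A B : Type*} [Field K] [AddCommGroup A] [Module K A]
    [AddCommGroup B] [Module K B] (𝒜 : RegularMultiplierHopfAlgebra K A)
    (ℬ : RegularMultiplierHopfAlgebra K B) (𝒟 : RegularMultiplierHopfAlgebra K (A ⊗[K] B))
    (Γ : A ⊗[K] B →ₗ[K] completedModule 𝒟.mul (A ⊗[K] B)) : Prop :=
  ∀ a b d x y,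
    (TensorProduct.map (𝒜.mul x) (ℬ.mul.flip y)).lTensor (A ⊗[K] B) (leftCover Γ (a ⊗ₜ b) d) =
      (𝒟.mul d).rTensor (A ⊗[K] B)
        (TensorProduct.tensorTensorTensorComm K A A B B
          (TensorProduct.comm K A A (𝒜.T₂ (x ⊗ₜ a)) ⊗ₜ ℬ.T₁ (b ⊗ₜ y)))

end MHA

end

/-!
The proof rests on one device, which turns identities in Sweedler notation into identities of linear
maps. For a left or right module over a regular multiplier Hopf algebra `X`, with structure map
`α : X → End Z`, the *twist map* `tw α : X ⊗ Z → X ⊗ Z`, `x ⊗ z ↦ x₍₂₎ ⊗ α(x₍₁₎)(z)`, is the unique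
colinear map of free comodules whose composite with `ε ⊗ ι` is `α` (`IsTw`, `Colin.ext`). It exists
because its values on products are given by the canonical maps (`IsUnitalModule.isTw_and`,
`IsRightModule.isTw_and`), it is natural (`IsTw.natural`), it is inverted by the antipode
(`IsRightModule.tw_antipode_comp`), and it carries convolution of actions to composition of maps. Two
colinear maps agree as soon as they do so after applying the counit; the relations between twist maps
below are verified in this way.

For a pairing, the maps `λ(a ⊗ b) = b₍₁₎ ▶ a ⊗ b₍₂₎` and `ρ(a ⊗ b) = a₍₂₎ ⊗ a₍₁₎ ▶ b` (`lam`, `rho`)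
are twist maps for `A` and for `B` at the same time (`comm_lam`); they are colinear over both, and
`ε ⊗ ε` takes each of them to the pairing. Hence `R = λ ∘ flip` and `T = ρ⁻¹λ ∘ flip` exist
and are bijective, and `λ` and `ρ⁻¹λ` are exchange rules: they define the Heisenberg and the Drinfel'd
double as twisted tensor products (`IsExchange.algebra`), with the co-opposite comultiplication on `A`.

A module over such a twisted tensor product is a pair of modules over `A` and `B` that satisfies the
exchange rule. With `t` and `u` the twist maps of the `A`- and the `B`-module, the rule of the
Heisenberg double reads `ut = tuλ` (`lam_exchange_iff`) and that of the Drinfel'd double `λut = tuλ`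
(`exch_exchange_iff`). In this form it is clear how the rules behave for diagonal actions: a tensor
product of two `𝒟`-modules is a `𝒟`-module (`conv_exch`), and that of a `𝒟`-module and an `ℋ`-module
is an `ℋ`-module (`conv_lam`). Applied to regular modules, the first fact says that `Δ` is
multiplicative on `𝒟`, which gives the Hopf structure (`IsExchange.hopf`). The second says that `Γ`,
which is nothing but the comultiplication of `𝒟` on the common space `A ⊗ B` (`regularCoaction`), is
multiplicative for the product of `ℋ`.

Finally, the action of `𝒟` on `ℋ` consists of the inner actions `v ↦ a₍₂₎ v S⁻¹(a₍₁₎)` of `A` and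
`v ↦ b₍₁₎ v S(b₍₂₎)` of `B` in the Heisenberg double (`heisenbergAction_eq`). Both the exchange rule of
left and that of right multiplications involve `λ`, so together these actions satisfy the rule of the
Drinfel'd double (`exchangeModule_act`). Inner actions are compatible with the product
(`mul_tensorAct_inner`), and with `Γ` because `Γ` is multiplicative (`tensorAct_inner_comm`); these are
the module algebra property and the Yetter-Drinfel'd condition.
-/

noncomputable section

namespace MHA

open TensorProduct

/-! ### Cancellation in tensor products -/

section Cancellation

variable {K X X' V W : Type*} [Field K] [AddCommGroup X] [Module K X] [AddCommGroup X']
  [Module K X'] [AddCommGroup V] [Module K V] [AddCommGroup W] [Module K W]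

/-- Functionals on one factor separate the points of a tensor product of vector spaces. -/
theorem eq_zero_of_forall_dual (w : X ⊗[K] V)
    (h : ∀ f : V →ₗ[K] K, f.lTensor X w = 0) : w = 0 := by
  classical
  let b := Module.Basis.ofVectorSpace K V
  apply (TensorProduct.equivFinsuppOfBasisRight (M := X) b).injective
  rw [map_zero]
  ext i
  have h1 : ∀ w : X ⊗[K] V, TensorProduct.equivFinsuppOfBasisRight (M := X) b w i
      = TensorProduct.rid K X ((b.coord i).lTensor X w) := by
    intro w
    induction w with
    | zero => simp
    | add x y hx hy => simp only [map_add, Finsupp.add_apply, hx, hy]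
    | tmul x v => simp
  rw [h1, h, map_zero, Finsupp.zero_apply]

/-- A jointly injective family of linear maps stays jointly injective after tensoring. -/
theorem eq_of_forall_rTensor {ι : Sort*} (g : ι → X →ₗ[K] X')
    (hg : ∀ x, (∀ i, g i x = 0) → x = 0) {w w' : X ⊗[K] V}
    (h : ∀ i, (g i).rTensor V w = (g i).rTensor V w') : w = w' := by
  rw [← sub_eq_zero]
  apply eq_zero_of_forall_dual
  intro f
  apply (TensorProduct.rid K X).injective
  rw [map_zero]
  apply hg
  intro i
  have h1 : ∀ w : X ⊗[K] V, g i (TensorProduct.rid K X (f.lTensor X w))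
      = TensorProduct.rid K X' (f.lTensor X' ((g i).rTensor V w)) := by
    intro w
    induction w with
    | zero => simp
    | add x y hx hy => simp only [map_add, hx, hy]
    | tmul x v => simp
  rw [h1, map_sub, h i, sub_self, map_zero, map_zero]

theorem eq_of_forall_lTensor {ι : Sort*} (g : ι → X →ₗ[K] X')
    (hg : ∀ x, (∀ i, g i x = 0) → x = 0) {w w' : V ⊗[K] X}
    (h : ∀ i, (g i).lTensor V w = (g i).lTensor V w') : w = w' := by
  apply (TensorProduct.comm K V X).injective
  apply eq_of_forall_rTensor g hg
  intro i
  have h1 : ∀ w : V ⊗[K] X, (g i).rTensor V (TensorProduct.comm K V X w)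
      = TensorProduct.comm K V X' ((g i).lTensor V w) := by
    intro w
    induction w with
    | zero => simp
    | add x y hx hy => simp only [map_add, hx, hy]
    | tmul x v => simp
  rw [h1, h1, h i]

namespace NondegenerateAlgebra

variable (H : NondegenerateAlgebra K X)

theorem rTensor_cancel_right {w w' : X ⊗[K] V}
    (h : ∀ y, (H.mul.flip y).rTensor V w = (H.mul.flip y).rTensor V w') : w = w' :=
  eq_of_forall_rTensor _ (fun x hx => H.nondeg_left x hx) h

theorem rTensor_cancel_left {w w' : X ⊗[K] V}
    (h : ∀ y, (H.mul y).rTensor V w = (H.mul y).rTensor V w') : w = w' :=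
  eq_of_forall_rTensor _ (fun x hx => H.nondeg_right x hx) h

theorem lTensor_cancel_right {w w' : V ⊗[K] X}
    (h : ∀ y, (H.mul.flip y).lTensor V w = (H.mul.flip y).lTensor V w') : w = w' :=
  eq_of_forall_lTensor _ (fun x hx => H.nondeg_left x hx) h

theorem lTensor_cancel_left {w w' : V ⊗[K] X}
    (h : ∀ y, (H.mul y).lTensor V w = (H.mul y).lTensor V w') : w = w' :=
  eq_of_forall_lTensor _ (fun x hx => H.nondeg_right x hx) h

theorem tensorMul_tmul_right (m : X →ₗ[K] X →ₗ[K] X) (u : X ⊗[K] X) (p q : X) :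
    tensorMul m u (p ⊗ₜ q) = (m.flip q).lTensor X ((m.flip p).rTensor X u) := by
  induction u with
  | zero => simp
  | add x y hx hy => simp only [map_add, LinearMap.add_apply, hx, hy]
  | tmul x v => simp [tensorMul]

theorem tensorMul_tmul_left (m : X →ₗ[K] X →ₗ[K] X) (u : X ⊗[K] X) (p q : X) :
    tensorMul m (p ⊗ₜ q) u = (m q).lTensor X ((m p).rTensor X u) := by
  induction u with
  | zero => simp
  | add x y hx hy => simp only [map_add, hx, hy]
  | tmul x v => simp [tensorMul]

theorem tensorMul_cancel_right {u u' : X ⊗[K] X}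
    (h : ∀ z, tensorMul H.mul u z = tensorMul H.mul u' z) : u = u' := by
  apply H.rTensor_cancel_right
  intro p
  apply H.lTensor_cancel_right
  intro q
  simpa only [tensorMul_tmul_right] using h (p ⊗ₜ q)

theorem tensorMul_cancel_left {u u' : X ⊗[K] X}
    (h : ∀ z, tensorMul H.mul z u = tensorMul H.mul z u') : u = u' := by
  apply H.rTensor_cancel_left
  intro p
  apply H.lTensor_cancel_left
  intro q
  simpa only [tensorMul_tmul_left] using h (p ⊗ₜ q)

theorem tensorMul_assoc (u v w : X ⊗[K] X) :
    tensorMul H.mul (tensorMul H.mul u v) w = tensorMul H.mul u (tensorMul H.mul v w) := by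
  induction u with
  | zero => simp
  | add x y hx hy => simp only [map_add, LinearMap.add_apply, hx, hy]
  | tmul a b =>
    induction v with
    | zero => simp
    | add x y hx hy => simp only [map_add, LinearMap.add_apply, hx, hy]
    | tmul c d =>
      induction w with
      | zero => simp
      | add x y hx hy => simp only [map_add, hx, hy]
      | tmul e f => simp [tensorMul, H.mul_assoc]

/-- `(u (p ⊗ 1)) z = u ((p ⊗ 1) z)`. -/
theorem tensorMul_right₁ (u z : X ⊗[K] X) (p : X) :
    tensorMul H.mul ((H.mul.flip p).rTensor X u) z = tensorMul H.mul u ((H.mul p).rTensor X z) := by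
  induction u with
  | zero => simp
  | add x y hx hy => simp only [map_add, LinearMap.add_apply, hx, hy]
  | tmul a b =>
    induction z with
    | zero => simp
    | add x y hx hy => simp only [map_add, hx, hy]
    | tmul e f => simp [tensorMul, H.mul_assoc]

theorem tensorMul_right₂ (u z : X ⊗[K] X) (p : X) :
    tensorMul H.mul ((H.mul.flip p).lTensor X u) z = tensorMul H.mul u ((H.mul p).lTensor X z) := by
  induction u with
  | zero => simp
  | add x y hx hy => simp only [map_add, LinearMap.add_apply, hx, hy]
  | tmul a b =>
    induction z with
    | zero => simp
    | add x y hx hy => simp only [map_add, hx, hy]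
    | tmul e f => simp [tensorMul, H.mul_assoc]

theorem tensorMul_left₁ (u z : X ⊗[K] X) (p : X) :
    tensorMul H.mul ((H.mul p).rTensor X u) z = (H.mul p).rTensor X (tensorMul H.mul u z) := by
  induction u with
  | zero => simp
  | add x y hx hy => simp only [map_add, LinearMap.add_apply, hx, hy]
  | tmul a b =>
    induction z with
    | zero => simp
    | add x y hx hy => simp only [map_add, hx, hy]
    | tmul e f => simp [tensorMul, H.mul_assoc]

theorem tensorMul_left₂ (u z : X ⊗[K] X) (p : X) :
    tensorMul H.mul ((H.mul p).lTensor X u) z = (H.mul p).lTensor X (tensorMul H.mul u z) := by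
  induction u with
  | zero => simp
  | add x y hx hy => simp only [map_add, LinearMap.add_apply, hx, hy]
  | tmul a b =>
    induction z with
    | zero => simp
    | add x y hx hy => simp only [map_add, hx, hy]
    | tmul e f => simp [tensorMul, H.mul_assoc]

theorem multiplier_compat (x : multiplierAlgebra (tensorMul H.mul)) (v w : X ⊗[K] X) :
    tensorMul H.mul v (multL x w) = tensorMul H.mul (multR x v) w := x.2 v w

theorem multL_tensorMul (x : multiplierAlgebra (tensorMul H.mul)) (v w : X ⊗[K] X) :
    multL x (tensorMul H.mul v w) = tensorMul H.mul (multL x v) w := by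
  apply H.tensorMul_cancel_left
  intro z
  rw [multiplier_compat, ← tensorMul_assoc, ← multiplier_compat, tensorMul_assoc]

theorem multR_tensorMul (x : multiplierAlgebra (tensorMul H.mul)) (v w : X ⊗[K] X) :
    multR x (tensorMul H.mul v w) = tensorMul H.mul v (multR x w) := by
  apply H.tensorMul_cancel_right
  intro z
  rw [← multiplier_compat, tensorMul_assoc, tensorMul_assoc, multiplier_compat]

/-- Two multipliers with the same left multiplication are equal. -/
theorem multiplier_ext {x y : multiplierAlgebra (tensorMul H.mul)} (h : multL x = multL y) :
    x = y := by
  have h2 : multR x = multR y := by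
    refine LinearMap.ext fun v => H.tensorMul_cancel_right fun w => ?_
    rw [← multiplier_compat, ← multiplier_compat, h]
  exact Subtype.ext (Prod.ext h (MulOpposite.unop_injective h2))

end NondegenerateAlgebra

end Cancellation

/-! ### Relations between the canonical maps -/

namespace RegularMultiplierHopfAlgebra

variable {K X V : Type*} [Field K] [AddCommGroup X] [Module K X] [AddCommGroup V] [Module K V]
  (H : RegularMultiplierHopfAlgebra K X)

theorem _root_.MHA.lTensor_rTensor_comm {P Q P' Q' : Type*} [AddCommGroup P] [Module K P]
    [AddCommGroup Q] [Module K Q] [AddCommGroup P'] [Module K P'] [AddCommGroup Q'] [Module K Q']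
    (f : P →ₗ[K] P') (g : Q →ₗ[K] Q') (z : P ⊗[K] Q) :
    g.lTensor P' (f.rTensor Q z) = f.rTensor Q' (g.lTensor P z) := by
  rw [← LinearMap.comp_apply, ← LinearMap.comp_apply, LinearMap.lTensor_comp_rTensor,
    LinearMap.rTensor_comp_lTensor]

/-- `Δ(a)(p ⊗ q) = Δ(a)(p ⊗ 1) (1 ⊗ q)`. -/
theorem multL_comul_eq₃ (a p q : X) :
    multL (H.comul a) (p ⊗ₜ q) = (H.mul.flip q).lTensor X (H.T₃ (a ⊗ₜ p)) := by
  apply H.tensorMul_cancel_right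
  intro z
  rw [H.tensorMul_right₂, H.T₃_spec, ← H.multL_tensorMul, NondegenerateAlgebra.tensorMul_tmul_left,
    lTensor_rTensor_comm]

theorem multL_comul_eq₁ (a p q : X) :
    multL (H.comul a) (p ⊗ₜ q) = (H.mul.flip p).rTensor X (H.T₁ (a ⊗ₜ q)) := by
  apply H.tensorMul_cancel_right
  intro z
  rw [H.tensorMul_right₁, H.T₁_spec, ← H.multL_tensorMul, NondegenerateAlgebra.tensorMul_tmul_left]

theorem multR_comul_eq₂ (a p q : X) :
    multR (H.comul a) (p ⊗ₜ q) = (H.mul q).lTensor X (H.T₂ (p ⊗ₜ a)) := by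
  apply H.tensorMul_cancel_left
  intro z
  rw [← H.tensorMul_right₂, H.T₂_spec, ← H.multR_tensorMul,
    NondegenerateAlgebra.tensorMul_tmul_right, lTensor_rTensor_comm]

/-- `Δ(x)(y ⊗ w)`, computed in two ways. -/
theorem T₃_right₂ (x y w : X) :
    (H.mul.flip w).lTensor X (H.T₃ (x ⊗ₜ y)) = (H.mul.flip y).rTensor X (H.T₁ (x ⊗ₜ w)) := by
  rw [← multL_comul_eq₃, multL_comul_eq₁]

/-- `(p ⊗ 1)Δ(a)(1 ⊗ b)`, computed in two ways. -/
theorem T₁_left₁ (p a b : X) :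
    (H.mul p).rTensor X (H.T₁ (a ⊗ₜ b)) = (H.mul.flip b).lTensor X (H.T₂ (p ⊗ₜ a)) := by
  apply H.tensorMul_cancel_right
  intro z
  apply H.tensorMul_cancel_left
  intro z'
  rw [H.tensorMul_left₁, H.T₁_spec, H.tensorMul_right₂, ← H.tensorMul_assoc z', H.T₂_spec,
    ← H.multiplier_compat, ← H.tensorMul_right₁]

theorem T₃_left₁ (p a b : X) :
    (H.mul p).rTensor X (H.T₃ (a ⊗ₜ b)) = (H.mul.flip b).rTensor X (H.T₂ (p ⊗ₜ a)) := by
  apply H.tensorMul_cancel_right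
  intro z
  apply H.tensorMul_cancel_left
  intro z'
  rw [H.tensorMul_left₁, H.T₃_spec, H.tensorMul_right₁, ← H.tensorMul_assoc z', H.T₂_spec,
    ← H.multiplier_compat, ← H.tensorMul_right₁]

theorem T₁_left₂ (p a b : X) :
    (H.mul p).lTensor X (H.T₁ (a ⊗ₜ b)) = (H.mul.flip b).lTensor X (H.T₄ (p ⊗ₜ a)) := by
  apply H.tensorMul_cancel_right
  intro z
  apply H.tensorMul_cancel_left
  intro z'
  rw [H.tensorMul_left₂, H.T₁_spec, H.tensorMul_right₂, ← H.tensorMul_assoc z', H.T₄_spec,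
    ← H.multiplier_compat, ← H.tensorMul_right₂]

theorem T₁_mul_right (a b c : X) :
    H.T₁ (a ⊗ₜ H.mul b c) = (H.mul.flip c).lTensor X (H.T₁ (a ⊗ₜ b)) := by
  apply H.tensorMul_cancel_right
  intro z
  rw [H.T₁_spec, H.tensorMul_right₂, H.T₁_spec]
  simp only [← LinearMap.comp_apply, ← LinearMap.lTensor_comp]
  congr 4
  ext z
  simp [H.mul_assoc]

theorem T₃_mul_right (a b c : X) :
    H.T₃ (a ⊗ₜ H.mul b c) = (H.mul.flip c).rTensor X (H.T₃ (a ⊗ₜ b)) := by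
  apply H.tensorMul_cancel_right
  intro z
  rw [H.T₃_spec, H.tensorMul_right₁, H.T₃_spec]
  simp only [← LinearMap.comp_apply, ← LinearMap.rTensor_comp]
  congr 4
  ext z
  simp [H.mul_assoc]

theorem T₂_mul_left (a b c : X) :
    H.T₂ (H.mul c a ⊗ₜ b) = (H.mul c).rTensor X (H.T₂ (a ⊗ₜ b)) := by
  apply H.lTensor_cancel_right
  intro y
  rw [← T₁_left₁, lTensor_rTensor_comm, ← T₁_left₁]
  simp only [← LinearMap.comp_apply, ← LinearMap.rTensor_comp]
  congr 2
  ext z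
  simp [H.mul_assoc]

theorem multL_comul_mul (a b : X) (z : X ⊗[K] X) :
    multL (H.comul (H.mul a b)) z = multL (H.comul a) (multL (H.comul b) z) := by
  rw [H.comul_mul]; rfl

/-- `Δ(xp)(1 ⊗ r) = Δ(x)Δ(p)(1 ⊗ r)`. -/
theorem T₁_mul_left (x p r : X) :
    H.T₁ (H.mul x p ⊗ₜ r) = multL (H.comul x) (H.T₁ (p ⊗ₜ r)) := by
  apply H.tensorMul_cancel_right
  intro z
  rw [H.T₁_spec, multL_comul_mul, ← H.T₁_spec, H.multL_tensorMul]

theorem T₃_mul_left (x p r : X) :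
    H.T₃ (H.mul x p ⊗ₜ r) = multL (H.comul x) (H.T₃ (p ⊗ₜ r)) := by
  apply H.tensorMul_cancel_right
  intro z
  rw [H.T₃_spec, multL_comul_mul, ← H.T₃_spec, H.multL_tensorMul]

/-- `(x ⊗ 1)Δ(ab) = ((x ⊗ 1)Δ(a))Δ(b)`. -/
theorem T₂_mul_right (x a b : X) :
    H.T₂ (x ⊗ₜ H.mul a b) = multR (H.comul b) (H.T₂ (x ⊗ₜ a)) := by
  apply H.tensorMul_cancel_left
  intro z
  rw [H.T₂_spec, H.comul_mul, ← H.multR_tensorMul, H.T₂_spec]; rfl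

end RegularMultiplierHopfAlgebra

namespace RegularMultiplierHopfAlgebra

variable {K X V : Type*} [Field K] [AddCommGroup X] [Module K X] [AddCommGroup V] [Module K V]
  (H : RegularMultiplierHopfAlgebra K X)

/-! ### Coassociativity for all coverings, the co-opposite -/

/-- `c ↦ x ↦ Δ(x)(1 ⊗ c)`. -/
def right₁ : X →ₗ[K] X →ₗ[K] X ⊗[K] X := (TensorProduct.curry H.T₁.toLinearMap).flip

/-- `c ↦ x ↦ (c ⊗ 1)Δ(x)`. -/
def left₂ : X →ₗ[K] X →ₗ[K] X ⊗[K] X := TensorProduct.curry H.T₂.toLinearMap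

/-- `c ↦ x ↦ Δ(x)(c ⊗ 1)`. -/
def right₃ : X →ₗ[K] X →ₗ[K] X ⊗[K] X := (TensorProduct.curry H.T₃.toLinearMap).flip

/-- `c ↦ x ↦ (1 ⊗ c)Δ(x)`. -/
def left₄ : X →ₗ[K] X →ₗ[K] X ⊗[K] X := TensorProduct.curry H.T₄.toLinearMap

@[simp] theorem right₁_apply (c x : X) : H.right₁ c x = H.T₁ (x ⊗ₜ c) := rfl
@[simp] theorem left₂_apply (c x : X) : H.left₂ c x = H.T₂ (c ⊗ₜ x) := rfl
@[simp] theorem right₃_apply (c x : X) : H.right₃ c x = H.T₃ (x ⊗ₜ c) := rfl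
@[simp] theorem left₄_apply (c x : X) : H.left₄ c x = H.T₄ (c ⊗ₜ x) := rfl

theorem coassoc_left₂_right₁ (a b c : X) :
    TensorProduct.assoc K X X X ((H.left₂ a).rTensor X (H.T₁ (b ⊗ₜ c))) =
      (H.right₁ c).lTensor X (H.T₂ (a ⊗ₜ b)) := by
  have h1 : ∀ w : X ⊗[K] X, (H.left₂ a).rTensor X w =
      H.T₂.toLinearMap.rTensor X ((TensorProduct.assoc K X X X).symm (a ⊗ₜ w)) := by
    intro w
    induction w with
    | zero => simp
    | add x y hx hy => simp only [map_add, TensorProduct.tmul_add, hx, hy]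
    | tmul x y => simp
  have h2 : ∀ w : X ⊗[K] X, (H.right₁ c).lTensor X w =
      H.T₁.toLinearMap.lTensor X (TensorProduct.assoc K X X X (w ⊗ₜ c)) := by
    intro w
    induction w with
    | zero => simp
    | add x y hx hy => simp only [map_add, TensorProduct.add_tmul, hx, hy]
    | tmul x y => simp
  rw [h1, h2, H.coassoc]

theorem coassoc_right₃_right₁ (a b c : X) :
    TensorProduct.assoc K X X X ((H.right₃ a).rTensor X (H.T₁ (b ⊗ₜ c))) =
      (H.right₁ c).lTensor X (H.T₃ (b ⊗ₜ a)) := by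
  apply H.rTensor_cancel_left
  intro y
  have h1 : ∀ w : X ⊗[K] X, (H.mul y).rTensor (X ⊗[K] X)
      (TensorProduct.assoc K X X X ((H.right₃ a).rTensor X w)) =
      (H.mul.flip a).rTensor (X ⊗[K] X)
        (TensorProduct.assoc K X X X ((H.left₂ y).rTensor X w)) := by
    intro w
    induction w with
    | zero => simp
    | add x y hx hy => simp only [map_add, hx, hy]
    | tmul p q =>
      have h := H.T₃_left₁ y p a
      have h2 := congrArg (fun t => TensorProduct.assoc K X X X (t ⊗ₜ[K] q)) h
      have h3 : ∀ (f : X →ₗ[K] X) (t : X ⊗[K] X), f.rTensor (X ⊗[K] X)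
          (TensorProduct.assoc K X X X (t ⊗ₜ[K] q)) =
          TensorProduct.assoc K X X X (f.rTensor X t ⊗ₜ[K] q) := by
        intro f t
        induction t with
        | zero => simp
        | add x y hx hy => simp only [map_add, TensorProduct.add_tmul, hx, hy]
        | tmul p q => simp
      simp only [LinearMap.rTensor_tmul, right₃_apply, left₂_apply, h3]
      exact h2
  rw [h1, coassoc_left₂_right₁, ← lTensor_rTensor_comm, ← lTensor_rTensor_comm, T₃_left₁]

theorem coassoc_right₃_left₄ (a b c : X) :
    TensorProduct.assoc K X X X ((H.right₃ a).rTensor X (H.T₄ (c ⊗ₜ b))) =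
      (H.left₄ c).lTensor X (H.T₃ (b ⊗ₜ a)) := by
  apply eq_of_forall_lTensor (fun y => (H.mul.flip y).lTensor X)
  · intro x hx
    apply H.lTensor_cancel_right
    intro y
    rw [hx, map_zero]
  intro y
  have h1 : ∀ w : X ⊗[K] X, ((H.mul.flip y).lTensor X).lTensor X ((H.left₄ c).lTensor X w) =
      ((H.mul c).lTensor X).lTensor X ((H.right₁ y).lTensor X w) := by
    intro w
    induction w with
    | zero => simp
    | add x y hx hy => simp only [map_add, hx, hy]
    | tmul p q => simp [T₁_left₂]
  have h3 : ∀ (f : X →ₗ[K] X) (w : X ⊗[K] X), (f.lTensor X).lTensor X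
      (TensorProduct.assoc K X X X ((H.right₃ a).rTensor X w)) =
      TensorProduct.assoc K X X X ((H.right₃ a).rTensor X (f.lTensor X w)) := by
    intro f w
    induction w with
    | zero => simp
    | add x y hx hy => simp only [map_add, hx, hy]
    | tmul p q =>
      simp only [LinearMap.rTensor_tmul, LinearMap.lTensor_tmul]
      generalize H.right₃ a p = t
      induction t with
      | zero => simp
      | add x y hx hy => simp only [map_add, TensorProduct.add_tmul, hx, hy]
      | tmul p q => simp
  rw [h1, h3, ← T₁_left₂, ← h3, coassoc_right₃_right₁]

theorem comm_tensorMul (m : X →ₗ[K] X →ₗ[K] X) (u v : X ⊗[K] X) :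
    TensorProduct.comm K X X (tensorMul m u v) =
      tensorMul m (TensorProduct.comm K X X u) (TensorProduct.comm K X X v) := by
  induction u with
  | zero => simp
  | add x y hx hy => simp only [map_add, LinearMap.add_apply, hx, hy]
  | tmul a b =>
    induction v with
    | zero => simp
    | add x y hx hy => simp only [map_add, hx, hy]
    | tmul e f => simp [tensorMul]

theorem _root_.MHA.comm_lTensor {P Q Q' : Type*} [AddCommGroup P] [Module K P]
    [AddCommGroup Q] [Module K Q] [AddCommGroup Q'] [Module K Q']
    (f : Q →ₗ[K] Q') (z : P ⊗[K] Q) :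
    TensorProduct.comm K P Q' (f.lTensor P z) = f.rTensor P (TensorProduct.comm K P Q z) := by
  induction z with
  | zero => simp
  | add x y hx hy => simp only [map_add, hx, hy]
  | tmul e f => simp

theorem _root_.MHA.comm_rTensor {P Q Q' : Type*} [AddCommGroup P] [Module K P]
    [AddCommGroup Q] [Module K Q] [AddCommGroup Q'] [Module K Q']
    (f : Q →ₗ[K] Q') (z : Q ⊗[K] P) :
    TensorProduct.comm K Q' P (f.rTensor P z) = f.lTensor P (TensorProduct.comm K Q P z) := by
  induction z with
  | zero => simp
  | add x y hx hy => simp only [map_add, hx, hy]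
  | tmul e f => simp

/-- The multiplier of `X ⊗ X` obtained by exchanging the two legs. -/
def flipMultiplier (m : X →ₗ[K] X →ₗ[K] X) :
    multiplierAlgebra (tensorMul m) →ₗ[K] multiplierAlgebra (tensorMul m) where
  toFun x := ⟨((TensorProduct.comm K X X).toLinearMap ∘ₗ multL x ∘ₗ
      (TensorProduct.comm K X X).toLinearMap, MulOpposite.op ((TensorProduct.comm K X X).toLinearMap ∘ₗ
      multR x ∘ₗ (TensorProduct.comm K X X).toLinearMap)), by
    intro v w
    have h := congrArg (TensorProduct.comm K X X)
      (x.2 (TensorProduct.comm K X X v) (TensorProduct.comm K X X w))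
    rw [comm_tensorMul, comm_tensorMul] at h
    simpa [multL, multR] using h⟩
  map_add' x y := by
    apply Subtype.ext
    apply Prod.ext
    · ext; simp [multL]
    · apply MulOpposite.unop_injective; ext; simp [multR]
  map_smul' c x := by
    apply Subtype.ext
    apply Prod.ext
    · ext; simp [multL]
    · apply MulOpposite.unop_injective; ext; simp [multR]

@[simp] theorem multL_flipMultiplier {m : X →ₗ[K] X →ₗ[K] X}
    (x : multiplierAlgebra (tensorMul m)) (z : X ⊗[K] X) :
    multL (flipMultiplier m x) z =
      TensorProduct.comm K X X (multL x (TensorProduct.comm K X X z)) := rfl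

@[simp] theorem multR_flipMultiplier {m : X →ₗ[K] X →ₗ[K] X}
    (x : multiplierAlgebra (tensorMul m)) (z : X ⊗[K] X) :
    multR (flipMultiplier m x) z =
      TensorProduct.comm K X X (multR x (TensorProduct.comm K X X z)) := rfl

/-- The co-opposite of a regular multiplier Hopf algebra. -/
def cop : RegularMultiplierHopfAlgebra K X where
  toNondegenerateAlgebra := H.toNondegenerateAlgebra
  comul := flipMultiplier H.mul ∘ₗ H.comul
  comul_mul a b := by
    apply H.multiplier_ext
    refine LinearMap.ext fun z => ?_
    change TensorProduct.comm K X X (multL (H.comul (H.mul a b)) (TensorProduct.comm K X X z)) =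
      TensorProduct.comm K X X (multL (H.comul a) (TensorProduct.comm K X X
        (TensorProduct.comm K X X (multL (H.comul b) (TensorProduct.comm K X X z)))))
    rw [multL_comul_mul, TensorProduct.comm_comm]
  T₁ := H.T₃.trans (TensorProduct.comm K X X)
  T₁_spec a b z := by
    have h := congrArg (TensorProduct.comm K X X) (H.T₃_spec a b (TensorProduct.comm K X X z))
    rw [comm_tensorMul] at h
    simpa [comm_lTensor] using h
  T₂ := H.T₄.trans (TensorProduct.comm K X X)
  T₂_spec a b z := by
    have h := congrArg (TensorProduct.comm K X X) (H.T₄_spec a b (TensorProduct.comm K X X z))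
    rw [comm_tensorMul] at h
    simpa [comm_rTensor] using h
  T₃ := H.T₁.trans (TensorProduct.comm K X X)
  T₃_spec a b z := by
    have h := congrArg (TensorProduct.comm K X X) (H.T₁_spec a b (TensorProduct.comm K X X z))
    rw [comm_tensorMul] at h
    simpa [comm_rTensor] using h
  T₄ := H.T₂.trans (TensorProduct.comm K X X)
  T₄_spec a b z := by
    have h := congrArg (TensorProduct.comm K X X) (H.T₂_spec a b (TensorProduct.comm K X X z))
    rw [comm_tensorMul] at h
    simpa [comm_lTensor] using h
  coassoc a b c := by
    have h := congrArg (fun w => TensorProduct.assoc K X X X (TensorProduct.comm K X (X ⊗[K] X)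
      ((TensorProduct.comm K X X).toLinearMap.lTensor X w))) (H.coassoc_right₃_left₄ c b a)
    have h1 : ∀ w : X ⊗[K] X, TensorProduct.assoc K X X X
        ((H.T₄.trans (TensorProduct.comm K X X)).toLinearMap.rTensor X
          ((TensorProduct.assoc K X X X).symm (a ⊗ₜ TensorProduct.comm K X X w))) =
        TensorProduct.assoc K X X X (TensorProduct.comm K X (X ⊗[K] X)
          ((TensorProduct.comm K X X).toLinearMap.lTensor X ((H.left₄ a).lTensor X w))) := by
      intro w
      induction w with
      | zero => simp
      | add x y hx hy => simp only [map_add, TensorProduct.tmul_add, hx, hy]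
      | tmul p q => simp
    have h2 : ∀ w : X ⊗[K] X, (H.T₃.trans (TensorProduct.comm K X X)).toLinearMap.lTensor X
          (TensorProduct.assoc K X X X (TensorProduct.comm K X X w ⊗ₜ c)) =
        TensorProduct.assoc K X X X (TensorProduct.comm K X (X ⊗[K] X)
          ((TensorProduct.comm K X X).toLinearMap.lTensor X
            (TensorProduct.assoc K X X X ((H.right₃ c).rTensor X w)))) := by
      intro w
      induction w with
      | zero => simp
      | add x y hx hy => simp only [map_add, TensorProduct.add_tmul, hx, hy]
      | tmul p q =>
        simp only [TensorProduct.comm_tmul, TensorProduct.assoc_tmul, LinearMap.lTensor_tmul,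
          LinearMap.rTensor_tmul, right₃_apply, LinearEquiv.coe_coe, LinearEquiv.trans_apply]
        generalize H.T₃ (p ⊗ₜ c) = t
        induction t with
        | zero => simp
        | add x y hx hy => simp only [map_add, TensorProduct.add_tmul, TensorProduct.tmul_add, hx, hy]
        | tmul p q => simp
    exact (h1 _).trans (h.symm.trans (h2 _).symm)

@[simp] theorem cop_mul : H.cop.mul = H.mul := rfl

@[simp] theorem cop_T₁ (w : X ⊗[K] X) : H.cop.T₁ w = TensorProduct.comm K X X (H.T₃ w) := rfl
@[simp] theorem cop_T₃ (w : X ⊗[K] X) : H.cop.T₃ w = TensorProduct.comm K X X (H.T₁ w) := rfl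
@[simp] theorem cop_T₄ (w : X ⊗[K] X) : H.cop.T₄ w = TensorProduct.comm K X X (H.T₂ w) := rfl

theorem multL_cop_comul (x : X) (w : X ⊗[K] X) : multL (H.cop.comul x) w =
    TensorProduct.comm K X X (multL (H.comul x) (TensorProduct.comm K X X w)) := rfl

/-! ### The counit -/

/-- `T₁⁻¹(Δ(x)w) = (x ⊗ 1) T₁⁻¹(w)`, since `T₁(xp ⊗ r) = Δ(x) T₁(p ⊗ r)`. -/
theorem T₁_symm_left (x : X) (w : X ⊗[K] X) :
    H.T₁.symm (multL (H.comul x) w) = (H.mul x).rTensor X (H.T₁.symm w) := by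
  rw [LinearEquiv.symm_apply_eq]
  obtain ⟨w, rfl⟩ := H.T₁.surjective w
  rw [LinearEquiv.symm_apply_apply]
  induction w with
  | zero => simp
  | add x y hx hy => simp only [map_add, hx, hy]
  | tmul p q => rw [← T₁_mul_left]; simp

theorem T₁_map_right (w : X ⊗[K] X) (c : X) :
    H.T₁ ((H.mul.flip c).lTensor X w) = (H.mul.flip c).lTensor X (H.T₁ w) := by
  induction w with
  | zero => simp
  | add x y hx hy => simp only [map_add, hx, hy]
  | tmul p q => rw [← T₁_mul_right]; simp

theorem T₂_map_left (w : X ⊗[K] X) (c : X) :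
    H.T₂ ((H.mul c).rTensor X w) = (H.mul c).rTensor X (H.T₂ w) := by
  induction w with
  | zero => simp
  | add x y hx hy => simp only [map_add, hx, hy]
  | tmul p q => rw [← T₂_mul_left]; simp

theorem T₁_symm_right (w : X ⊗[K] X) (c : X) :
    H.T₁.symm ((H.mul.flip c).lTensor X w) = (H.mul.flip c).lTensor X (H.T₁.symm w) := by
  rw [LinearEquiv.symm_apply_eq, T₁_map_right, LinearEquiv.apply_symm_apply]

/-- With `E = m T₁⁻¹`: `(ι ⊗ E)(v ⊗ b) = m(T₂⁻¹ v) ⊗ b`. Both sides turn out to be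
`(ι ⊗ ε)(v) ⊗ b`. -/
theorem lTensor_mul_T₁_symm (v : X ⊗[K] X) (b : X) :
    (TensorProduct.lift H.mul ∘ₗ H.T₁.symm.toLinearMap).lTensor X
      (TensorProduct.assoc K X X X (v ⊗ₜ b)) = TensorProduct.lift H.mul (H.T₂.symm v) ⊗ₜ b := by
  obtain ⟨v, rfl⟩ := H.T₂.surjective v
  rw [LinearEquiv.symm_apply_apply]
  induction v with
  | zero => simp
  | add x y hx hy => simp only [map_add, TensorProduct.add_tmul, hx, hy]
  | tmul x a =>
    have key : ∀ u : X ⊗[K] X, (TensorProduct.lift H.mul ∘ₗ H.T₁.symm.toLinearMap).lTensor X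
        (TensorProduct.assoc K X X X ((H.left₂ x).rTensor X (H.T₁ u))) =
        (H.mul x).rTensor X (H.T₁ u) := by
      intro u
      induction u with
      | zero => simp
      | add x y hx hy => simp only [map_add, hx, hy]
      | tmul p q =>
        rw [coassoc_left₂_right₁, T₁_left₁, ← LinearMap.comp_apply, ← LinearMap.lTensor_comp]
        congr 2
        ext z
        simp
    have h := key (H.T₁.symm (a ⊗ₜ b))
    rw [LinearEquiv.apply_symm_apply] at h
    simpa using h

/-- Comparing the two sides of `lTensor_mul_T₁_symm` shows that `m T₁⁻¹(q ⊗ b)` is a scalar multiple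
`ε(q) b` of `b`, and `m T₂⁻¹(r ⊗ q)` is `ε(q) r` with the same scalar; this is the counit. -/
theorem exists_isCounit : ∃ ε : X →ₗ[K] K, H.IsCounit ε := by
  rcases subsingleton_or_nontrivial X with hX | hX
  · exact ⟨0, fun a b => Subsingleton.elim _ _, fun a b => Subsingleton.elim _ _⟩
  obtain ⟨p, hp⟩ := exists_ne (0 : X)
  obtain ⟨φ, hφ⟩ := Module.Projective.exists_dual_eq_one K hp
  let ε : X →ₗ[K] K := φ ∘ₗ TensorProduct.lift H.mul ∘ₗ H.T₂.symm.toLinearMap ∘ₗ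
    TensorProduct.mk K X X p
  have h1 : ∀ q b, TensorProduct.lift H.mul (H.T₁.symm (q ⊗ₜ b)) = ε q • b := by
    intro q b
    have h := congrArg (fun w => TensorProduct.lid K X (φ.rTensor X w))
      (H.lTensor_mul_T₁_symm (p ⊗ₜ q) b)
    change _ = φ _ • b
    simpa [hφ] using h
  have h2 : ∀ r q, TensorProduct.lift H.mul (H.T₂.symm (r ⊗ₜ q)) = ε q • r := by
    intro r q
    have h := H.lTensor_mul_T₁_symm (r ⊗ₜ q) p
    have h' := congrArg (fun w => TensorProduct.rid K X (φ.lTensor X w)) h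
    simpa [hφ, h1] using h'.symm
  refine ⟨ε, fun a b => ?_, fun a b => ?_⟩
  · have : ∀ w : X ⊗[K] X, TensorProduct.lid K X (ε.rTensor X w) =
        TensorProduct.lift H.mul (H.T₁.symm w) := by
      intro w
      induction w with
      | zero => simp
      | add x y hx hy => simp only [map_add, hx, hy]
      | tmul q b => simp [h1]
    rw [this, LinearEquiv.symm_apply_apply, TensorProduct.lift.tmul]
  · have : ∀ w : X ⊗[K] X, TensorProduct.rid K X (ε.lTensor X w) =
        TensorProduct.lift H.mul (H.T₂.symm w) := by
      intro w
      induction w with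
      | zero => simp
      | add x y hx hy => simp only [map_add, hx, hy]
      | tmul q b => simp [h2]
    rw [this, LinearEquiv.symm_apply_apply, TensorProduct.lift.tmul]

theorem isCounit_counit : H.IsCounit H.counit := Classical.epsilon_spec H.exists_isCounit

/-- `x ⊗ v ↦ ε(x) v`. -/
def counitL (V : Type*) [AddCommGroup V] [Module K V] : X ⊗[K] V →ₗ[K] V :=
  (TensorProduct.lid K V).toLinearMap ∘ₗ H.counit.rTensor V

@[simp] theorem counitL_tmul (x : X) (v : V) : H.counitL V (x ⊗ₜ v) = H.counit x • v := by
  simp [counitL]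

/-- `v ⊗ x ↦ ε(x) v`. -/
def counitR (V : Type*) [AddCommGroup V] [Module K V] : V ⊗[K] X →ₗ[K] V :=
  (TensorProduct.rid K V).toLinearMap ∘ₗ H.counit.lTensor V

@[simp] theorem counitR_tmul (x : X) (v : V) : H.counitR V (v ⊗ₜ x) = H.counit x • v := by
  simp [counitR]

theorem counitL_T₁ (a b : X) : H.counitL X (H.T₁ (a ⊗ₜ b)) = H.mul a b := H.isCounit_counit.1 a b

theorem counitR_T₂ (a b : X) : H.counitR X (H.T₂ (a ⊗ₜ b)) = H.mul a b := H.isCounit_counit.2 a b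

theorem counitL_lTensor {W : Type*} [AddCommGroup W] [Module K W] (f : V →ₗ[K] W) (w : X ⊗[K] V) :
    H.counitL W (f.lTensor X w) = f (H.counitL V w) := by
  induction w with
  | zero => simp
  | add x y hx hy => simp only [map_add, hx, hy]
  | tmul q b => simp

theorem counitR_rTensor {W : Type*} [AddCommGroup W] [Module K W] (f : V →ₗ[K] W) (w : V ⊗[K] X) :
    H.counitR W (f.rTensor X w) = f (H.counitR V w) := by
  induction w with
  | zero => simp
  | add x y hx hy => simp only [map_add, hx, hy]
  | tmul q b => simp

/-- Uniqueness of the counit; the half of the definition that concerns `T₁` suffices. -/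
theorem counit_eq_of_isCounit {ε : X →ₗ[K] K} (h : ∀ a b, TensorProduct.lid K X
    (ε.rTensor X (H.T₁ (a ⊗ₜ b))) = H.mul a b) : ε = H.counit := by
  have h1 : ∀ w : X ⊗[K] X, TensorProduct.lid K X (ε.rTensor X (H.T₁ w)) =
      H.counitL X (H.T₁ w) := by
    intro w
    induction w with
    | zero => simp
    | add x y hx hy => simp only [map_add, hx, hy]
    | tmul q b => rw [h, counitL_T₁]
  ext x
  by_cases hX : x = 0
  · simp [hX]
  have h2 := h1 (H.T₁.symm (x ⊗ₜ x))
  rw [LinearEquiv.apply_symm_apply] at h2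
  have h3 : ε x • x = H.counit x • x := by simpa using h2
  exact smul_left_injective K hX h3

theorem counitR_mul_left (q : X) (w : X ⊗[K] X) :
    H.counitR X ((H.mul q).lTensor X w) = H.counit q • H.counitR X w := by
  have h1 : ∀ (b : X) (w : X ⊗[K] X), H.counitR X (multR (H.comul b) (H.T₂ w)) =
      H.mul (H.counitR X (H.T₂ w)) b := by
    intro b w
    induction w with
    | zero => simp
    | add x y hx hy => simp only [map_add, LinearMap.add_apply, hx, hy]
    | tmul x a => rw [← T₂_mul_right, counitR_T₂, counitR_T₂, H.mul_assoc]
  obtain ⟨w, rfl⟩ := H.T₂.surjective w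
  induction w with
  | zero => simp
  | add x y hx hy => simp only [map_add, smul_add, hx, hy]
  | tmul p b =>
    have h2 := h1 b (H.T₂.symm (p ⊗ₜ q))
    rw [LinearEquiv.apply_symm_apply, multR_comul_eq₂] at h2
    rw [h2, counitR_T₂]
    simp

theorem counit_mul (a b : X) : H.counit (H.mul a b) = H.counit a * H.counit b := by
  by_cases hX : a = 0
  · simp [hX]
  have h := H.counitR_mul_left a (a ⊗ₜ b)
  have h3 : H.counit (H.mul a b) • a = (H.counit a * H.counit b) • a := by
    simpa [mul_smul] using h
  exact smul_left_injective K hX h3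

theorem counitL_mul_left (x : X) (w : X ⊗[K] V) :
    H.counitL V ((H.mul x).rTensor V w) = H.counit x • H.counitL V w := by
  induction w with
  | zero => simp
  | add x y hx hy => simp only [map_add, smul_add, hx, hy]
  | tmul p b => simp [counit_mul, mul_smul]

theorem counitL_mul_right (x : X) (w : X ⊗[K] V) :
    H.counitL V ((H.mul.flip x).rTensor V w) = H.counit x • H.counitL V w := by
  induction w with
  | zero => simp
  | add x y hx hy => simp only [map_add, smul_add, hx, hy]
  | tmul p b =>
    simp only [LinearMap.rTensor_tmul, LinearMap.flip_apply, counitL_tmul, counit_mul]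
    rw [mul_comm, mul_smul]

theorem counitR_mul_right (x : X) (w : V ⊗[K] X) :
    H.counitR V ((H.mul.flip x).lTensor V w) = H.counit x • H.counitR V w := by
  induction w with
  | zero => simp
  | add x y hx hy => simp only [map_add, smul_add, hx, hy]
  | tmul p b =>
    simp only [LinearMap.lTensor_tmul, LinearMap.flip_apply, counitR_tmul, counit_mul]
    rw [mul_comm, mul_smul]

theorem counitR_T₃ (a b : X) : H.counitR X (H.T₃ (a ⊗ₜ b)) = H.mul a b := by
  rw [← sub_eq_zero]
  apply H.nondeg_right
  intro c
  rw [map_sub, ← counitR_rTensor, T₃_left₁, counitR_rTensor, counitR_T₂]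
  simp [H.mul_assoc]

theorem counitL_T₃ (a b : X) : H.counitL X (H.T₃ (a ⊗ₜ b)) = H.counit b • a := by
  rw [← sub_eq_zero]
  apply H.nondeg_left
  intro c
  have h := H.counitL_lTensor (H.mul.flip c) (H.T₃ (a ⊗ₜ b))
  rw [T₃_right₂, counitL_mul_right, counitL_T₁] at h
  rw [map_sub, LinearMap.sub_apply, ← LinearMap.flip_apply H.mul, ← h]
  simp

theorem counitR_T₁ (a b : X) : H.counitR X (H.T₁ (a ⊗ₜ b)) = H.counit b • a := by
  rw [← sub_eq_zero]
  apply H.nondeg_left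
  intro c
  have h := H.counitR_rTensor (H.mul.flip c) (H.T₁ (a ⊗ₜ b))
  rw [← T₃_right₂, counitR_mul_right, counitR_T₃] at h
  rw [map_sub, LinearMap.sub_apply, ← LinearMap.flip_apply H.mul, ← h]
  simp

theorem cop_counit : H.cop.counit = H.counit := by
  symm
  apply counit_eq_of_isCounit
  intro a b
  have h : ∀ w : X ⊗[K] X, TensorProduct.lid K X (H.counit.rTensor X (TensorProduct.comm K X X w)) =
      H.counitR X w := by
    intro w
    induction w with
    | zero => simp
    | add x y hx hy => simp only [map_add, hx, hy]
    | tmul p b => simp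
  rw [cop_T₁, h, counitR_T₃]
  rfl

/-! ### The antipode -/

/-- Every element `a` is of the form `a e`. -/
theorem exists_mul_eq_self (a : X) : ∃ e, H.mul a e = a := by
  by_cases ha : a = 0
  · exact ⟨0, by simp [ha]⟩
  obtain ⟨φ, hφ⟩ := Module.Projective.exists_dual_eq_one K ha
  have h1 : (LinearMap.range (H.mul a)).mkQ.rTensor X (H.T₂ (a ⊗ₜ a)) = 0 := by
    apply H.lTensor_cancel_right
    intro q
    rw [map_zero, lTensor_rTensor_comm, ← T₁_left₁, ← LinearMap.comp_apply,
      ← LinearMap.rTensor_comp]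
    have : (LinearMap.range (H.mul a)).mkQ ∘ₗ H.mul a = 0 := by
      ext x
      simp
    rw [this]
    simp
  have h2 := (rTensor_exact X (LinearMap.exact_map_mkQ_range (H.mul a))
    (Submodule.mkQ_surjective _) _).1 h1
  obtain ⟨w, hw⟩ := h2
  obtain ⟨w, rfl⟩ := H.T₂.surjective w
  rw [← T₂_map_left] at hw
  have h3 := congrArg (fun w => TensorProduct.rid K X (φ.lTensor X w)) (H.T₂.injective hw)
  refine ⟨TensorProduct.rid K X (φ.lTensor X w), ?_⟩
  beta_reduce at h3
  rw [lTensor_rTensor_comm] at h3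
  have h4 : ∀ w : X ⊗[K] K, TensorProduct.rid K X ((H.mul a).rTensor K w) =
      H.mul a (TensorProduct.rid K X w) := by
    intro w
    induction w with
    | zero => simp
    | add x y hx hy => simp only [map_add, hx, hy]
    | tmul p b => simp
  have h5 : TensorProduct.rid K X (φ.lTensor X (a ⊗ₜ a)) = a := by simp [hφ]
  rw [← h4, h3, h5]

/-- The counit takes the value one, unless the algebra is zero. -/
theorem exists_counit_eq_one [Nontrivial X] : ∃ u, H.counit u = 1 := by
  by_contra! hne
  have h0 : ∀ x, H.counit x = 0 := by
    intro x
    by_contra hx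
    exact hne ((H.counit x)⁻¹ • x) (by simp [hx])
  obtain ⟨a, ha⟩ := exists_ne (0 : X)
  apply ha
  apply H.nondeg_left
  intro b
  rw [← counitL_T₁]
  have : H.counit = 0 := LinearMap.ext h0
  simp [counitL, this]

/-- The linear map underlying the antipode, determined by
`(ε ⊗ ι)(T₁⁻¹(Δ(a)(b ⊗ 1))) = ε(a) S(b)`. -/
theorem exists_antipode_aux : ∃ S : X →ₗ[K] X,
    ∀ a b, H.counitL X (H.T₁.symm (H.T₃ (a ⊗ₜ b))) = H.counit a • S b := by
  rcases subsingleton_or_nontrivial X with hX | hX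
  · exact ⟨0, fun a b => Subsingleton.elim _ _⟩
  obtain ⟨u, hu⟩ := H.exists_counit_eq_one
  let Q : X ⊗[K] X →ₗ[K] X := H.counitL X ∘ₗ H.T₁.symm.toLinearMap ∘ₗ H.T₃.toLinearMap
  refine ⟨Q ∘ₗ TensorProduct.mk K X X u, fun a b => ?_⟩
  have h1 : ∀ x a, Q (H.mul x a ⊗ₜ b) = H.counit x • Q (a ⊗ₜ b) := by
    intro x a
    simp only [Q, LinearMap.comp_apply, LinearEquiv.coe_coe]
    rw [T₃_mul_left, T₁_symm_left, counitL_mul_left]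
  obtain ⟨e, he⟩ := H.exists_mul_eq_self (a - H.counit a • u)
  have h2 : Q ((a - H.counit a • u) ⊗ₜ b) = 0 := by
    rw [← he, h1]
    simp [hu]
  rw [TensorProduct.sub_tmul, map_sub, sub_eq_zero, ← TensorProduct.smul_tmul', map_smul] at h2
  exact h2

/-- `S(p)q = (ε ⊗ ι)(T₁⁻¹(p ⊗ q))`. -/
theorem antipode_aux_mul {S : X →ₗ[K] X}
    (hS : ∀ a b, H.counitL X (H.T₁.symm (H.T₃ (a ⊗ₜ b))) = H.counit a • S b) (p q : X) :
    H.mul (S p) q = H.counitL X (H.T₁.symm (p ⊗ₜ q)) := by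
  rcases subsingleton_or_nontrivial X with hX | hX
  · exact Subsingleton.elim _ _
  obtain ⟨u, hu⟩ := H.exists_counit_eq_one
  have h := hS u p
  rw [hu, one_smul] at h
  rw [← h, ← LinearMap.flip_apply H.mul, ← counitL_lTensor, ← T₁_symm_right, ← multL_comul_eq₃,
    T₁_symm_left, counitL_mul_left, hu, one_smul]

/-- `m(S ⊗ ι)(Δ(a)(1 ⊗ b)) = ε(a)b`. -/
theorem antipode_aux_T₁ {S : X →ₗ[K] X}
    (hS : ∀ p q, H.mul (S p) q = H.counitL X (H.T₁.symm (p ⊗ₜ q))) (a b : X) :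
    TensorProduct.lift (H.mul ∘ₗ S) (H.T₁ (a ⊗ₜ b)) = H.counit a • b := by
  have h : ∀ w : X ⊗[K] X, TensorProduct.lift (H.mul ∘ₗ S) w = H.counitL X (H.T₁.symm w) := by
    intro w
    induction w with
    | zero => simp
    | add x y hx hy => simp only [map_add, hx, hy]
    | tmul p b => simp [hS]
  rw [h, LinearEquiv.symm_apply_apply, counitL_tmul]

/-- `m(ι ⊗ S)((a ⊗ 1)Δ(b)) = ε(b)a`. -/
theorem antipode_aux_T₂ {S : X →ₗ[K] X}
    (hS : ∀ p q, H.mul (S p) q = H.counitL X (H.T₁.symm (p ⊗ₜ q))) (a b : X) :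
    TensorProduct.lift (H.mul.compl₂ S) (H.T₂ (a ⊗ₜ b)) = H.counit b • a := by
  rw [← sub_eq_zero]
  apply H.nondeg_left
  intro q
  -- `T₂` on the legs 1, 2 commutes with `T₁⁻¹` on the legs 2, 3.
  have h1 : ∀ u : X ⊗[K] X, TensorProduct.lift (H.mul.compl₂ (H.counitL X ∘ₗ H.T₁.symm.toLinearMap))
      (TensorProduct.assoc K X X X ((H.left₂ a).rTensor X (H.T₁ u))) =
        H.mul a (TensorProduct.lift H.mul u) := by
    intro u
    induction u with
    | zero => simp
    | add x y hx hy => simp only [map_add, hx, hy]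
    | tmul s t =>
      rw [coassoc_left₂_right₁]
      have h2 : ∀ w : X ⊗[K] X, TensorProduct.lift
          (H.mul.compl₂ (H.counitL X ∘ₗ H.T₁.symm.toLinearMap)) ((H.right₁ t).lTensor X w) =
          H.mul (H.counitR X w) t := by
        intro w
        induction w with
        | zero => simp
        | add x y hx hy => simp only [map_add, LinearMap.add_apply, hx, hy]
        | tmul p b => simp
      rw [h2, counitR_T₂]
      simp [H.mul_assoc]
  have h3 : ∀ w : X ⊗[K] X, H.mul (TensorProduct.lift (H.mul.compl₂ S) w) q =
      TensorProduct.lift (H.mul.compl₂ (H.counitL X ∘ₗ H.T₁.symm.toLinearMap))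
      (TensorProduct.assoc K X X X (w ⊗ₜ q)) := by
    intro w
    induction w with
    | zero => simp
    | add x y hx hy => simp only [map_add, LinearMap.add_apply, TensorProduct.add_tmul, hx, hy]
    | tmul p b => simp [H.mul_assoc, hS]
  have h4 : ∀ w : X ⊗[K] X, TensorProduct.lift H.mul (H.T₁.symm w) = H.counitL X w := by
    intro w
    obtain ⟨w, rfl⟩ := H.T₁.surjective w
    rw [LinearEquiv.symm_apply_apply]
    induction w with
    | zero => simp
    | add x y hx hy => simp only [map_add, hx, hy]
    | tmul p b => simp [counitL_T₁]
  have h5 := h1 (H.T₁.symm (b ⊗ₜ q))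
  rw [LinearEquiv.apply_symm_apply, h4] at h5
  rw [map_sub, LinearMap.sub_apply, h3, sub_eq_zero]
  simpa using h5

/-- The maps `T₁⁻¹T₃` of the algebra and of its co-opposite are inverse to each other, hence so are
the antipodes. -/
theorem antipode_aux_comp {S S' : X →ₗ[K] X}
    (hS : ∀ a b, H.counitL X (H.T₁.symm (H.T₃ (a ⊗ₜ b))) = H.counit a • S b)
    (hS' : ∀ a b, H.counitL X (H.T₃.symm (H.T₁ (a ⊗ₜ b))) = H.counit a • S' b) (b : X) :
    S (S' b) = b := by
  rcases subsingleton_or_nontrivial X with hX | hX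
  · exact Subsingleton.elim _ _
  obtain ⟨u, hu⟩ := H.exists_counit_eq_one
  have h : ∀ w : X ⊗[K] X, H.counitL X (H.T₁.symm (H.T₃ w)) = S (H.counitL X w) := by
    intro w
    induction w with
    | zero => simp
    | add x y hx hy => simp only [map_add, hx, hy]
    | tmul p b => simp [hS]
  have h2 := h (H.T₃.symm (H.T₁ (u ⊗ₜ b)))
  rw [LinearEquiv.apply_symm_apply, LinearEquiv.symm_apply_apply, hS', hu] at h2
  simpa [hu] using h2.symm

theorem cop_T₁_symm_T₃ (w : X ⊗[K] X) : H.cop.T₁.symm (H.cop.T₃ w) = H.T₃.symm (H.T₁ w) := by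
  rw [LinearEquiv.symm_apply_eq, cop_T₁, LinearEquiv.apply_symm_apply, cop_T₃]

theorem cop_T₃_symm_T₁ (w : X ⊗[K] X) : H.cop.T₃.symm (H.cop.T₁ w) = H.T₁.symm (H.T₃ w) := by
  rw [LinearEquiv.symm_apply_eq, cop_T₃, LinearEquiv.apply_symm_apply, cop_T₁]

theorem cop_counitL (w : X ⊗[K] V) : H.cop.counitL V w = H.counitL V w := by
  simp [counitL, cop_counit]

theorem exists_isAntipode : ∃ S : X ≃ₗ[K] X, H.IsAntipode S := by
  obtain ⟨S, hS⟩ := H.exists_antipode_aux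
  obtain ⟨S', hS'⟩ := H.cop.exists_antipode_aux
  have hS'' := hS'
  simp only [cop_T₁_symm_T₃, cop_counitL, cop_counit] at hS''
  have h1 := H.antipode_aux_comp hS hS''
  have h2 := H.cop.antipode_aux_comp hS' (S' := S) (by
    simpa only [cop_T₃_symm_T₁, cop_counitL, cop_counit] using hS)
  let e : X ≃ₗ[K] X := LinearEquiv.ofLinearMap S S' (LinearMap.ext h1) (LinearMap.ext h2)
  exact ⟨e, H.antipode_aux_T₁ (H.antipode_aux_mul hS), H.antipode_aux_T₂ (H.antipode_aux_mul hS)⟩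

theorem isAntipode_antipode : H.IsAntipode H.antipode :=
  @Classical.epsilon_spec _ H.IsAntipode H.exists_isAntipode

/-- `S(p)q = (ε ⊗ ι)(T₁⁻¹(p ⊗ q))`. -/
theorem antipode_mul_eq (p q : X) :
    H.mul (H.antipode p) q = H.counitL X (H.T₁.symm (p ⊗ₜ q)) := by
  have h : ∀ w : X ⊗[K] X, TensorProduct.lift (H.mul ∘ₗ H.antipode.toLinearMap) (H.T₁ w) =
      H.counitL X w := by
    intro w
    induction w with
    | zero => simp
    | add x y hx hy => simp only [map_add, hx, hy]
    | tmul p b => simp [H.isAntipode_antipode.1]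
  have h2 := h (H.T₁.symm (p ⊗ₜ q))
  rw [LinearEquiv.apply_symm_apply] at h2
  simpa using h2

/-- `(ε ⊗ ι)(T₁⁻¹(Δ(a)(b ⊗ 1))) = ε(a) S(b)`. -/
theorem antipode_T₃ (a b : X) :
    H.counitL X (H.T₁.symm (H.T₃ (a ⊗ₜ b))) = H.counit a • H.antipode b := by
  obtain ⟨S, hS⟩ := H.exists_antipode_aux
  have : ∀ b, S b = H.antipode b := by
    intro b
    rw [← sub_eq_zero]
    apply H.nondeg_left
    intro q
    rw [map_sub, LinearMap.sub_apply, antipode_mul_eq, H.antipode_aux_mul hS, sub_self]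
  rw [hS, this]

/-- `S(a₍₁₎ b) a₍₂₎ = ε(a) S(b)`. -/
theorem antipode_lift_T₃ (a b : X) :
    TensorProduct.lift (H.mul ∘ₗ H.antipode.toLinearMap) (H.T₃ (a ⊗ₜ b)) =
      H.counit a • H.antipode b := by
  rw [← antipode_T₃]
  generalize H.T₃ (a ⊗ₜ b) = w
  induction w with
  | zero => simp
  | add x y hx hy => simp only [map_add, hx, hy]
  | tmul p b => simp [antipode_mul_eq]

/-- The antipode of the co-opposite is `S⁻¹`, as `T₁⁻¹T₃` is replaced by its inverse `T₃⁻¹T₁`. -/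
theorem cop_antipode : H.cop.antipode = H.antipode.symm := by
  ext x
  rw [LinearEquiv.eq_symm_apply]
  refine H.antipode_aux_comp (S := H.antipode.toLinearMap) (S' := H.cop.antipode.toLinearMap)
    H.antipode_T₃ ?_ x
  intro a b
  have := H.cop.antipode_T₃ a b
  rwa [cop_T₁_symm_T₃, cop_counitL, cop_counit] at this

theorem antipode_mul (p p' : X) :
    H.antipode (H.mul p p') = H.mul (H.antipode p') (H.antipode p) := by
  have h : ∀ w : X ⊗[K] X, H.counitL X (H.T₁.symm ((H.mul.flip p').rTensor X (H.T₁ w))) =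
      H.mul (H.antipode p') (H.counitL X w) := by
    intro w
    induction w with
    | zero => simp
    | add x y hx hy => simp only [map_add, hx, hy]
    | tmul c d =>
      rw [← multL_comul_eq₁, T₁_symm_left, counitL_mul_left, ← antipode_mul_eq]
      simp
  rw [← sub_eq_zero]
  apply H.nondeg_left
  intro q
  have h2 := h (H.T₁.symm (p ⊗ₜ q))
  rw [LinearEquiv.apply_symm_apply, ← antipode_mul_eq] at h2
  rw [map_sub, LinearMap.sub_apply, H.mul_assoc, ← h2, antipode_mul_eq]
  simp

end RegularMultiplierHopfAlgebra

namespace RegularMultiplierHopfAlgebra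

variable {K X Z Z' Z'' W W' : Type*} [Field K] [AddCommGroup X] [Module K X]
  [AddCommGroup Z] [Module K Z] [AddCommGroup Z'] [Module K Z'] [AddCommGroup Z''] [Module K Z'']
  [AddCommGroup W] [Module K W] [AddCommGroup W'] [Module K W']
  (H : RegularMultiplierHopfAlgebra K X)

/-! ### Colinear maps between free comodules -/

/-- The coaction `x ⊗ z ↦ x₍₂₎ y ⊗ x₍₁₎ ⊗ z` of the free comodule `X ⊗ Z`, covered by `y`. -/
def coact (Z : Type*) [AddCommGroup Z] [Module K Z] (y : X) : X ⊗[K] Z →ₗ[K] X ⊗[K] (X ⊗[K] Z) :=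
  (TensorProduct.assoc K X X Z).toLinearMap ∘ₗ
    ((TensorProduct.comm K X X).toLinearMap ∘ₗ H.right₁ y).rTensor Z

/-- Linear maps `X ⊗ Z → X ⊗ Z'` that respect the coactions. -/
def Colin (t : X ⊗[K] Z →ₗ[K] X ⊗[K] Z') : Prop :=
  ∀ y w, t.lTensor X (H.coact Z y w) = H.coact Z' y (t w)

/-- Applying `ε` to the inner copy of `X` recovers `x ⊗ z`, covered by `y`; so a colinear map is
determined by its composite with `ε ⊗ ι`. -/
theorem counitL_coact (y : X) (w : X ⊗[K] Z) :
    (H.counitL Z).lTensor X (H.coact Z y w) = (H.mul.flip y).rTensor Z w := by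
  induction w with
  | zero => simp
  | add x y hx hy => simp only [map_add, hx, hy]
  | tmul x z =>
    have h : ∀ u : X ⊗[K] X, (H.counitL Z).lTensor X
        (TensorProduct.assoc K X X Z (TensorProduct.comm K X X u ⊗ₜ z)) = H.counitL X u ⊗ₜ z := by
      intro u
      induction u with
      | zero => simp
      | add x y hx hy => simp only [map_add, TensorProduct.add_tmul, hx, hy]
      | tmul p q => simp [TensorProduct.smul_tmul]
    simp [coact, h, counitL_T₁]

namespace Colin

variable {H}

theorem comp {u : X ⊗[K] Z' →ₗ[K] X ⊗[K] Z''} {t : X ⊗[K] Z →ₗ[K] X ⊗[K] Z'} (hu : H.Colin u)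
    (ht : H.Colin t) : H.Colin (u ∘ₗ t) := by
  intro y w
  rw [LinearMap.comp_apply, ← hu, ← ht, LinearMap.lTensor_comp, LinearMap.comp_apply]

theorem lTensor (f : Z →ₗ[K] Z') : H.Colin (f.lTensor X) := by
  intro y w
  induction w with
  | zero => simp
  | add x y hx hy => simp only [map_add, hx, hy]
  | tmul x z =>
    simp only [coact, LinearMap.comp_apply, LinearMap.rTensor_tmul, LinearMap.lTensor_tmul,
      LinearEquiv.coe_coe]
    generalize TensorProduct.comm K X X _ = u
    induction u with
    | zero => simp
    | add x y hx hy => simp only [map_add, TensorProduct.add_tmul, hx, hy]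
    | tmul p q => simp

/-- A colinear map is determined by its composite with `ε ⊗ ι`. -/
theorem ext {t u : X ⊗[K] Z →ₗ[K] X ⊗[K] Z'} (ht : H.Colin t) (hu : H.Colin u)
    (h : ∀ x z, H.counitL Z' (t (x ⊗ₜ z)) = H.counitL Z' (u (x ⊗ₜ z))) : t = u := by
  have h' : H.counitL Z' ∘ₗ t = H.counitL Z' ∘ₗ u := TensorProduct.ext' h
  refine TensorProduct.ext' fun x z => ?_
  apply H.rTensor_cancel_right
  intro y
  rw [← counitL_coact, ← counitL_coact]
  rw [← ht, ← hu]
  simp only [← LinearMap.lTensor_comp_apply, h']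

end Colin

/-! ### Twist maps -/

/-- For a linear family `α` of maps, `z ↦ p ⊗ q ↦ q ⊗ α(p)(z)`. -/
def swapApply (α : X →ₗ[K] Z →ₗ[K] Z') : Z →ₗ[K] X ⊗[K] X →ₗ[K] X ⊗[K] Z' :=
  LinearMap.llcomp K _ _ _ (TensorProduct.comm K Z' X).toLinearMap ∘ₗ
    LinearMap.rTensorHom X ∘ₗ α.flip

@[simp] theorem swapApply_tmul (α : X →ₗ[K] Z →ₗ[K] Z') (z : Z) (p q : X) :
    swapApply α z (p ⊗ₜ q) = q ⊗ₜ α p z := by simp [swapApply]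

/-- `t` is the map `x ⊗ z ↦ x₍₂₎ ⊗ α(x₍₁₎)(z)`: the colinear map that composes with `ε ⊗ ι` to `α`. -/
structure IsTw (α : X →ₗ[K] Z →ₗ[K] Z') (t : X ⊗[K] Z →ₗ[K] X ⊗[K] Z') : Prop where
  colin : H.Colin t
  counit : ∀ x z, H.counitL Z' (t (x ⊗ₜ z)) = α x z

/-- `x ⊗ z ↦ x₍₂₎ ⊗ α(x₍₁₎)(z)`. -/
def tw (α : X →ₗ[K] Z →ₗ[K] Z) : X ⊗[K] Z →ₗ[K] X ⊗[K] Z :=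
  (TensorProduct.comm K Z X).toLinearMap ∘ₗ H.twist α

theorem lTensor_assoc_comm (f : X ⊗[K] Z →ₗ[K] Z') (z : Z) (u : X ⊗[K] X) (α : X →ₗ[K] Z →ₗ[K] Z')
    (h : ∀ x, f (x ⊗ₜ z) = α x z) :
    f.lTensor X (TensorProduct.assoc K X X Z (TensorProduct.comm K X X u ⊗ₜ z)) =
      swapApply α z u := by
  induction u with
  | zero => simp
  | add x y hx hy => simp only [map_add, TensorProduct.add_tmul, hx, hy]
  | tmul p q => simp [h]

theorem IsTw.cover {H : RegularMultiplierHopfAlgebra K X} {α : X →ₗ[K] Z →ₗ[K] Z'}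
    {t : X ⊗[K] Z →ₗ[K] X ⊗[K] Z'} (h : H.IsTw α t) (x : X) (z : Z) (y : X) :
    (H.mul.flip y).rTensor Z' (t (x ⊗ₜ z)) = swapApply α z (H.T₁ (x ⊗ₜ y)) := by
  rw [← counitL_coact, ← h.colin, ← LinearMap.comp_apply, ← LinearMap.lTensor_comp]
  have h2 := lTensor_assoc_comm (H.counitL Z' ∘ₗ t) z (H.T₁ (x ⊗ₜ y)) α
    (fun x => by simp [h.counit])
  simpa [coact] using h2

/-- `a ↦ w ↦ Δ(a)w`. -/
def comulHom : X →ₗ[K] X ⊗[K] X →ₗ[K] X ⊗[K] X :=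
  LinearMap.fst K _ _ ∘ₗ (multiplierAlgebra (tensorMul H.mul)).val.toLinearMap ∘ₗ H.comul

@[simp] theorem comulHom_apply (a : X) (w : X ⊗[K] X) :
    H.comulHom a w = multL (H.comul a) w := rfl

/-- The pentagon relation `x₍₁₎ ⊗ Δ(x₍₂₎)Δ(p)(1 ⊗ r) = x₍₁₎ ⊗ Δ(x₍₂₎p)(1 ⊗ r)`. The left side is
given its meaning by `x₍₁₎ ⊗ Δ(x₍₂₎)(y ⊗ w) = x₍₁₎ ⊗ x₍₂₎ y ⊗ x₍₃₎ w`. -/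
theorem pentagon (x p r : X) :
    TensorProduct.assoc K X X X (TensorProduct.lift ((LinearMap.rTensorHom X ∘ₗ H.right₁).compl₂
      (TensorProduct.curry H.T₁.toLinearMap x)) (H.T₁ (p ⊗ₜ r))) =
    (H.right₁ r).lTensor X (H.T₁ (x ⊗ₜ p)) := by
  apply H.rTensor_cancel_left
  intro c
  have h1 : (H.mul c).rTensor (X ⊗[K] X) ((H.right₁ r).lTensor X (H.T₁ (x ⊗ₜ p))) =
      (H.comulHom.flip (H.T₁ (p ⊗ₜ r))).lTensor X (H.T₂ (c ⊗ₜ x)) := by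
    rw [← lTensor_rTensor_comm, T₁_left₁, ← LinearMap.comp_apply, ← LinearMap.lTensor_comp]
    congr 2
    ext v
    simp [T₁_mul_left]
  rw [h1]
  generalize H.T₁ (p ⊗ₜ r) = u
  induction u with
  | zero => simp
  | add a b ha hb => simp only [map_add, ha, hb, LinearMap.lTensor_add, LinearMap.add_apply]
  | tmul y w =>
    have h2 : ∀ u : X ⊗[K] X, (H.mul c).rTensor (X ⊗[K] X)
        (TensorProduct.assoc K X X X ((H.right₁ y).rTensor X u)) =
        ((H.mul.flip y).rTensor X).lTensor X
          (TensorProduct.assoc K X X X ((H.left₂ c).rTensor X u)) := by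
      intro u
      induction u with
      | zero => simp
      | add x y hx hy => simp only [map_add, hx, hy]
      | tmul a b =>
        have h3 : ∀ t : X ⊗[K] X, (H.mul c).rTensor (X ⊗[K] X)
            (TensorProduct.assoc K X X X (t ⊗ₜ b)) =
            TensorProduct.assoc K X X X ((H.mul c).rTensor X t ⊗ₜ b) := by
          intro t
          induction t with
          | zero => simp
          | add x y hx hy => simp only [map_add, TensorProduct.add_tmul, hx, hy]
          | tmul a b => simp
        have h4 : ∀ t : X ⊗[K] X, ((H.mul.flip y).rTensor X).lTensor X
            (TensorProduct.assoc K X X X (t ⊗ₜ b)) =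
            TensorProduct.assoc K X X X ((H.mul.flip y).lTensor X t ⊗ₜ b) := by
          intro t
          induction t with
          | zero => simp
          | add x y hx hy => simp only [map_add, TensorProduct.add_tmul, hx, hy]
          | tmul a b => simp
        simp only [LinearMap.rTensor_tmul, h3, h4, right₁_apply, left₂_apply, T₁_left₁]
    have h5 := h2 (H.T₁ (x ⊗ₜ w))
    rw [coassoc_left₂_right₁, ← LinearMap.lTensor_comp_apply] at h5
    refine h5.trans ?_
    congr 2
    ext v
    simp [multL_comul_eq₁]

/-- A map is of the form `x ⊗ z ↦ x₍₂₎ ⊗ α(x₍₁₎)(z)` as soon as it is so after covering. -/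
theorem IsTw.of_cover {α : X →ₗ[K] Z →ₗ[K] Z'} {t : X ⊗[K] Z →ₗ[K] X ⊗[K] Z'}
    (h : ∀ x z y, (H.mul.flip y).rTensor Z' (t (x ⊗ₜ z)) = swapApply α z (H.T₁ (x ⊗ₜ y))) :
    H.IsTw α t := by
  constructor
  · intro w0 v
    induction v with
    | zero => simp
    | add x y hx hy => simp only [map_add, hx, hy]
    | tmul x z =>
      apply eq_of_forall_lTensor (fun y => (H.mul.flip y).rTensor Z')
      · intro a ha
        apply H.rTensor_cancel_right
        intro y
        rw [ha, map_zero]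
      intro y0
      -- `Ξ (a ⊗ b ⊗ c) = c ⊗ b ⊗ α(a)(z)`
      let Ξ : X ⊗[K] (X ⊗[K] X) →ₗ[K] X ⊗[K] (X ⊗[K] Z') :=
        (TensorProduct.assoc K X X Z').toLinearMap ∘ₗ
          (TensorProduct.comm K X X).toLinearMap.rTensor Z' ∘ₗ
          (TensorProduct.comm K Z' (X ⊗[K] X)).toLinearMap ∘ₗ (α.flip z).rTensor (X ⊗[K] X)
      have hL : ∀ y w, ((H.mul.flip y).rTensor Z').lTensor X (t.lTensor X (H.coact Z w (x ⊗ₜ z))) =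
          Ξ (TensorProduct.assoc K X X X ((H.right₁ y).rTensor X (H.T₁ (x ⊗ₜ w)))) := by
        intro y w
        simp only [coact, LinearMap.comp_apply, LinearMap.rTensor_tmul, right₁_apply,
          LinearEquiv.coe_coe]
        generalize H.T₁ (x ⊗ₜ w) = u
        induction u with
        | zero => simp
        | add x y hx hy => simp only [map_add, TensorProduct.add_tmul, hx, hy]
        | tmul p q =>
          simp only [TensorProduct.comm_tmul, TensorProduct.assoc_tmul, LinearMap.lTensor_tmul,
            LinearMap.rTensor_tmul, right₁_apply, h]
          generalize H.T₁ (p ⊗ₜ y) = u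
          induction u with
          | zero => simp
          | add x y hx hy => simp only [map_add, TensorProduct.add_tmul, TensorProduct.tmul_add, hx, hy]
          | tmul p q => simp [Ξ]
      let Ψ : X ⊗[K] X →ₗ[K] X ⊗[K] Z' →ₗ[K] X ⊗[K] (X ⊗[K] Z') :=
        LinearMap.llcomp K _ _ _ ((TensorProduct.assoc K X X Z').toLinearMap ∘ₗ
          (TensorProduct.comm K X X).toLinearMap.rTensor Z') ∘ₗ
          LinearMap.rTensorHom Z' ∘ₗ H.comulHom.flip
      have hΨ : ∀ u a b, Ψ u (a ⊗ₜ b) = TensorProduct.assoc K X X Z'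
          (TensorProduct.comm K X X (multL (H.comul a) u) ⊗ₜ b) := fun u a b => rfl
      have hR : ∀ y w v, ((H.mul.flip y).rTensor Z').lTensor X (H.coact Z' w v) = Ψ (y ⊗ₜ w) v := by
        intro y w v
        induction v with
        | zero => simp
        | add x y hx hy => simp only [map_add, hx, hy]
        | tmul a b =>
          rw [hΨ, multL_comul_eq₁]
          simp only [coact, LinearMap.comp_apply, LinearMap.rTensor_tmul, right₁_apply,
            LinearEquiv.coe_coe]
          generalize H.T₁ (a ⊗ₜ w) = u
          induction u with
          | zero => simp
          | add x y hx hy => simp only [map_add, TensorProduct.add_tmul, hx, hy]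
          | tmul p q => simp
      have hΨ₁ : ∀ p r v, Ψ (H.T₁ (p ⊗ₜ r)) v = H.coact Z' r ((H.mul.flip p).rTensor Z' v) := by
        intro p r v
        induction v with
        | zero => simp
        | add x y hx hy => simp only [map_add, hx, hy]
        | tmul a b => simp [hΨ, coact, T₁_mul_left]
      have hΞ : ∀ r u, Ξ ((H.right₁ r).lTensor X u) = H.coact Z' r (swapApply α z u) := by
        intro r u
        induction u with
        | zero => simp
        | add x y hx hy => simp only [map_add, hx, hy]
        | tmul a b => simp [Ξ, coact]
      -- The two sides as functions of `y₀ ⊗ w₀`; it suffices to compare them on `T₁ (p ⊗ r)`.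
      have key : ∀ u, Ξ (TensorProduct.assoc K X X X (TensorProduct.lift
          ((LinearMap.rTensorHom X ∘ₗ H.right₁).compl₂ (TensorProduct.curry H.T₁.toLinearMap x)) u)) =
          Ψ u (t (x ⊗ₜ z)) := by
        intro u
        obtain ⟨u, rfl⟩ := H.T₁.surjective u
        induction u with
        | zero => simp
        | add x y hx hy => simp only [map_add, LinearMap.add_apply, hx, hy]
        | tmul p r => rw [pentagon, hΞ, hΨ₁, h]
      rw [hL, hR, ← key]
      rfl
  · intro x z
    rcases subsingleton_or_nontrivial X with hX | hX
    · rw [Subsingleton.elim x 0]; simp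
    obtain ⟨u, hu⟩ := H.exists_counit_eq_one
    have h1 := congrArg (H.counitL Z') (h x z u)
    have h2 : ∀ w : X ⊗[K] X, H.counitL Z' (swapApply α z w) = α (H.counitR X w) z := by
      intro w
      induction w with
      | zero => simp
      | add x y hx hy => simp only [map_add, LinearMap.add_apply, hx, hy]
      | tmul p q => simp
    rw [counitL_mul_right, hu, one_smul, h2, counitR_T₁, hu, one_smul] at h1
    exact h1

end RegularMultiplierHopfAlgebra

namespace RegularMultiplierHopfAlgebra

variable {K X Z Z' Z'' W W' : Type*} [Field K] [AddCommGroup X] [Module K X]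
  [AddCommGroup Z] [Module K Z] [AddCommGroup Z'] [Module K Z'] [AddCommGroup Z''] [Module K Z'']
  [AddCommGroup W] [Module K W] [AddCommGroup W'] [Module K W']

section

variable {H : RegularMultiplierHopfAlgebra K X}

namespace IsTw

theorem unique {α : X →ₗ[K] Z →ₗ[K] Z'} {t u : X ⊗[K] Z →ₗ[K] X ⊗[K] Z'} (ht : H.IsTw α t)
    (hu : H.IsTw α u) : t = u :=
  ht.colin.ext hu.colin fun x z => by rw [ht.counit, hu.counit]

theorem counit_apply {α : X →ₗ[K] Z →ₗ[K] Z'} {t : X ⊗[K] Z →ₗ[K] X ⊗[K] Z'} (ht : H.IsTw α t)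
    (w : X ⊗[K] Z) : H.counitL Z' (t w) = TensorProduct.lift α w := by
  induction w with
  | zero => simp
  | add x y hx hy => simp only [map_add, hx, hy]
  | tmul x z => rw [ht.counit]; simp

theorem isTwist {α : X →ₗ[K] Z →ₗ[K] Z} {t : X ⊗[K] Z →ₗ[K] X ⊗[K] Z} (ht : H.IsTw α t) :
    H.IsTwist α ((TensorProduct.comm K X Z).toLinearMap ∘ₗ t) := by
  intro x v y
  have h := congrArg (TensorProduct.comm K X Z) (ht.cover x v y)
  rw [comm_rTensor] at h
  simpa [swapApply] using h

theorem _root_.MHA.RegularMultiplierHopfAlgebra.isTw_of_isTwist {α : X →ₗ[K] Z →ₗ[K] Z}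
    {R : X ⊗[K] Z →ₗ[K] Z ⊗[K] X} (h : H.IsTwist α R) :
    H.IsTw α ((TensorProduct.comm K Z X).toLinearMap ∘ₗ R) := by
  apply IsTw.of_cover
  intro x z y
  rw [LinearMap.comp_apply, LinearEquiv.coe_coe, ← comm_lTensor, h]
  rfl

theorem isTwist_twist {α : X →ₗ[K] Z →ₗ[K] Z} {t : X ⊗[K] Z →ₗ[K] X ⊗[K] Z} (ht : H.IsTw α t) :
    H.IsTwist α (H.twist α) := Classical.epsilon_spec ⟨_, ht.isTwist⟩

theorem isTw_tw {α : X →ₗ[K] Z →ₗ[K] Z} {t : X ⊗[K] Z →ₗ[K] X ⊗[K] Z} (ht : H.IsTw α t) :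
    H.IsTw α (H.tw α) := isTw_of_isTwist ht.isTwist_twist

theorem tw_eq {α : X →ₗ[K] Z →ₗ[K] Z} {t : X ⊗[K] Z →ₗ[K] X ⊗[K] Z} (ht : H.IsTw α t) :
    H.tw α = t := ht.isTw_tw.unique ht

/-- Naturality: intertwining maps commute with the twist maps. -/
theorem natural {α : X →ₗ[K] Z →ₗ[K] Z'} {t : X ⊗[K] Z →ₗ[K] X ⊗[K] Z'}
    {β : X →ₗ[K] W →ₗ[K] W'} {u : X ⊗[K] W →ₗ[K] X ⊗[K] W'} (ht : H.IsTw α t) (hu : H.IsTw β u)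
    {f : Z →ₗ[K] W} {f' : Z' →ₗ[K] W'} (h : ∀ x z, f' (α x z) = β x (f z)) :
    f'.lTensor X ∘ₗ t = u ∘ₗ f.lTensor X := by
  refine ((Colin.lTensor f').comp ht.colin).ext (hu.colin.comp (Colin.lTensor f)) fun x z => ?_
  simp only [LinearMap.comp_apply, counitL_lTensor, ht.counit, LinearMap.lTensor_tmul, hu.counit, h]

/-- Naturality for two families that become equal after composition. -/
theorem balanced {α : X →ₗ[K] Z →ₗ[K] Z'} {t : X ⊗[K] Z →ₗ[K] X ⊗[K] Z'}
    {β : X →ₗ[K] Z →ₗ[K] W'} {u : X ⊗[K] Z →ₗ[K] X ⊗[K] W'} (ht : H.IsTw α t) (hu : H.IsTw β u)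
    {f : Z' →ₗ[K] W} {f' : W' →ₗ[K] W} (h : ∀ x z, f (α x z) = f' (β x z)) :
    f.lTensor X ∘ₗ t = f'.lTensor X ∘ₗ u := by
  refine ((Colin.lTensor f).comp ht.colin).ext ((Colin.lTensor f').comp hu.colin) fun x z => ?_
  simp only [LinearMap.comp_apply, counitL_lTensor, ht.counit, hu.counit, h]

theorem comp {α : X →ₗ[K] Z →ₗ[K] Z'} {t : X ⊗[K] Z →ₗ[K] X ⊗[K] Z'}
    {β : X →ₗ[K] Z' →ₗ[K] Z''} {u : X ⊗[K] Z' →ₗ[K] X ⊗[K] Z''} (ht : H.IsTw α t)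
    (hu : H.IsTw β u) : H.IsTw (TensorProduct.curry (TensorProduct.lift β ∘ₗ t)) (u ∘ₗ t) where
  colin := hu.colin.comp ht.colin
  counit x z := by rw [LinearMap.comp_apply, hu.counit_apply]; rfl

theorem lTensor {α : X →ₗ[K] Z →ₗ[K] Z'} {t : X ⊗[K] Z →ₗ[K] X ⊗[K] Z'} (ht : H.IsTw α t)
    (W : Type*) [AddCommGroup W] [Module K W] :
    H.IsTw (LinearMap.lTensorHom W ∘ₗ α) ((TensorProduct.leftComm K W X Z').toLinearMap ∘ₗ
      t.lTensor W ∘ₗ (TensorProduct.leftComm K X W Z).toLinearMap) := by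
  apply IsTw.of_cover
  intro x v y
  induction v with
  | zero => simp
  | add a b ha hb =>
    simp only [map_add, LinearMap.add_apply, TensorProduct.tmul_add, ha, hb]
  | tmul w z =>
    have h1 : ∀ u : X ⊗[K] X, swapApply (LinearMap.lTensorHom W ∘ₗ α) (w ⊗ₜ z) u =
        TensorProduct.leftComm K W X Z' (w ⊗ₜ swapApply α z u) := by
      intro u
      induction u with
      | zero => simp
      | add x y hx hy => simp only [map_add, TensorProduct.tmul_add, hx, hy]
      | tmul p q => simp
    rw [h1, ← ht.cover]
    simp only [LinearMap.comp_apply, LinearEquiv.coe_coe, TensorProduct.leftComm_tmul,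
      LinearMap.lTensor_tmul]
    generalize t (x ⊗ₜ z) = u
    induction u with
    | zero => simp
    | add x y hx hy => simp only [map_add, TensorProduct.tmul_add, hx, hy]
    | tmul p q => simp

theorem rTensor {α : X →ₗ[K] Z →ₗ[K] Z'} {t : X ⊗[K] Z →ₗ[K] X ⊗[K] Z'} (ht : H.IsTw α t)
    (W : Type*) [AddCommGroup W] [Module K W] :
    H.IsTw (LinearMap.rTensorHom W ∘ₗ α) ((TensorProduct.assoc K X Z' W).toLinearMap ∘ₗ
      t.rTensor W ∘ₗ (TensorProduct.assoc K X Z W).symm.toLinearMap) := by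
  apply IsTw.of_cover
  intro x v y
  induction v with
  | zero => simp
  | add a b ha hb =>
    simp only [map_add, LinearMap.add_apply, TensorProduct.tmul_add, ha, hb]
  | tmul z w =>
    have h1 : ∀ u : X ⊗[K] X, swapApply (LinearMap.rTensorHom W ∘ₗ α) (z ⊗ₜ w) u =
        TensorProduct.assoc K X Z' W (swapApply α z u ⊗ₜ w) := by
      intro u
      induction u with
      | zero => simp
      | add x y hx hy => simp only [map_add, TensorProduct.add_tmul, hx, hy]
      | tmul p q => simp
    rw [h1, ← ht.cover]
    simp only [LinearMap.comp_apply, LinearEquiv.coe_coe, TensorProduct.assoc_symm_tmul,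
      LinearMap.rTensor_tmul]
    generalize t (x ⊗ₜ z) = u
    induction u with
    | zero => simp
    | add x y hx hy => simp only [map_add, TensorProduct.add_tmul, hx, hy]
    | tmul p q => simp

/-- The twist map covered from the left. -/
theorem cover_left {α : X →ₗ[K] Z →ₗ[K] Z'} {t : X ⊗[K] Z →ₗ[K] X ⊗[K] Z'} (ht : H.IsTw α t)
    (x : X) (z : Z) (y : X) :
    (H.mul y).rTensor Z' (t (x ⊗ₜ z)) = swapApply α z (H.T₄ (y ⊗ₜ x)) := by
  apply H.rTensor_cancel_right
  intro w
  have h1 : ∀ f : X →ₗ[K] X, ∀ u, f.rTensor Z' (swapApply α z u) =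
      swapApply α z (f.lTensor X u) := by
    intro f u
    induction u with
    | zero => simp
    | add x y hx hy => simp only [map_add, hx, hy]
    | tmul p q => simp
  have h2 : ∀ u, (H.mul.flip w).rTensor Z' ((H.mul y).rTensor Z' u) =
      (H.mul y).rTensor Z' ((H.mul.flip w).rTensor Z' u) := by
    intro u
    rw [← LinearMap.rTensor_comp_apply, ← LinearMap.rTensor_comp_apply]
    congr 2
    ext; simp [H.mul_assoc]
  rw [h2, ht.cover, h1, h1, T₁_left₂]

end IsTw

/-! ### Twist maps of left and right modules -/

/-- `V` is a unital right `H`-module, with `γ x v = v x`. -/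
structure IsRightModule (H : RegularMultiplierHopfAlgebra K X) (γ : X →ₗ[K] Z →ₗ[K] Z) : Prop where
  mul_act : ∀ x y v, γ (H.mul x y) v = γ y (γ x v)
  unital : Submodule.span K {w | ∃ x v, γ x v = w} = ⊤

theorem lift_surjective {α : X →ₗ[K] Z →ₗ[K] Z'}
    (h : Submodule.span K {w | ∃ x v, α x v = w} = ⊤) :
    Function.Surjective (TensorProduct.lift α) := by
  rw [← LinearMap.range_eq_top, eq_top_iff, ← h, Submodule.span_le]
  rintro _ ⟨x, v, rfl⟩
  exact ⟨x ⊗ₜ v, by simp⟩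

theorem span_of_lift_surjective {α : X →ₗ[K] Z →ₗ[K] Z'}
    (h : Function.Surjective (TensorProduct.lift α)) :
    Submodule.span K {w | ∃ x v, α x v = w} = ⊤ := by
  rw [eq_top_iff]
  intro w _
  obtain ⟨u, rfl⟩ := h w
  induction u with
  | zero => simp
  | add x y hx hy => rw [map_add]; exact add_mem (hx trivial) (hy trivial)
  | tmul x v => exact Submodule.subset_span ⟨x, v, by simp⟩

/-- Two linear maps agree if they agree on the elements `α(y)(z)`. -/
theorem hom_ext_of_span {α : X →ₗ[K] Z →ₗ[K] Z'}
    (h : Submodule.span K {w | ∃ x v, α x v = w} = ⊤) {f g : Z' →ₗ[K] W}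
    (hfg : ∀ y z, f (α y z) = g (α y z)) : f = g := by
  apply LinearMap.ext_on h
  rintro _ ⟨x, v, rfl⟩
  exact hfg x v

theorem rTensor_swapApply (α : X →ₗ[K] Z →ₗ[K] Z') (z : Z) (f : X →ₗ[K] X) (u : X ⊗[K] X) :
    f.rTensor Z' (swapApply α z u) = swapApply α z (f.lTensor X u) := by
  induction u with
  | zero => simp
  | add x y hx hy => simp only [map_add, hx, hy]
  | tmul p q => simp

/-- Existence of the twist map, given a formula `y ⊗ z ⊗ x ↦ swapApply α z (G y x)` for its value at
`x ⊗ α(y)(z)`. -/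
theorem exists_isTw_of_cover {α : X →ₗ[K] Z →ₗ[K] Z}
    (hu : Submodule.span K {w | ∃ x v, α x v = w} = ⊤) (G : X →ₗ[K] X →ₗ[K] X ⊗[K] X)
    (hG : ∀ y z x w, swapApply α z ((H.mul.flip w).lTensor X (G y x)) =
      swapApply α (α y z) (H.T₁ (x ⊗ₜ w))) :
    H.IsTw α (H.tw α) ∧ ∀ x y z, H.tw α (x ⊗ₜ α y z) = swapApply α z (G y x) := by
  obtain ⟨σ, hσ⟩ := (TensorProduct.lift α).exists_rightInverse_of_surjective
    (LinearMap.range_eq_top.2 (lift_surjective hu))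
  let Φ : X →ₗ[K] Z →ₗ[K] X →ₗ[K] X ⊗[K] Z := (LinearMap.llcomp K X _ _ ∘ₗ swapApply α).flip ∘ₗ G
  have ht : H.IsTw α (TensorProduct.lift (TensorProduct.lift Φ ∘ₗ σ).flip) := by
    refine IsTw.of_cover H fun x z w => ?_
    have h1 : ∀ u : X ⊗[K] Z, (H.mul.flip w).rTensor Z (TensorProduct.lift Φ u x) =
        swapApply α (TensorProduct.lift α u) (H.T₁ (x ⊗ₜ w)) := by
      intro u
      induction u with
      | zero => simp
      | add a b ha hb => simp only [map_add, LinearMap.add_apply, ha, hb]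
      | tmul y z =>
        rw [TensorProduct.lift.tmul, TensorProduct.lift.tmul, ← hG, ← rTensor_swapApply]
        rfl
    have h2 : TensorProduct.lift α (σ z) = z := LinearMap.congr_fun hσ z
    rw [TensorProduct.lift.tmul, LinearMap.flip_apply, LinearMap.comp_apply, h1, h2]
  refine ⟨ht.isTw_tw, fun x y z => ?_⟩
  apply H.rTensor_cancel_right
  intro w
  rw [ht.isTw_tw.cover, rTensor_swapApply, hG]

theorem swapApply_act {α : X →ₗ[K] Z →ₗ[K] Z} (hα : IsUnitalModule H α) (y : X) (z : Z)
    (u : X ⊗[K] X) : swapApply α (α y z) u = swapApply α z ((H.mul.flip y).rTensor X u) := by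
  induction u with
  | zero => simp
  | add a b ha hb => simp only [map_add, ha, hb]
  | tmul p q => simp [hα.mul_act]

theorem swapApply_rightAct {γ : X →ₗ[K] Z →ₗ[K] Z} (hγ : IsRightModule H γ) (y : X) (z : Z)
    (u : X ⊗[K] X) : swapApply γ (γ y z) u = swapApply γ z ((H.mul y).rTensor X u) := by
  induction u with
  | zero => simp
  | add a b ha hb => simp only [map_add, ha, hb]
  | tmul p q => simp [hγ.mul_act]

/-- For a left module the twist map exists: on `x ⊗ yz` it is read off from `Δ(x)(y ⊗ 1) = T₃(x ⊗ y)`. -/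
theorem _root_.MHA.IsUnitalModule.isTw_and {α : X →ₗ[K] Z →ₗ[K] Z} (hα : IsUnitalModule H α) :
    H.IsTw α (H.tw α) ∧ ∀ x y z, H.tw α (x ⊗ₜ α y z) = swapApply α z (H.T₃ (x ⊗ₜ y)) :=
  exists_isTw_of_cover hα.unital H.right₃ fun y z x w => by
    rw [right₃_apply, T₃_right₂, swapApply_act hα]

theorem _root_.MHA.IsUnitalModule.isTw {α : X →ₗ[K] Z →ₗ[K] Z} (hα : IsUnitalModule H α) :
    H.IsTw α (H.tw α) := hα.isTw_and.1

theorem _root_.MHA.IsUnitalModule.tw_act {α : X →ₗ[K] Z →ₗ[K] Z} (hα : IsUnitalModule H α)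
    (x y : X) (z : Z) : H.tw α (x ⊗ₜ α y z) = swapApply α z (H.T₃ (x ⊗ₜ y)) := hα.isTw_and.2 x y z

/-- For a right module the twist map exists: on `x ⊗ zy` it is read off from `(y ⊗ 1)Δ(x) = T₂(y ⊗ x)`. -/
theorem IsRightModule.isTw_and {γ : X →ₗ[K] Z →ₗ[K] Z} (hγ : IsRightModule H γ) :
    H.IsTw γ (H.tw γ) ∧ ∀ x y z, H.tw γ (x ⊗ₜ γ y z) = swapApply γ z (H.T₂ (y ⊗ₜ x)) :=
  exists_isTw_of_cover hγ.unital H.left₂ fun y z x w => by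
    rw [left₂_apply, ← T₁_left₁, swapApply_rightAct hγ]

theorem IsRightModule.isTw {γ : X →ₗ[K] Z →ₗ[K] Z} (hγ : IsRightModule H γ) :
    H.IsTw γ (H.tw γ) := hγ.isTw_and.1

theorem IsRightModule.tw_act {γ : X →ₗ[K] Z →ₗ[K] Z} (hγ : IsRightModule H γ)
    (x y : X) (z : Z) : H.tw γ (x ⊗ₜ γ y z) = swapApply γ z (H.T₂ (y ⊗ₜ x)) := hγ.isTw_and.2 x y z

theorem tmul_ext_of_span {α : X →ₗ[K] Z →ₗ[K] Z'}
    (h : Submodule.span K {w | ∃ x v, α x v = w} = ⊤) {f g : W' ⊗[K] Z' →ₗ[K] W}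
    (hfg : ∀ x y z, f (x ⊗ₜ α y z) = g (x ⊗ₜ α y z)) : f = g := by
  refine TensorProduct.ext' fun x z => ?_
  have := hom_ext_of_span h (f := f ∘ₗ TensorProduct.mk K W' Z' x)
    (g := g ∘ₗ TensorProduct.mk K W' Z' x) fun y z => by simp [hfg]
  exact LinearMap.congr_fun this z

/-- `t : X ⊗ Z → X ⊗ Z'` applied to the first and third legs. -/
def _root_.MHA.skip (W : Type*) [AddCommGroup W] [Module K W] (t : X ⊗[K] Z →ₗ[K] X ⊗[K] Z') :
    X ⊗[K] (W ⊗[K] Z) →ₗ[K] X ⊗[K] (W ⊗[K] Z') :=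
  (TensorProduct.leftComm K W X Z').toLinearMap ∘ₗ t.lTensor W ∘ₗ
    (TensorProduct.leftComm K X W Z).toLinearMap

theorem _root_.MHA.skip_tmul (t : X ⊗[K] Z →ₗ[K] X ⊗[K] Z') (x : X) (w : W) (z : Z) :
    skip W t (x ⊗ₜ (w ⊗ₜ z)) = TensorProduct.leftComm K W X Z' (w ⊗ₜ t (x ⊗ₜ z)) := by
  simp [skip]

theorem _root_.MHA.skip_comp (u : X ⊗[K] Z' →ₗ[K] X ⊗[K] Z'') (t : X ⊗[K] Z →ₗ[K] X ⊗[K] Z') :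
    skip W (u ∘ₗ t) = skip W u ∘ₗ skip W t := by
  refine TensorProduct.ext' fun x v => ?_
  induction v with
  | zero => simp
  | add a b ha hb => simp only [TensorProduct.tmul_add, map_add, ha, hb]
  | tmul w z =>
    have h : ∀ y : X ⊗[K] Z', TensorProduct.leftComm K X W Z'
        (TensorProduct.leftComm K W X Z' (w ⊗ₜ y)) = w ⊗ₜ y := by
      intro y
      induction y with
      | zero => simp
      | add a b ha hb => simp only [TensorProduct.tmul_add, map_add, ha, hb]
      | tmul p q => simp
    simp [skip, h]

/-- `x ⊗ x' ⊗ z ↦ xx' ⊗ z`. -/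
def mulFst (H : RegularMultiplierHopfAlgebra K X) (Z : Type*) [AddCommGroup Z] [Module K Z] :
    X ⊗[K] (X ⊗[K] Z) →ₗ[K] X ⊗[K] Z :=
  (TensorProduct.lift H.mul).rTensor Z ∘ₗ (TensorProduct.assoc K X X Z).symm.toLinearMap

@[simp] theorem mulFst_tmul (x x' : X) (z : Z) :
    H.mulFst Z (x ⊗ₜ (x' ⊗ₜ z)) = H.mul x x' ⊗ₜ z := by simp [mulFst]

theorem mulFst_leftComm (q : X) (w : X ⊗[K] Z) :
    H.mulFst Z (TensorProduct.leftComm K X X Z (q ⊗ₜ w)) = (H.mul.flip q).rTensor Z w := by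
  induction w with
  | zero => simp
  | add x y hx hy => simp only [map_add, TensorProduct.tmul_add, hx, hy]
  | tmul x z => simp

theorem mulFst_tmul' (q : X) (w : X ⊗[K] Z) :
    H.mulFst Z (q ⊗ₜ w) = (H.mul q).rTensor Z w := by
  induction w with
  | zero => simp
  | add x y hx hy => simp only [map_add, TensorProduct.tmul_add, hx, hy]
  | tmul x z => simp

theorem IsTw.skip {α : X →ₗ[K] Z →ₗ[K] Z'} {t : X ⊗[K] Z →ₗ[K] X ⊗[K] Z'} (ht : H.IsTw α t)
    (W : Type*) [AddCommGroup W] [Module K W] :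
    H.IsTw (LinearMap.lTensorHom W ∘ₗ α) (MHA.skip W t) := ht.lTensor W

/-- `(xx')₍₂₎ ⊗ (xx')₍₁₎ z = x₍₂₎x'₍₂₎ ⊗ x₍₁₎x'₍₁₎ z`. -/
theorem _root_.MHA.IsUnitalModule.tw_mulFst {α : X →ₗ[K] Z →ₗ[K] Z} (hα : IsUnitalModule H α) :
    H.tw α ∘ₗ H.mulFst Z = H.mulFst Z ∘ₗ MHA.skip X (H.tw α) ∘ₗ (H.tw α).lTensor X := by
  refine TensorProduct.ext' fun x w => ?_
  have h0 : ∀ x', (H.tw α ∘ₗ H.mulFst Z) ∘ₗ TensorProduct.mk K X (X ⊗[K] Z) x ∘ₗ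
      TensorProduct.mk K X Z x' = (H.mulFst Z ∘ₗ MHA.skip X (H.tw α) ∘ₗ (H.tw α).lTensor X) ∘ₗ
      TensorProduct.mk K X (X ⊗[K] Z) x ∘ₗ TensorProduct.mk K X Z x' := by
    intro x'
    refine hom_ext_of_span hα.unital fun y z => ?_
    simp only [LinearMap.comp_apply, TensorProduct.mk_apply, mulFst_tmul, LinearMap.lTensor_tmul,
      hα.tw_act, T₃_mul_left]
    generalize H.T₃ (x' ⊗ₜ y) = u
    induction u with
    | zero => simp
    | add x y hx hy => simp only [map_add, TensorProduct.tmul_add, hx, hy]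
    | tmul p q =>
      rw [swapApply_tmul, skip_tmul, hα.tw_act, mulFst_leftComm, rTensor_swapApply, multL_comul_eq₃]
  induction w with
  | zero => simp
  | add x y hx hy => simp only [map_add, TensorProduct.tmul_add, hx, hy]
  | tmul x' z => exact LinearMap.congr_fun (h0 x') z

/-- `(xx')₍₂₎ ⊗ z(xx')₍₁₎ = x₍₂₎x'₍₂₎ ⊗ z x₍₁₎x'₍₁₎`. -/
theorem IsRightModule.tw_mulFst {γ : X →ₗ[K] Z →ₗ[K] Z} (hγ : IsRightModule H γ) :
    H.tw γ ∘ₗ H.mulFst Z = H.mulFst Z ∘ₗ (H.tw γ).lTensor X ∘ₗ MHA.skip X (H.tw γ) := by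
  refine TensorProduct.ext' fun x w => ?_
  have h0 : ∀ x', (H.tw γ ∘ₗ H.mulFst Z) ∘ₗ TensorProduct.mk K X (X ⊗[K] Z) x ∘ₗ
      TensorProduct.mk K X Z x' = (H.mulFst Z ∘ₗ (H.tw γ).lTensor X ∘ₗ MHA.skip X (H.tw γ)) ∘ₗ
      TensorProduct.mk K X (X ⊗[K] Z) x ∘ₗ TensorProduct.mk K X Z x' := by
    intro x'
    refine hom_ext_of_span hγ.unital fun y z => ?_
    simp only [LinearMap.comp_apply, TensorProduct.mk_apply, mulFst_tmul, skip_tmul,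
      hγ.tw_act, T₂_mul_right]
    generalize H.T₂ (y ⊗ₜ x) = u
    induction u with
    | zero => simp
    | add x y hx hy => simp only [map_add, TensorProduct.tmul_add, hx, hy]
    | tmul p q =>
      rw [swapApply_tmul, TensorProduct.leftComm_tmul, LinearMap.lTensor_tmul, hγ.tw_act,
        mulFst_tmul', rTensor_swapApply, multR_comul_eq₂]
  induction w with
  | zero => simp
  | add x y hx hy => simp only [map_add, TensorProduct.tmul_add, hx, hy]
  | tmul x' z => exact LinearMap.congr_fun (h0 x') z

theorem isTw_counit : H.IsTw (LinearMap.lsmul K Z ∘ₗ H.counit) LinearMap.id where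
  colin := by simpa using Colin.lTensor (H := H) (LinearMap.id (R := K) (M := Z))
  counit x z := by simp

theorem IsTw.comp_eq_id {α : X →ₗ[K] Z →ₗ[K] Z'} {t : X ⊗[K] Z →ₗ[K] X ⊗[K] Z'}
    {β : X →ₗ[K] Z' →ₗ[K] Z} {u : X ⊗[K] Z' →ₗ[K] X ⊗[K] Z} (ht : H.IsTw α t) (hu : H.IsTw β u)
    (h : ∀ x z, TensorProduct.lift β (t (x ⊗ₜ z)) = H.counit x • z) : u ∘ₗ t = LinearMap.id := by
  refine (hu.colin.comp ht.colin).ext isTw_counit.colin fun x z => ?_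
  rw [LinearMap.comp_apply, hu.counit_apply, h]
  simp

/-- A right module becomes a left module through the antipode. -/
theorem IsRightModule.antipode {γ : X →ₗ[K] Z →ₗ[K] Z} (hγ : IsRightModule H γ) :
    IsUnitalModule H (γ ∘ₗ H.antipode.toLinearMap) where
  mul_act x y v := by simp [antipode_mul, hγ.mul_act]
  unital := by
    rw [← hγ.unital]
    congr 1
    ext w
    constructor
    · rintro ⟨x, v, rfl⟩; exact ⟨H.antipode x, v, rfl⟩
    · rintro ⟨x, v, rfl⟩; exact ⟨H.antipode.symm x, v, by simp⟩

/-- A left module becomes a right module through the inverse of the antipode. -/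
theorem _root_.MHA.IsUnitalModule.antipode_symm {α : X →ₗ[K] Z →ₗ[K] Z} (hα : IsUnitalModule H α) :
    IsRightModule H (α ∘ₗ H.antipode.symm.toLinearMap) where
  mul_act x y v := by
    have h : H.antipode.symm (H.mul x y) = H.mul (H.antipode.symm y) (H.antipode.symm x) := by
      rw [LinearEquiv.symm_apply_eq, antipode_mul]; simp
    simp [h, hα.mul_act]
  unital := by
    rw [← hα.unital]
    congr 1
    ext w
    constructor
    · rintro ⟨x, v, rfl⟩; exact ⟨H.antipode.symm x, v, rfl⟩
    · rintro ⟨x, v, rfl⟩; exact ⟨H.antipode x, v, by simp⟩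

/-- `z x₍₁₎ S(x₍₂₎) = ε(x) z`. -/
theorem IsRightModule.tw_antipode_comp {γ : X →ₗ[K] Z →ₗ[K] Z} (hγ : IsRightModule H γ) :
    H.tw (γ ∘ₗ H.antipode.toLinearMap) ∘ₗ H.tw γ = LinearMap.id := by
  refine hγ.isTw.comp_eq_id hγ.antipode.isTw fun x z => ?_
  have h : (TensorProduct.lift (γ ∘ₗ H.antipode.toLinearMap) ∘ₗ H.tw γ) ∘ₗ
      TensorProduct.mk K X Z x = H.counit x • LinearMap.id := by
    refine hom_ext_of_span hγ.unital fun y z => ?_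
    have h1 : ∀ u, TensorProduct.lift (γ ∘ₗ H.antipode.toLinearMap) (swapApply γ z u) =
        γ (TensorProduct.lift (H.mul.compl₂ H.antipode.toLinearMap) u) z := by
      intro u
      induction u with
      | zero => simp
      | add x y hx hy => simp only [map_add, LinearMap.add_apply, hx, hy]
      | tmul p q => simp [hγ.mul_act]
    simp only [LinearMap.comp_apply, TensorProduct.mk_apply, hγ.tw_act, h1,
      H.isAntipode_antipode.2]
    simp
  exact LinearMap.congr_fun h z

/-- `z S(x₍₁₎) x₍₂₎ = ε(x) z`. -/
theorem IsRightModule.tw_comp_antipode {γ : X →ₗ[K] Z →ₗ[K] Z} (hγ : IsRightModule H γ) :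
    H.tw γ ∘ₗ H.tw (γ ∘ₗ H.antipode.toLinearMap) = LinearMap.id := by
  refine hγ.antipode.isTw.comp_eq_id hγ.isTw fun x z => ?_
  have h : (TensorProduct.lift γ ∘ₗ H.tw (γ ∘ₗ H.antipode.toLinearMap)) ∘ₗ
      TensorProduct.mk K X Z x = H.counit x • LinearMap.id := by
    refine hom_ext_of_span hγ.antipode.unital fun y z => ?_
    have h1 : ∀ u, TensorProduct.lift γ (swapApply (γ ∘ₗ H.antipode.toLinearMap) z u) =
        γ (TensorProduct.lift (H.mul ∘ₗ H.antipode.toLinearMap) u) z := by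
      intro u
      induction u with
      | zero => simp
      | add x y hx hy => simp only [map_add, LinearMap.add_apply, hx, hy]
      | tmul p q => simp [hγ.mul_act]
    rw [LinearMap.comp_apply, LinearMap.comp_apply, TensorProduct.mk_apply, hγ.antipode.tw_act, h1,
      H.antipode_lift_T₃]
    simp
  exact LinearMap.congr_fun h z

/-- The invertible map `x ⊗ z ↦ x₍₂₎ ⊗ z x₍₁₎` of a right module. -/
def IsRightModule.twEquiv {γ : X →ₗ[K] Z →ₗ[K] Z} (hγ : IsRightModule H γ) :
    X ⊗[K] Z ≃ₗ[K] X ⊗[K] Z :=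
  LinearEquiv.ofLinearMap (H.tw γ) (H.tw (γ ∘ₗ H.antipode.toLinearMap)) hγ.tw_comp_antipode
    hγ.tw_antipode_comp

theorem comp_antipode_symm_comp (α : X →ₗ[K] Z →ₗ[K] Z) :
    (α ∘ₗ H.antipode.symm.toLinearMap) ∘ₗ H.antipode.toLinearMap = α := by ext; simp

/-- The invertible map `x ⊗ z ↦ x₍₂₎ ⊗ x₍₁₎ z` of a left module. -/
def _root_.MHA.IsUnitalModule.twEquiv {α : X →ₗ[K] Z →ₗ[K] Z} (hα : IsUnitalModule H α) :
    X ⊗[K] Z ≃ₗ[K] X ⊗[K] Z :=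
  LinearEquiv.ofLinearMap (H.tw α) (H.tw (α ∘ₗ H.antipode.symm.toLinearMap))
    (by simpa [comp_antipode_symm_comp] using hα.antipode_symm.tw_antipode_comp)
    (by simpa [comp_antipode_symm_comp] using hα.antipode_symm.tw_comp_antipode)

@[simp] theorem _root_.MHA.IsUnitalModule.coe_twEquiv {α : X →ₗ[K] Z →ₗ[K] Z}
    (hα : IsUnitalModule H α) : hα.twEquiv.toLinearMap = H.tw α := rfl

end

/-! ### The two comultiplications -/

section

variable {H : RegularMultiplierHopfAlgebra K X}

theorem _root_.MHA.IsUnitalModule.of_cop {α : X →ₗ[K] Z →ₗ[K] Z} (hα : IsUnitalModule H α) :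
    IsUnitalModule H.cop α := ⟨hα.mul_act, hα.unital⟩

theorem IsRightModule.of_cop {γ : X →ₗ[K] Z →ₗ[K] Z} (hγ : IsRightModule H γ) :
    IsRightModule H.cop γ := ⟨hγ.mul_act, hγ.unital⟩

theorem _root_.MHA.IsUnitalModule.tw_lTensor_act {α : X →ₗ[K] Z →ₗ[K] Z} (hα : IsUnitalModule H α)
    (y : X) (w : X ⊗[K] Z) : H.tw α ((α y).lTensor X w) =
      TensorProduct.lift (LinearMap.lTensorHom X ∘ₗ α) (H.cop.coact Z y w) := by
  induction w with
  | zero => simp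
  | add x y hx hy => simp only [map_add, hx, hy]
  | tmul x z =>
    rw [LinearMap.lTensor_tmul, hα.tw_act]
    simp only [coact, LinearMap.comp_apply, LinearMap.rTensor_tmul, right₁_apply, cop_T₁,
      LinearEquiv.coe_coe]
    generalize H.T₃ (x ⊗ₜ y) = u
    induction u with
    | zero => simp
    | add x y hx hy => simp only [map_add, TensorProduct.add_tmul, hx, hy]
    | tmul p q => simp

/-- The maps `x ⊗ z ↦ x₍₂₎ ⊗ x₍₁₎ z` commute with every map that is colinear for the other
coaction and module linear. -/
theorem _root_.MHA.IsUnitalModule.tw_comm {α : X →ₗ[K] Z →ₗ[K] Z} {α' : X →ₗ[K] Z' →ₗ[K] Z'}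
    (hα : IsUnitalModule H α) (hα' : IsUnitalModule H α') {s : X ⊗[K] Z →ₗ[K] X ⊗[K] Z'}
    (hs : H.cop.Colin s) (h : ∀ y, s ∘ₗ (α y).lTensor X = (α' y).lTensor X ∘ₗ s) :
    s ∘ₗ H.tw α = H.tw α' ∘ₗ s := by
  have key : ∀ y w, s (H.tw α ((α y).lTensor X w)) = H.tw α' (s ((α y).lTensor X w)) := by
    intro y w
    have h1 : s ((α y).lTensor X w) = (α' y).lTensor X (s w) := LinearMap.congr_fun (h y) w
    rw [h1, hα.tw_lTensor_act, hα'.tw_lTensor_act, ← hs]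
    generalize H.cop.coact Z y w = u
    induction u with
    | zero => simp
    | add x y hx hy => simp only [map_add, hx, hy]
    | tmul p v =>
      have h2 : s ((α p).lTensor X v) = (α' p).lTensor X (s v) := LinearMap.congr_fun (h p) v
      simpa using h2
  refine tmul_ext_of_span hα.unital fun x y z => ?_
  simpa using key y (x ⊗ₜ z)

/-- A module map that is colinear for the co-opposite coaction commutes with the twist maps of right
modules. -/
theorem IsRightModule.tw_comm {γ : X →ₗ[K] Z →ₗ[K] Z} {γ' : X →ₗ[K] Z' →ₗ[K] Z'}
    (hγ : IsRightModule H γ) (hγ' : IsRightModule H γ') {s : X ⊗[K] Z →ₗ[K] X ⊗[K] Z'}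
    (hs : H.cop.Colin s) (h : ∀ y, s ∘ₗ (γ y).lTensor X = (γ' y).lTensor X ∘ₗ s) :
    s ∘ₗ H.tw γ = H.tw γ' ∘ₗ s := by
  have h1 := hγ.antipode.tw_comm hγ'.antipode hs fun y => by simpa using h (H.antipode y)
  calc s ∘ₗ H.tw γ = (H.tw γ' ∘ₗ H.tw (γ' ∘ₗ H.antipode.toLinearMap)) ∘ₗ s ∘ₗ H.tw γ := by
        rw [hγ'.tw_comp_antipode, LinearMap.id_comp]
    _ = H.tw γ' ∘ₗ s ∘ₗ (H.tw (γ ∘ₗ H.antipode.toLinearMap) ∘ₗ H.tw γ) := by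
        ext1; ext x z
        have := LinearMap.congr_fun h1 (H.tw γ (x ⊗ₜ z))
        simp only [LinearMap.comp_apply] at this
        simp [this]
    _ = H.tw γ' ∘ₗ s := by rw [hγ.tw_antipode_comp, LinearMap.comp_id]

/-- `β(x₍₂₎)(x₍₁₎ z)`, with the twist map formed for either of the two legs. -/
theorem _root_.MHA.IsUnitalModule.lift_tw_eq {α : X →ₗ[K] Z →ₗ[K] Z} (hα : IsUnitalModule H α)
    {β : X →ₗ[K] Z →ₗ[K] Z} {s : X ⊗[K] Z →ₗ[K] X ⊗[K] Z} (hs : H.cop.IsTw β s)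
    (h : ∀ x y z, α x (β y z) = β y (α x z)) :
    TensorProduct.lift β ∘ₗ H.tw α = TensorProduct.lift α ∘ₗ s := by
  refine tmul_ext_of_span hα.unital fun x y z => ?_
  have h1 : s (x ⊗ₜ α y z) = (α y).lTensor X (s (x ⊗ₜ z)) := by
    have := hs.natural hs (f := α y) (f' := α y) fun x z => h y x z
    simpa using (LinearMap.congr_fun this (x ⊗ₜ z)).symm
  have h2 : ∀ w, TensorProduct.lift α ((α y).lTensor X w) =
      TensorProduct.lift α ((H.mul.flip y).rTensor Z w) := by
    intro w
    induction w with
    | zero => simp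
    | add x y hx hy => simp only [map_add, hx, hy]
    | tmul p z => simp [hα.mul_act]
  have h3 := hs.cover x z y
  rw [cop_mul] at h3
  rw [LinearMap.comp_apply, LinearMap.comp_apply, h1, h2, h3, cop_T₁, hα.tw_act]
  generalize H.T₃ (x ⊗ₜ y) = u
  induction u with
  | zero => simp
  | add x y hx hy => simp only [map_add, hx, hy]
  | tmul p q => simp [h]

/-- For commuting actions `γ` and `β`, both sides are `x ⊗ z ↦ γ(x₍₁₎)β(x₍₂₎)(z)`. -/
theorem IsRightModule.lift_tw_eq {γ : X →ₗ[K] Z →ₗ[K] Z} (hγ : IsRightModule H γ)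
    {β : X →ₗ[K] Z →ₗ[K] Z} {s : X ⊗[K] Z →ₗ[K] X ⊗[K] Z} (hs : H.cop.IsTw β s)
    (h : ∀ x y z, γ x (β y z) = β y (γ x z)) :
    TensorProduct.lift β ∘ₗ H.tw γ = TensorProduct.lift γ ∘ₗ s := by
  refine tmul_ext_of_span hγ.unital fun x y z => ?_
  have h1 : s (x ⊗ₜ γ y z) = (γ y).lTensor X (s (x ⊗ₜ z)) := by
    have := hs.natural hs (f := γ y) (f' := γ y) fun x z => h y x z
    simpa using (LinearMap.congr_fun this (x ⊗ₜ z)).symm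
  have h2 : ∀ w, TensorProduct.lift γ ((γ y).lTensor X w) =
      TensorProduct.lift γ ((H.mul y).rTensor Z w) := by
    intro w
    induction w with
    | zero => simp
    | add x y hx hy => simp only [map_add, hx, hy]
    | tmul p z => simp [hγ.mul_act]
  have h3 := hs.cover_left x z y
  rw [cop_mul] at h3
  rw [LinearMap.comp_apply, LinearMap.comp_apply, h1, h2, h3, cop_T₄, hγ.tw_act]
  generalize H.T₂ (y ⊗ₜ x) = u
  induction u with
  | zero => simp
  | add x y hx hy => simp only [map_add, hx, hy]
  | tmul p q => simp [h]

/-! ### Convolution -/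

/-- The action `x ⊗ z ↦ β(x₍₂₎)(α(x₍₁₎)(z))`. -/
def conv (H : RegularMultiplierHopfAlgebra K X) (α : X →ₗ[K] Z →ₗ[K] Z) (β : X →ₗ[K] Z →ₗ[K] Z') :
    X →ₗ[K] Z →ₗ[K] Z' := TensorProduct.curry (TensorProduct.lift β ∘ₗ H.tw α)

theorem conv_apply (α : X →ₗ[K] Z →ₗ[K] Z) (β : X →ₗ[K] Z →ₗ[K] Z') (x : X) (z : Z) :
    H.conv α β x z = TensorProduct.lift β (H.tw α (x ⊗ₜ z)) := rfl

theorem IsTw.conv {α : X →ₗ[K] Z →ₗ[K] Z} {β : X →ₗ[K] Z →ₗ[K] Z}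
    (hα : H.IsTw α (H.tw α)) (hβ : H.IsTw β (H.tw β)) :
    H.IsTw (H.conv α β) (H.tw β ∘ₗ H.tw α) := hα.comp hβ

theorem IsTw.tw_conv {α : X →ₗ[K] Z →ₗ[K] Z} {β : X →ₗ[K] Z →ₗ[K] Z}
    (hα : H.IsTw α (H.tw α)) (hβ : H.IsTw β (H.tw β)) :
    H.tw (H.conv α β) = H.tw β ∘ₗ H.tw α := (hα.conv hβ).tw_eq

theorem counitL_mulFst (w : X ⊗[K] (X ⊗[K] Z)) :
    H.counitL Z (H.mulFst Z w) = H.counitL Z (H.counitL (X ⊗[K] Z) w) := by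
  induction w with
  | zero => simp
  | add x y hx hy => simp only [map_add, hx, hy]
  | tmul p v =>
    rw [mulFst_tmul', counitL_mul_left]
    simp

/-- The convolution of two commuting module structures is a module structure. -/
theorem _root_.MHA.IsUnitalModule.conv {α β : X →ₗ[K] Z →ₗ[K] Z} (hα : IsUnitalModule H α)
    (hβ : IsUnitalModule H β) (h : ∀ x y z, α x (β y z) = β y (α x z)) :
    IsUnitalModule H (H.conv α β) where
  mul_act x x' z := by
    have ht := hα.isTw.conv hβ.isTw
    have h1 : (H.tw β).lTensor X ∘ₗ MHA.skip X (H.tw α) =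
        MHA.skip X (H.tw α) ∘ₗ (H.tw β).lTensor X := by
      refine (hα.isTw.skip X).natural (hα.isTw.skip X) fun x w => ?_
      have := hβ.isTw.natural hβ.isTw (f := α x) (f' := α x) fun y z => h x y z
      simpa using (LinearMap.congr_fun this w).symm
    have h2 : (H.tw β ∘ₗ H.tw α) ∘ₗ H.mulFst Z = H.mulFst Z ∘ₗ
        MHA.skip X (H.tw β ∘ₗ H.tw α) ∘ₗ (H.tw β ∘ₗ H.tw α).lTensor X := by
      refine LinearMap.ext fun w => ?_
      have a1 := LinearMap.congr_fun hα.tw_mulFst w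
      have a2 := fun w => LinearMap.congr_fun hβ.tw_mulFst w
      have a3 := fun w => LinearMap.congr_fun h1 w
      simp only [LinearMap.comp_apply] at a1 a2 a3
      simp only [LinearMap.comp_apply, skip_comp, LinearMap.lTensor_comp, a1, a2, a3]
    have h3 := congrArg (H.counitL Z) (LinearMap.congr_fun h2 (x ⊗ₜ (x' ⊗ₜ z)))
    rw [LinearMap.comp_apply, mulFst_tmul, ht.counit] at h3
    rw [h3, LinearMap.comp_apply, LinearMap.comp_apply, counitL_mulFst, LinearMap.lTensor_tmul,
      (ht.skip X).counit]
    have h4 := ht.counit x' z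
    rw [LinearMap.comp_apply] at h4
    simp [counitL_lTensor, h4]
  unital := by
    refine span_of_lift_surjective ?_
    have : TensorProduct.lift (H.conv α β) = TensorProduct.lift β ∘ₗ hα.twEquiv.toLinearMap :=
      TensorProduct.ext' fun x z => by simp [conv_apply]
    rw [this]
    exact (lift_surjective hβ.unital).comp hα.twEquiv.surjective

end

end RegularMultiplierHopfAlgebra

/-! ### Twisted tensor products -/

section Exchange

variable {K X Y Z : Type*} [Field K] [AddCommGroup X] [Module K X] [AddCommGroup Y] [Module K Y]
  [AddCommGroup Z] [Module K Z]
  {G : RegularMultiplierHopfAlgebra K X} {H : RegularMultiplierHopfAlgebra K Y}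

open RegularMultiplierHopfAlgebra

/-- `x · e` for `e` in a twisted product. -/
def leftFst (G : RegularMultiplierHopfAlgebra K X) (Y : Type*) [AddCommGroup Y] [Module K Y] :
    X →ₗ[K] X ⊗[K] Y →ₗ[K] X ⊗[K] Y := LinearMap.rTensorHom Y ∘ₗ G.mul

/-- `e · y` for `e` in a twisted product. -/
def rightSnd (H : RegularMultiplierHopfAlgebra K Y) (X : Type*) [AddCommGroup X] [Module K X] :
    Y →ₗ[K] X ⊗[K] Y →ₗ[K] X ⊗[K] Y := LinearMap.lTensorHom X ∘ₗ H.mul.flip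

/-- `y · e` for `e` in the twisted product where `yx = τ(x ⊗ y)`. -/
def leftSnd (H : RegularMultiplierHopfAlgebra K Y) (τ : X ⊗[K] Y ≃ₗ[K] X ⊗[K] Y) :
    Y →ₗ[K] X ⊗[K] Y →ₗ[K] X ⊗[K] Y := τ.conj.toLinearMap ∘ₗ LinearMap.lTensorHom X ∘ₗ H.mul

/-- `e · x` for `e` in the twisted product where `yx = τ(x ⊗ y)`. -/
def rightFst (G : RegularMultiplierHopfAlgebra K X) (τ : X ⊗[K] Y ≃ₗ[K] X ⊗[K] Y) :
    X →ₗ[K] X ⊗[K] Y →ₗ[K] X ⊗[K] Y := τ.conj.toLinearMap ∘ₗ LinearMap.rTensorHom Y ∘ₗ G.mul.flip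

theorem leftFst_apply (x : X) (e : X ⊗[K] Y) : leftFst G Y x e = (G.mul x).rTensor Y e := rfl
theorem rightSnd_apply (y : Y) (e : X ⊗[K] Y) :
    rightSnd H X y e = (H.mul.flip y).lTensor X e := rfl
theorem leftSnd_apply (τ : X ⊗[K] Y ≃ₗ[K] X ⊗[K] Y) (y : Y) (e : X ⊗[K] Y) :
    leftSnd H τ y e = τ ((H.mul y).lTensor X (τ.symm e)) := rfl
theorem rightFst_apply (τ : X ⊗[K] Y ≃ₗ[K] X ⊗[K] Y) (x : X) (e : X ⊗[K] Y) :
    rightFst G τ x e = τ ((G.mul.flip x).rTensor Y (τ.symm e)) := rfl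

@[simp] theorem leftFst_tmul (x x' : X) (y : Y) : leftFst G Y x (x' ⊗ₜ y) = G.mul x x' ⊗ₜ y := by
  simp [leftFst]
@[simp] theorem rightSnd_tmul (x : X) (y y' : Y) : rightSnd H X y (x ⊗ₜ y') = x ⊗ₜ H.mul y' y := by
  simp [rightSnd]

/-- The exchange rule `yx = τ(x ⊗ y)` makes `X ⊗ Y` an algebra: it is compatible with the products
of `X` and `Y`. -/
structure IsExchange (G : RegularMultiplierHopfAlgebra K X) (H : RegularMultiplierHopfAlgebra K Y)
    (τ : X ⊗[K] Y ≃ₗ[K] X ⊗[K] Y) : Prop where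
  rightFst_tmul : ∀ x' x y, rightFst G τ x' (x ⊗ₜ y) = leftFst G Y x (τ (x' ⊗ₜ y))
  leftSnd_tmul : ∀ y' x y, leftSnd H τ y' (x ⊗ₜ y) = rightSnd H X y (τ (x ⊗ₜ y'))

/-- The two hexagon identities for an exchange rule. -/
theorem IsExchange.of_mulFst {τ : X ⊗[K] Y ≃ₗ[K] X ⊗[K] Y} {τ' : Y ⊗[K] X →ₗ[K] Y ⊗[K] X}
    (hτ : ∀ x y, τ' (y ⊗ₜ x) = TensorProduct.comm K X Y (τ (x ⊗ₜ y)))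
    (hX : τ.toLinearMap ∘ₗ G.mulFst Y =
      G.mulFst Y ∘ₗ τ.toLinearMap.lTensor X ∘ₗ skip X τ.toLinearMap)
    (hY : τ' ∘ₗ H.mulFst X = H.mulFst X ∘ₗ skip Y τ' ∘ₗ τ'.lTensor Y) : IsExchange G H τ where
  rightFst_tmul x' x y := by
    let F : X ⊗[K] Y →ₗ[K] X ⊗[K] Y := G.mulFst Y ∘ₗ τ.toLinearMap.lTensor X ∘ₗ
      (TensorProduct.leftComm K X X Y).toLinearMap ∘ₗ TensorProduct.mk K X (X ⊗[K] Y) x'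
    have hF : ∀ e, rightFst G τ x' (τ e) = F (τ e) := by
      intro e
      rw [rightFst_apply, LinearEquiv.symm_apply_apply]
      induction e with
      | zero => simp
      | add x y hx hy => simp only [map_add, hx, hy]
      | tmul x y =>
        have h := LinearMap.congr_fun hX (x ⊗ₜ (x' ⊗ₜ y))
        simpa [skip_tmul, F] using h
    obtain ⟨e, he⟩ := τ.surjective (x ⊗ₜ y)
    rw [← he, hF, he]
    simp [F, mulFst_tmul', leftFst_apply]
  leftSnd_tmul y' x y := by
    have hτ' : ∀ e, τ' (TensorProduct.comm K X Y e) = TensorProduct.comm K X Y (τ e) := by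
      intro e
      induction e with
      | zero => simp
      | add x y hx hy => simp only [map_add, hx, hy]
      | tmul x y => simp [hτ]
    let F : X ⊗[K] Y →ₗ[K] Y ⊗[K] X := H.mulFst X ∘ₗ skip Y τ' ∘ₗ TensorProduct.mk K Y (Y ⊗[K] X) y' ∘ₗ
      (TensorProduct.comm K X Y).toLinearMap
    have hF : ∀ e, TensorProduct.comm K X Y (leftSnd H τ y' (τ e)) = F (τ e) := by
      intro e
      rw [leftSnd_apply, LinearEquiv.symm_apply_apply]
      induction e with
      | zero => simp
      | add x y hx hy => simp only [map_add, hx, hy]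
      | tmul x y =>
        have h := LinearMap.congr_fun hY (y' ⊗ₜ (y ⊗ₜ x))
        simpa [F, hτ] using h
    obtain ⟨e, he⟩ := τ.surjective (x ⊗ₜ y)
    apply (TensorProduct.comm K X Y).injective
    rw [← he, hF, he]
    simp [F, skip_tmul, mulFst_leftComm, rightSnd_apply, hτ, comm_lTensor]

theorem comm_of_forall_tmul {f g : X ⊗[K] Y →ₗ[K] Z} (h : ∀ x y, f (x ⊗ₜ y) = g (x ⊗ₜ y))
    (e : X ⊗[K] Y) : f e = g e := LinearMap.congr_fun (TensorProduct.ext' h) e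

theorem leftFst_rightSnd (x : X) (y : Y) (e : X ⊗[K] Y) :
    leftFst G Y x (rightSnd H X y e) = rightSnd H X y (leftFst G Y x e) := by
  rw [leftFst_apply, rightSnd_apply, ← lTensor_rTensor_comm]; rfl

theorem leftSnd_rightFst (τ : X ⊗[K] Y ≃ₗ[K] X ⊗[K] Y) (x : X) (y : Y) (e : X ⊗[K] Y) :
    leftSnd H τ y (rightFst G τ x e) = rightFst G τ x (leftSnd H τ y e) := by
  simp [leftSnd_apply, rightFst_apply, lTensor_rTensor_comm]

theorem leftFst_mul (x x' : X) (e : X ⊗[K] Y) :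
    leftFst G Y (G.mul x x') e = leftFst G Y x (leftFst G Y x' e) := by
  rw [leftFst_apply, leftFst_apply, leftFst_apply, ← LinearMap.rTensor_comp_apply]
  congr 2; ext; simp [G.mul_assoc]

theorem rightSnd_mul (y y' : Y) (e : X ⊗[K] Y) :
    rightSnd H X (H.mul y y') e = rightSnd H X y' (rightSnd H X y e) := by
  rw [rightSnd_apply, rightSnd_apply, rightSnd_apply, ← LinearMap.lTensor_comp_apply]
  congr 2; ext; simp [H.mul_assoc]

theorem leftSnd_mul (τ : X ⊗[K] Y ≃ₗ[K] X ⊗[K] Y) (y y' : Y) (e : X ⊗[K] Y) :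
    leftSnd H τ (H.mul y y') e = leftSnd H τ y (leftSnd H τ y' e) := by
  rw [leftSnd_apply, leftSnd_apply, leftSnd_apply, LinearEquiv.symm_apply_apply,
    ← LinearMap.lTensor_comp_apply]
  congr 3; ext; simp [H.mul_assoc]

theorem rightFst_mul (τ : X ⊗[K] Y ≃ₗ[K] X ⊗[K] Y) (x x' : X) (e : X ⊗[K] Y) :
    rightFst G τ (G.mul x x') e = rightFst G τ x' (rightFst G τ x e) := by
  rw [rightFst_apply, rightFst_apply, rightFst_apply, LinearEquiv.symm_apply_apply,
    ← LinearMap.rTensor_comp_apply]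
  congr 3; ext; simp [G.mul_assoc]

theorem isUnitalModule_mul : IsUnitalModule G G.mul where
  mul_act := G.mul_assoc
  unital := by
    rw [eq_top_iff]
    intro a _
    obtain ⟨e, he⟩ := G.exists_mul_eq_self a
    exact Submodule.subset_span ⟨a, e, he⟩

theorem isRightModule_mul_flip : IsRightModule G G.mul.flip where
  mul_act x y v := by simp [G.mul_assoc]
  unital := by
    rw [eq_top_iff]
    intro a _
    obtain ⟨e, he⟩ := G.exists_mul_eq_self a
    exact Submodule.subset_span ⟨e, a, he⟩

/-! Module structures pass to one leg of a tensor product and along isomorphisms. -/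

theorem unital_rTensor {α : X →ₗ[K] Z →ₗ[K] Z} (h : Submodule.span K {w | ∃ x v, α x v = w} = ⊤)
    (W : Type*) [AddCommGroup W] [Module K W] :
    Submodule.span K {w | ∃ x v, (LinearMap.rTensorHom W ∘ₗ α) x v = w} = ⊤ := by
  rw [eq_top_iff, ← TensorProduct.span_tmul_eq_top, Submodule.span_le]
  rintro _ ⟨z, w, rfl⟩
  have hz : z ∈ Submodule.span K {w | ∃ x v, α x v = w} := h ▸ trivial
  induction hz using Submodule.span_induction with
  | mem z hz =>
    obtain ⟨x, v, rfl⟩ := hz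
    exact Submodule.subset_span ⟨x, v ⊗ₜ w, by simp⟩
  | zero => simp
  | add a b _ _ ha hb => rw [TensorProduct.add_tmul]; exact add_mem ha hb
  | smul c a _ ha => rw [← TensorProduct.smul_tmul']; exact Submodule.smul_mem _ _ ha

theorem unital_lTensor {α : X →ₗ[K] Z →ₗ[K] Z} (h : Submodule.span K {w | ∃ x v, α x v = w} = ⊤)
    (W : Type*) [AddCommGroup W] [Module K W] :
    Submodule.span K {w | ∃ x v, (LinearMap.lTensorHom W ∘ₗ α) x v = w} = ⊤ := by
  rw [eq_top_iff, ← TensorProduct.span_tmul_eq_top, Submodule.span_le]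
  rintro _ ⟨w, z, rfl⟩
  have hz : z ∈ Submodule.span K {w | ∃ x v, α x v = w} := h ▸ trivial
  induction hz using Submodule.span_induction with
  | mem z hz =>
    obtain ⟨x, v, rfl⟩ := hz
    exact Submodule.subset_span ⟨x, w ⊗ₜ v, by simp⟩
  | zero => simp
  | add a b _ _ ha hb => rw [TensorProduct.tmul_add]; exact add_mem ha hb
  | smul c a _ ha => rw [TensorProduct.tmul_smul]; exact Submodule.smul_mem _ _ ha

theorem unital_conj {α : X →ₗ[K] Z →ₗ[K] Z} (h : Submodule.span K {w | ∃ x v, α x v = w} = ⊤)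
    (τ : Z ≃ₗ[K] Z) :
    Submodule.span K {w | ∃ x v, (τ.conj.toLinearMap ∘ₗ α) x v = w} = ⊤ := by
  refine span_of_lift_surjective ?_
  have : TensorProduct.lift (τ.conj.toLinearMap ∘ₗ α) =
      τ.toLinearMap ∘ₗ TensorProduct.lift α ∘ₗ (τ.symm.lTensor X).toLinearMap :=
    TensorProduct.ext' fun x z => by simp [LinearEquiv.conj_apply]
  rw [this]
  exact τ.surjective.comp ((lift_surjective h).comp (τ.symm.lTensor X).surjective)

theorem IsUnitalModule.rTensor {α : X →ₗ[K] Z →ₗ[K] Z} (hα : IsUnitalModule G α)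
    (W : Type*) [AddCommGroup W] [Module K W] : IsUnitalModule G (LinearMap.rTensorHom W ∘ₗ α) where
  mul_act x x' v := by
    refine comm_of_forall_tmul (f := (LinearMap.rTensorHom W ∘ₗ α) (G.mul x x'))
      (g := (LinearMap.rTensorHom W ∘ₗ α) x ∘ₗ (LinearMap.rTensorHom W ∘ₗ α) x') ?_ v
    intro z w
    simp [hα.mul_act]
  unital := unital_rTensor hα.unital W

theorem IsUnitalModule.lTensor {α : X →ₗ[K] Z →ₗ[K] Z} (hα : IsUnitalModule G α)
    (W : Type*) [AddCommGroup W] [Module K W] : IsUnitalModule G (LinearMap.lTensorHom W ∘ₗ α) where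
  mul_act x x' v := by
    refine comm_of_forall_tmul (f := (LinearMap.lTensorHom W ∘ₗ α) (G.mul x x'))
      (g := (LinearMap.lTensorHom W ∘ₗ α) x ∘ₗ (LinearMap.lTensorHom W ∘ₗ α) x') ?_ v
    intro z w
    simp [hα.mul_act]
  unital := unital_lTensor hα.unital W

theorem _root_.MHA.RegularMultiplierHopfAlgebra.IsRightModule.rTensor {γ : X →ₗ[K] Z →ₗ[K] Z} (hγ : IsRightModule G γ)
    (W : Type*) [AddCommGroup W] [Module K W] : IsRightModule G (LinearMap.rTensorHom W ∘ₗ γ) where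
  mul_act x x' v := by
    refine comm_of_forall_tmul (f := (LinearMap.rTensorHom W ∘ₗ γ) (G.mul x x'))
      (g := (LinearMap.rTensorHom W ∘ₗ γ) x' ∘ₗ (LinearMap.rTensorHom W ∘ₗ γ) x) ?_ v
    intro z w
    simp [hγ.mul_act]
  unital := unital_rTensor hγ.unital W

theorem _root_.MHA.RegularMultiplierHopfAlgebra.IsRightModule.lTensor {γ : X →ₗ[K] Z →ₗ[K] Z} (hγ : IsRightModule G γ)
    (W : Type*) [AddCommGroup W] [Module K W] : IsRightModule G (LinearMap.lTensorHom W ∘ₗ γ) where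
  mul_act x x' v := by
    refine comm_of_forall_tmul (f := (LinearMap.lTensorHom W ∘ₗ γ) (G.mul x x'))
      (g := (LinearMap.lTensorHom W ∘ₗ γ) x' ∘ₗ (LinearMap.lTensorHom W ∘ₗ γ) x) ?_ v
    intro z w
    simp [hγ.mul_act]
  unital := unital_lTensor hγ.unital W

theorem isUnitalModule_leftFst : IsUnitalModule G (leftFst G Y) := isUnitalModule_mul.rTensor Y

theorem isRightModule_rightSnd : IsRightModule H (rightSnd H X) := isRightModule_mul_flip.lTensor X

theorem isUnitalModule_leftSnd (τ : X ⊗[K] Y ≃ₗ[K] X ⊗[K] Y) : IsUnitalModule H (leftSnd H τ) where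
  mul_act := leftSnd_mul τ
  unital := unital_conj (isUnitalModule_mul.lTensor X).unital τ

theorem isRightModule_rightFst (τ : X ⊗[K] Y ≃ₗ[K] X ⊗[K] Y) : IsRightModule G (rightFst G τ) where
  mul_act := rightFst_mul τ
  unital := unital_conj (isRightModule_mul_flip.rTensor Y).unital τ

namespace IsExchange

variable {τ : X ⊗[K] Y ≃ₗ[K] X ⊗[K] Y}

theorem leftFst_rightFst (h : IsExchange G H τ) (x x' : X) (e : X ⊗[K] Y) :
    leftFst G Y x (rightFst G τ x' e) = rightFst G τ x' (leftFst G Y x e) := by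
  refine comm_of_forall_tmul (f := leftFst G Y x ∘ₗ rightFst G τ x')
    (g := rightFst G τ x' ∘ₗ leftFst G Y x) (fun x'' y => ?_) e
  simp [h.rightFst_tmul, leftFst_mul]

theorem leftSnd_rightSnd (h : IsExchange G H τ) (y y' : Y) (e : X ⊗[K] Y) :
    leftSnd H τ y (rightSnd H X y' e) = rightSnd H X y' (leftSnd H τ y e) := by
  refine comm_of_forall_tmul (f := leftSnd H τ y ∘ₗ rightSnd H X y')
    (g := rightSnd H X y' ∘ₗ leftSnd H τ y) (fun x'' y => ?_) e
  simp [h.leftSnd_tmul, rightSnd_mul]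

theorem exchange_mul_fst (x x' : X) (y : Y) :
    τ (G.mul x x' ⊗ₜ y) = rightFst G τ x' (τ (x ⊗ₜ y)) := by
  simp [rightFst_apply]

end IsExchange

theorem twistedMul_tmul_tmul (mX : X →ₗ[K] X →ₗ[K] X) (mY : Y →ₗ[K] Y →ₗ[K] Y)
    (R : Y ⊗[K] X →ₗ[K] X ⊗[K] Y) (x x' : X) (y y' : Y) :
    twistedMul mX mY R (x ⊗ₜ y) (x' ⊗ₜ y') =
      (mX x).rTensor Y ((mY.flip y').lTensor X (R (y ⊗ₜ x'))) := by
  simp only [twistedMul, middleTwist, TensorProduct.curry_apply, LinearMap.comp_apply,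
    LinearEquiv.coe_coe, TensorProduct.assoc_tmul, LinearMap.lTensor_tmul,
    TensorProduct.assoc_symm_tmul, LinearMap.rTensor_tmul]
  generalize R (y ⊗ₜ x') = e
  induction e with
  | zero => simp
  | add a b ha hb => simp only [map_add, TensorProduct.add_tmul, TensorProduct.tmul_add, ha, hb]
  | tmul p q => simp

namespace IsExchange

variable {τ : X ⊗[K] Y ≃ₗ[K] X ⊗[K] Y}

theorem twistedMul_tmul (h : IsExchange G H τ) (x : X) (y : Y) (e : X ⊗[K] Y) :
    twistedMul G.mul H.mul (τ.toLinearMap ∘ₗ (TensorProduct.comm K Y X).toLinearMap) (x ⊗ₜ y) e =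
      leftFst G Y x (leftSnd H τ y e) := by
  refine comm_of_forall_tmul (g := leftFst G Y x ∘ₗ leftSnd H τ y) (fun x' y' => ?_) e
  rw [twistedMul_tmul_tmul, LinearMap.comp_apply (leftFst G Y x), h.leftSnd_tmul]
  rfl

theorem twistedMul_tmul_right (h : IsExchange G H τ) (x : X) (y : Y) (e : X ⊗[K] Y) :
    twistedMul G.mul H.mul (τ.toLinearMap ∘ₗ (TensorProduct.comm K Y X).toLinearMap) e (x ⊗ₜ y) =
      rightSnd H X y (rightFst G τ x e) := by
  refine comm_of_forall_tmul (f := (twistedMul G.mul H.mul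
      (τ.toLinearMap ∘ₗ (TensorProduct.comm K Y X).toLinearMap)).flip (x ⊗ₜ y))
    (g := rightSnd H X y ∘ₗ rightFst G τ x) (fun x' y' => ?_) e
  rw [LinearMap.flip_apply, h.twistedMul_tmul, h.leftSnd_tmul, leftFst_rightSnd,
    LinearMap.comp_apply, h.rightFst_tmul]

/-- The twisted tensor product as an algebra with non-degenerate product. -/
def algebra (h : IsExchange G H τ) : NondegenerateAlgebra K (X ⊗[K] Y) where
  mul := twistedMul G.mul H.mul (τ.toLinearMap ∘ₗ (TensorProduct.comm K Y X).toLinearMap)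
  mul_assoc d e f := by
    induction d with
    | zero => simp
    | add a b ha hb => simp only [map_add, LinearMap.add_apply, ha, hb]
    | tmul x y =>
      induction f with
      | zero => simp
      | add a b ha hb => simp only [map_add, ha, hb]
      | tmul x' y' =>
        simp only [h.twistedMul_tmul, h.twistedMul_tmul_right, h.leftSnd_rightSnd,
          leftSnd_rightFst, leftFst_rightSnd, h.leftFst_rightFst]
  nondeg_left d hd := by
    have h1 : ∀ x, rightFst G τ x d = 0 := fun x => H.lTensor_cancel_right fun y => by
      have := hd (x ⊗ₜ y)
      rw [h.twistedMul_tmul_right, rightSnd_apply] at this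
      simpa using this
    have h2 : τ.symm d = 0 := G.rTensor_cancel_right fun x => by
      have := h1 x
      rw [rightFst_apply] at this
      simpa using this
    simpa using h2
  nondeg_right e he := by
    have h1 : ∀ y, leftSnd H τ y e = 0 := fun y => G.rTensor_cancel_left fun x => by
      have := he (x ⊗ₜ y)
      rw [h.twistedMul_tmul, leftFst_apply] at this
      simpa using this
    have h2 : τ.symm e = 0 := H.lTensor_cancel_left fun y => by
      have := h1 y
      rw [leftSnd_apply] at this
      simpa using this
    simpa using h2

theorem algebra_mul_tmul (h : IsExchange G H τ) (x : X) (y : Y) (e : X ⊗[K] Y) :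
    h.algebra.mul (x ⊗ₜ y) e = leftFst G Y x (leftSnd H τ y e) := h.twistedMul_tmul x y e

theorem algebra_mul_tmul_right (h : IsExchange G H τ) (x : X) (y : Y) (e : X ⊗[K] Y) :
    h.algebra.mul e (x ⊗ₜ y) = rightSnd H X y (rightFst G τ x e) := h.twistedMul_tmul_right x y e

end IsExchange

/-! ### Modules over twisted tensor products -/

/-- The operator `α(x) β(y)` for `x ⊗ y`. -/
def pairAct (α : X →ₗ[K] Z →ₗ[K] Z) (β : Y →ₗ[K] Z →ₗ[K] Z) : X ⊗[K] Y →ₗ[K] Z →ₗ[K] Z :=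
  TensorProduct.lift ((LinearMap.llcomp K Z Z Z ∘ₗ α).compl₂ β)

@[simp] theorem pairAct_tmul (α : X →ₗ[K] Z →ₗ[K] Z) (β : Y →ₗ[K] Z →ₗ[K] Z) (x : X) (y : Y)
    (z : Z) : pairAct α β (x ⊗ₜ y) z = α x (β y z) := by simp [pairAct]

/-- Unital module structures over `X` and `Y` that satisfy the exchange rule
`β(y)α(x) = ∑ α(x')β(y')` for `τ(x ⊗ y) = ∑ x' ⊗ y'`. -/
structure IsExchangeModule (G : RegularMultiplierHopfAlgebra K X)
    (H : RegularMultiplierHopfAlgebra K Y) (τ : X ⊗[K] Y ≃ₗ[K] X ⊗[K] Y)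
    (α : X →ₗ[K] Z →ₗ[K] Z) (β : Y →ₗ[K] Z →ₗ[K] Z) : Prop where
  fst : IsUnitalModule G α
  snd : IsUnitalModule H β
  exchange : ∀ x y z, β y (α x z) = pairAct α β (τ (x ⊗ₜ y)) z

namespace IsExchangeModule

variable {τ : X ⊗[K] Y ≃ₗ[K] X ⊗[K] Y} {α : X →ₗ[K] Z →ₗ[K] Z} {β : Y →ₗ[K] Z →ₗ[K] Z}

theorem pairAct_leftFst (m : IsExchangeModule G H τ α β) (x : X) (e : X ⊗[K] Y) (z : Z) :
    pairAct α β (leftFst G Y x e) z = α x (pairAct α β e z) := by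
  refine comm_of_forall_tmul (f := (pairAct α β).flip z ∘ₗ leftFst G Y x)
    (g := α x ∘ₗ (pairAct α β).flip z) (fun x' y => ?_) e
  simp [m.fst.mul_act]

theorem pairAct_rightSnd (m : IsExchangeModule G H τ α β) (y : Y) (e : X ⊗[K] Y) (z : Z) :
    pairAct α β (rightSnd H X y e) z = pairAct α β e (β y z) := by
  refine comm_of_forall_tmul (f := (pairAct α β).flip z ∘ₗ rightSnd H X y)
    (g := (pairAct α β).flip (β y z)) (fun x' y => ?_) e
  simp [m.snd.mul_act]

theorem pairAct_leftSnd (m : IsExchangeModule G H τ α β) (h : IsExchange G H τ) (y : Y) (e : X ⊗[K] Y) (z : Z) :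
    pairAct α β (leftSnd H τ y e) z = β y (pairAct α β e z) := by
  refine comm_of_forall_tmul (f := (pairAct α β).flip z ∘ₗ leftSnd H τ y)
    (g := β y ∘ₗ (pairAct α β).flip z) (fun x' y' => ?_) e
  simp [h.leftSnd_tmul, m.pairAct_rightSnd, m.exchange]

theorem pairAct_rightFst (m : IsExchangeModule G H τ α β) (h : IsExchange G H τ) (x : X) (e : X ⊗[K] Y) (z : Z) :
    pairAct α β (rightFst G τ x e) z = pairAct α β e (α x z) := by
  refine comm_of_forall_tmul (f := (pairAct α β).flip z ∘ₗ rightFst G τ x)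
    (g := (pairAct α β).flip (α x z)) (fun x' y' => ?_) e
  simp [h.rightFst_tmul, m.pairAct_leftFst, m.exchange]

theorem pairAct_mul (m : IsExchangeModule G H τ α β) (h : IsExchange G H τ) (d e : X ⊗[K] Y) (z : Z) :
    pairAct α β (h.algebra.mul d e) z = pairAct α β d (pairAct α β e z) := by
  refine comm_of_forall_tmul (f := (pairAct α β).flip z ∘ₗ h.algebra.mul.flip e)
    (g := (pairAct α β).flip (pairAct α β e z)) (fun x' y' => ?_) d
  simp [h.algebra_mul_tmul, m.pairAct_leftFst, m.pairAct_leftSnd h]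

theorem unital (m : IsExchangeModule G H τ α β) :
    Submodule.span K {w | ∃ d z, pairAct α β d z = w} = ⊤ := by
  refine span_of_lift_surjective ?_
  intro z
  obtain ⟨u, rfl⟩ := lift_surjective m.fst.unital z
  induction u with
  | zero => exact ⟨0, by simp⟩
  | add a b ha hb =>
    obtain ⟨u, hu⟩ := ha
    obtain ⟨v, hv⟩ := hb
    exact ⟨u + v, by rw [map_add, map_add, hu, hv]⟩
  | tmul x z =>
    obtain ⟨v, rfl⟩ := lift_surjective m.snd.unital z
    refine ⟨(TensorProduct.assoc K X Y Z).symm (x ⊗ₜ v), ?_⟩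
    induction v with
    | zero => simp
    | add a b ha hb => simp only [map_add, TensorProduct.tmul_add, ha, hb]
    | tmul y z => simp

end IsExchangeModule

/-- A twisted tensor product is a module over itself. -/
theorem IsExchange.isExchangeModule {τ : X ⊗[K] Y ≃ₗ[K] X ⊗[K] Y} (h : IsExchange G H τ) :
    IsExchangeModule G H τ (leftFst G Y) (leftSnd H τ) where
  fst := isUnitalModule_leftFst
  snd := isUnitalModule_leftSnd τ
  exchange x y e := by
    have h1 : ∀ d e, pairAct (leftFst G Y) (leftSnd H τ) d e = h.algebra.mul d e := fun d e =>
      comm_of_forall_tmul (f := (pairAct (leftFst G Y) (leftSnd H τ)).flip e)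
        (g := h.algebra.mul.flip e) (fun x y => by simp [h.algebra_mul_tmul]) d
    rw [h1]
    refine comm_of_forall_tmul (f := leftSnd H τ y ∘ₗ leftFst G Y x)
      (g := h.algebra.mul (τ (x ⊗ₜ y))) (fun x' y' => ?_) e
    rw [h.algebra_mul_tmul_right, ← IsExchange.exchange_mul_fst]
    simp [h.leftSnd_tmul]

theorem IsExchange.pairAct_eq_mul {τ : X ⊗[K] Y ≃ₗ[K] X ⊗[K] Y} (h : IsExchange G H τ)
    (d e : X ⊗[K] Y) : pairAct (leftFst G Y) (leftSnd H τ) d e = h.algebra.mul d e :=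
  comm_of_forall_tmul (f := (pairAct (leftFst G Y) (leftSnd H τ)).flip e)
    (g := h.algebra.mul.flip e) (fun x y => by simp [h.algebra_mul_tmul]) d

end Exchange

section

variable {K X Z : Type*} [Field K] [AddCommGroup X] [Module K X] [AddCommGroup Z] [Module K Z]
  {H : RegularMultiplierHopfAlgebra K X}

namespace RegularMultiplierHopfAlgebra

theorem cop_cop_coact (y : X) : H.cop.cop.coact Z y = H.coact Z y := by
  have : H.cop.cop.right₁ y = H.right₁ y := by
    ext x
    simp
  rw [coact, coact, this]

theorem colin_cop_cop {Z' : Type*} [AddCommGroup Z'] [Module K Z'] {t : X ⊗[K] Z →ₗ[K] X ⊗[K] Z'} :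
    H.cop.cop.Colin t ↔ H.Colin t := by
  simp only [Colin, cop_cop_coact]

theorem isTw_cop_cop {Z' : Type*} [AddCommGroup Z'] [Module K Z'] {α : X →ₗ[K] Z →ₗ[K] Z'}
    {t : X ⊗[K] Z →ₗ[K] X ⊗[K] Z'} : H.cop.cop.IsTw α t ↔ H.IsTw α t :=
  ⟨fun h => ⟨colin_cop_cop.1 h.colin, fun x z => by rw [← h.counit, cop_counitL, cop_counitL]⟩,
    fun h => ⟨colin_cop_cop.2 h.colin, fun x z => by rw [← h.counit, cop_counitL, cop_counitL]⟩⟩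

/-- The hexagon identity `t(xx' ⊗ z) = …` is inherited by a composite `r l` when `l` and `r`, placed on
different legs, commute. -/
theorem mulFst_comp_right {r l : X ⊗[K] Z →ₗ[K] X ⊗[K] Z}
    (hr : r ∘ₗ H.mulFst Z = H.mulFst Z ∘ₗ r.lTensor X ∘ₗ skip X r)
    (hl : l ∘ₗ H.mulFst Z = H.mulFst Z ∘ₗ l.lTensor X ∘ₗ skip X l)
    (h : l.lTensor X ∘ₗ skip X r = skip X r ∘ₗ l.lTensor X) :
    (r ∘ₗ l) ∘ₗ H.mulFst Z = H.mulFst Z ∘ₗ (r ∘ₗ l).lTensor X ∘ₗ skip X (r ∘ₗ l) := by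
  refine LinearMap.ext fun w => ?_
  have a1 := fun w => LinearMap.congr_fun hr w
  have a2 := fun w => LinearMap.congr_fun hl w
  have a3 := fun w => LinearMap.congr_fun h w
  simp only [LinearMap.comp_apply] at a1 a2 a3
  simp only [LinearMap.comp_apply, skip_comp, LinearMap.lTensor_comp, a1, a2, a3]

theorem mulFst_comp_left {s t : X ⊗[K] Z →ₗ[K] X ⊗[K] Z}
    (hs : s ∘ₗ H.mulFst Z = H.mulFst Z ∘ₗ skip X s ∘ₗ s.lTensor X)
    (ht : t ∘ₗ H.mulFst Z = H.mulFst Z ∘ₗ skip X t ∘ₗ t.lTensor X)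
    (h : s.lTensor X ∘ₗ skip X t = skip X t ∘ₗ s.lTensor X) :
    (s ∘ₗ t) ∘ₗ H.mulFst Z = H.mulFst Z ∘ₗ skip X (s ∘ₗ t) ∘ₗ (s ∘ₗ t).lTensor X := by
  refine LinearMap.ext fun w => ?_
  have a1 := fun w => LinearMap.congr_fun hs w
  have a2 := fun w => LinearMap.congr_fun ht w
  have a3 := fun w => LinearMap.congr_fun h w
  simp only [LinearMap.comp_apply] at a1 a2 a3
  simp only [LinearMap.comp_apply, skip_comp, LinearMap.lTensor_comp, a1, a2, a3]

/-- Twist maps for commuting families act independently. -/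
theorem IsTw.lTensor_comp_skip {Y : Type*} [AddCommGroup Y] [Module K Y] {G : RegularMultiplierHopfAlgebra K Y}
    {α : X →ₗ[K] Z →ₗ[K] Z} {t : X ⊗[K] Z →ₗ[K] X ⊗[K] Z} (ht : H.IsTw α t)
    {β : Y →ₗ[K] Z →ₗ[K] Z} {u : Y ⊗[K] Z →ₗ[K] Y ⊗[K] Z} (hu : G.IsTw β u)
    (h : ∀ x y z, α x (β y z) = β y (α x z)) :
    u.lTensor X ∘ₗ MHA.skip Y t = MHA.skip Y t ∘ₗ u.lTensor X := by
  refine (ht.skip Y).natural (ht.skip Y) fun x w => ?_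
  have := hu.natural hu (f := α x) (f' := α x) fun y z => h x y z
  simpa using (LinearMap.congr_fun this w).symm

end RegularMultiplierHopfAlgebra

end

open RegularMultiplierHopfAlgebra

/-! ### The actions of a pairing -/

namespace Pairing

variable {K A B Z : Type*} [Field K] [AddCommGroup A] [Module K A] [AddCommGroup B] [Module K B]
  [AddCommGroup Z] [Module K Z]
  {𝒜 : RegularMultiplierHopfAlgebra K A} {ℬ : RegularMultiplierHopfAlgebra K B}
  (P : Pairing 𝒜 ℬ)

/-- The pairing with its two sides exchanged. -/
def swap : Pairing ℬ 𝒜 where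
  pair := P.pair.flip
  nondegenerate := ⟨P.nondegenerate.2, P.nondegenerate.1⟩
  lA := P.lB
  lA_spec := P.lB_spec
  rA := P.rB
  rA_spec := P.rB_spec
  lB := P.lA
  lB_spec := P.lA_spec
  rB := P.rA
  rB_spec := P.rA_spec
  pair_lA a b b' := P.pair_lB b b' a
  pair_rA a b b' := P.pair_rB b b' a
  pair_lB a a' b := P.pair_lA b a a'
  pair_rB a a' b := P.pair_rA b a a'

theorem ext_left {a a' : A} (h : ∀ b, P.pair a b = P.pair a' b) : a = a' := by
  rw [← sub_eq_zero]
  apply P.nondegenerate.1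
  intro b
  simp [h]

theorem lA_mul (b b' : B) (a : A) : P.lA (ℬ.mul b b') a = P.lA b (P.lA b' a) :=
  P.ext_left fun c => by simp [P.pair_lA, ℬ.mul_assoc]

theorem rA_mul (b b' : B) (a : A) : P.rA a (ℬ.mul b b') = P.rA (P.rA a b) b' :=
  P.ext_left fun c => by simp [P.pair_rA, ℬ.mul_assoc]

theorem lA_rA (b b' : B) (a : A) : P.lA b (P.rA a b') = P.rA (P.lA b a) b' :=
  P.ext_left fun c => by simp [P.pair_rA, P.pair_lA, ℬ.mul_assoc]

/-- `(c ▶ b) ▶ a = (ι ⊗ ⟨·, b⟩)(Δ(a)(1 ⊗ c))`. As `T₁` is onto, the left action of `B` on `A` is unital. -/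
theorem lA_lB (a : A) (b : B) (c : A) :
    P.lA (P.lB c b) a = TensorProduct.rid K A ((P.pair.flip b).lTensor A (𝒜.T₁ (a ⊗ₜ c))) := by
  rw [← sub_eq_zero]
  apply 𝒜.nondeg_left
  intro a'
  have h1 : P.pair.flip (P.lB c b) = P.pair.flip b ∘ₗ 𝒜.mul.flip c := by
    ext x; simp [P.pair_lB]
  have h2 : ∀ u : A ⊗[K] A, TensorProduct.rid K A ((P.pair.flip b).lTensor A
      ((𝒜.mul.flip a').rTensor A u)) =
      𝒜.mul (TensorProduct.rid K A ((P.pair.flip b).lTensor A u)) a' := by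
    intro u
    induction u with
    | zero => simp
    | add x y hx hy => simp only [map_add, LinearMap.add_apply, hx, hy]
    | tmul p q => simp
  rw [map_sub, LinearMap.sub_apply, P.lA_spec, h1, LinearMap.lTensor_comp_apply, T₃_right₂, h2,
    sub_self]

/-- `a ◀ (b ◀ c) = (⟨·, b⟩ ⊗ ι)((c ⊗ 1)Δ(a))`. As `T₂` is onto, the right action of `B` on `A` is
unital. -/
theorem rA_rB (a : A) (b : B) (c : A) :
    P.rA a (P.rB b c) = TensorProduct.lid K A ((P.pair.flip b).rTensor A (𝒜.T₂ (c ⊗ₜ a))) := by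
  rw [← sub_eq_zero]
  apply 𝒜.nondeg_left
  intro a'
  have h1 : P.pair.flip (P.rB b c) = P.pair.flip b ∘ₗ 𝒜.mul c := by
    ext x; simp [P.pair_rB]
  have h2 : ∀ u : A ⊗[K] A, TensorProduct.lid K A ((P.pair.flip b).rTensor A
      ((𝒜.mul.flip a').lTensor A u)) =
      𝒜.mul (TensorProduct.lid K A ((P.pair.flip b).rTensor A u)) a' := by
    intro u
    induction u with
    | zero => simp
    | add x y hx hy => simp only [map_add, LinearMap.add_apply, hx, hy]
    | tmul p q => simp
  rw [map_sub, LinearMap.sub_apply, P.rA_spec, h1, LinearMap.rTensor_comp_apply, T₁_left₁, h2,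
    sub_self]

theorem exists_pair_eq_one [Nontrivial A] : ∃ a b, P.pair a b = 1 := by
  obtain ⟨a, ha⟩ := exists_ne (0 : A)
  by_contra! h
  refine ha (P.nondegenerate.1 a fun b => ?_)
  by_contra hb
  exact h a ((P.pair a b)⁻¹ • b) (by simp [hb])

theorem isUnitalModule_lA : IsUnitalModule ℬ P.lA where
  mul_act := P.lA_mul
  unital := by
    rcases subsingleton_or_nontrivial A with hA | hA
    · exact Subsingleton.elim _ _
    obtain ⟨a₁, b, hab⟩ := P.exists_pair_eq_one
    rw [eq_top_iff]
    intro a _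
    have h1 : ∀ u, TensorProduct.rid K A ((P.pair.flip b).lTensor A (𝒜.T₁ u)) ∈
        Submodule.span K {w | ∃ x v, P.lA x v = w} := by
      intro u
      induction u with
      | zero => simp
      | add x y hx hy => simp only [map_add]; exact add_mem hx hy
      | tmul x c => rw [← P.lA_lB]; exact Submodule.subset_span ⟨_, _, rfl⟩
    simpa [hab] using h1 (𝒜.T₁.symm (a ⊗ₜ a₁))

theorem isRightModule_rA : IsRightModule ℬ P.rA.flip where
  mul_act b b' a := P.rA_mul b b' a
  unital := by
    rcases subsingleton_or_nontrivial A with hA | hA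
    · exact Subsingleton.elim _ _
    obtain ⟨a₁, b, hab⟩ := P.exists_pair_eq_one
    rw [eq_top_iff]
    intro a _
    have h1 : ∀ u, TensorProduct.lid K A ((P.pair.flip b).rTensor A (𝒜.T₂ u)) ∈
        Submodule.span K {w | ∃ x v, P.rA.flip x v = w} := by
      intro u
      induction u with
      | zero => simp
      | add x y hx hy => simp only [map_add]; exact add_mem hx hy
      | tmul c x => rw [← P.rA_rB]; exact Submodule.subset_span ⟨_, _, rfl⟩
    simpa [hab] using h1 (𝒜.T₂.symm (a₁ ⊗ₜ a))

theorem isUnitalModule_lB : IsUnitalModule 𝒜 P.lB := P.swap.isUnitalModule_lA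

theorem isRightModule_rB : IsRightModule 𝒜 P.rB.flip := P.swap.isRightModule_rA

theorem lB_rB (a a' : A) (b : B) : P.lB a (P.rB b a') = P.rB (P.lB a b) a' := P.swap.lA_rA a a' b

theorem counit_rA (a : A) (b : B) : 𝒜.counit (P.rA a b) = P.pair a b := by
  rcases subsingleton_or_nontrivial A with hA | hA
  · rw [Subsingleton.elim a 0]; simp
  obtain ⟨u, hu⟩ := 𝒜.exists_counit_eq_one
  have h1 := congrArg 𝒜.counit (P.rA_spec a b u)
  have h2 : ∀ w : A ⊗[K] A, 𝒜.counit (TensorProduct.lid K A ((P.pair.flip b).rTensor A w)) =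
      P.pair (𝒜.counitR A w) b := by
    intro w
    induction w with
    | zero => simp
    | add x y hx hy => simp only [map_add, LinearMap.add_apply, hx, hy]
    | tmul p q => simp [mul_comm]
  rw [counit_mul, hu, mul_one, h2, counitR_T₁, hu, one_smul] at h1
  exact h1

theorem counit_lA (a : A) (b : B) : 𝒜.counit (P.lA b a) = P.pair a b := by
  rcases subsingleton_or_nontrivial A with hA | hA
  · rw [Subsingleton.elim a 0]; simp
  obtain ⟨u, hu⟩ := 𝒜.exists_counit_eq_one
  have h1 := congrArg 𝒜.counit (P.lA_spec b a u)
  have h2 : ∀ w : A ⊗[K] A, 𝒜.counit (TensorProduct.rid K A ((P.pair.flip b).lTensor A w)) =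
      P.pair (𝒜.counitL A w) b := by
    intro w
    induction w with
    | zero => simp
    | add x y hx hy => simp only [map_add, LinearMap.add_apply, hx, hy]
    | tmul p q => simp [mul_comm]
  rw [counit_mul, hu, mul_one, h2, counitL_T₃, hu, one_smul] at h1
  exact h1

theorem counit_rB (a : A) (b : B) : ℬ.counit (P.rB b a) = P.pair a b := P.swap.counit_rA b a

theorem counit_lB (a : A) (b : B) : ℬ.counit (P.lB a b) = P.pair a b := P.swap.counit_lA b a

/-! ### The exchange maps -/

/-- `a ⊗ b ↦ a₍₁₎ ⊗ b ◀ a₍₂₎ = b₍₁₎ ▶ a ⊗ b₍₂₎`. -/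
def lam : A ⊗[K] B ≃ₗ[K] A ⊗[K] B := P.isRightModule_rB.of_cop.twEquiv

/-- `a ⊗ b ↦ a₍₂₎ ⊗ a₍₁₎ ▶ b = a ◀ b₍₂₎ ⊗ b₍₁₎`. -/
def rho : A ⊗[K] B ≃ₗ[K] A ⊗[K] B := P.isUnitalModule_lB.twEquiv

/-- `a ⊗ b ↦ b₍₁₎ ▶ a ◀ S⁻¹(b₍₃₎) ⊗ b₍₂₎`. -/
def exch : A ⊗[K] B ≃ₗ[K] A ⊗[K] B := P.lam.trans P.rho.symm

theorem isTw_lam : 𝒜.cop.IsTw P.rB.flip P.lam.toLinearMap := P.isRightModule_rB.of_cop.isTw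

theorem isTw_rho : 𝒜.IsTw P.lB P.rho.toLinearMap := P.isUnitalModule_lB.isTw

/-- The map `λ` in terms of the comultiplication of `B`. -/
theorem comm_lam (a : A) (b : B) :
    TensorProduct.comm K A B (P.lam (a ⊗ₜ b)) = ℬ.tw P.lA (b ⊗ₜ a) := by
  apply ℬ.rTensor_cancel_right
  intro b'
  apply 𝒜.lTensor_cancel_right
  intro a'
  rw [P.isUnitalModule_lA.isTw.cover]
  have h1 := P.isTw_lam.cover a b a'
  rw [cop_mul, LinearEquiv.coe_coe] at h1
  rw [← comm_lTensor, ← comm_rTensor, ← lTensor_rTensor_comm, h1, cop_T₁]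
  let Φ : A ⊗[K] A → B ⊗[K] B → B ⊗[K] A := fun U V => TensorProduct.comm K A B
    (TensorProduct.lid K (A ⊗[K] B) ((TensorProduct.lift P.pair).rTensor (A ⊗[K] B)
      (TensorProduct.tensorTensorTensorComm K A A B B (TensorProduct.comm K A A U ⊗ₜ V))))
  have h2 : ∀ U, TensorProduct.comm K A B ((ℬ.mul.flip b').lTensor A
      (swapApply P.rB.flip b (TensorProduct.comm K A A U))) = Φ U (ℬ.T₁ (b ⊗ₜ b')) := by
    intro U
    induction U with
    | zero => simp [Φ]
    | add x y hx hy => simp only [map_add, hx, hy, Φ, TensorProduct.add_tmul]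
    | tmul p q =>
      simp only [TensorProduct.comm_tmul, swapApply_tmul, LinearMap.lTensor_tmul,
        LinearMap.flip_apply, P.rB_spec]
      generalize ℬ.T₁ (b ⊗ₜ b') = V
      induction V with
      | zero => simp [Φ]
      | add x y hx hy =>
        simp only [map_add, TensorProduct.add_tmul, hx, hy, Φ, TensorProduct.tmul_add]
      | tmul r s => simp [Φ, TensorProduct.smul_tmul]
  have h3 : ∀ V, (𝒜.mul.flip a').lTensor B (swapApply P.lA a V) = Φ (𝒜.T₃ (a ⊗ₜ a')) V := by
    intro V
    induction V with
    | zero => simp [Φ]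
    | add x y hx hy => simp only [map_add, hx, hy, Φ, TensorProduct.tmul_add]
    | tmul r s =>
      simp only [swapApply_tmul, LinearMap.lTensor_tmul, LinearMap.flip_apply, P.lA_spec]
      generalize 𝒜.T₃ (a ⊗ₜ a') = U
      induction U with
      | zero => simp [Φ]
      | add x y hx hy =>
        simp only [map_add, TensorProduct.add_tmul, hx, hy, Φ, TensorProduct.tmul_add]
      | tmul p q => simp [Φ]
  rw [h2, h3]

theorem isTw_comm_lam : ℬ.IsTw P.lA ((TensorProduct.comm K A B).toLinearMap ∘ₗ
    P.lam.toLinearMap ∘ₗ (TensorProduct.comm K B A).toLinearMap) := by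
  have : (TensorProduct.comm K A B).toLinearMap ∘ₗ
    P.lam.toLinearMap ∘ₗ (TensorProduct.comm K B A).toLinearMap = ℬ.tw P.lA :=
    TensorProduct.ext' fun b a => by simp [comm_lam]
  rw [this]
  exact P.isUnitalModule_lA.isTw

theorem swap_lam (a : A) (b : B) :
    P.swap.lam (b ⊗ₜ a) = TensorProduct.comm K A B (P.rho (a ⊗ₜ b)) := by
  have h := P.swap.comm_lam b a
  apply (TensorProduct.comm K B A).injective
  rw [h]
  have : ∀ w : A ⊗[K] B, TensorProduct.comm K B A (TensorProduct.comm K A B w) = w := fun w =>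
    (TensorProduct.comm K A B).symm_apply_apply w
  rw [this]
  rfl

theorem isTw_comm_rho : ℬ.cop.IsTw P.rA.flip ((TensorProduct.comm K A B).toLinearMap ∘ₗ
    P.rho.toLinearMap ∘ₗ (TensorProduct.comm K B A).toLinearMap) := by
  have : (TensorProduct.comm K A B).toLinearMap ∘ₗ
    P.rho.toLinearMap ∘ₗ (TensorProduct.comm K B A).toLinearMap = P.swap.lam.toLinearMap :=
    TensorProduct.ext' fun b a => by simp [swap_lam]
  rw [this]
  exact P.swap.isTw_lam

theorem isUnitalModule_invA : IsUnitalModule ℬ P.invA := by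
  have h := P.isRightModule_rA.of_cop.antipode
  rw [cop_antipode] at h
  exact ⟨h.mul_act, h.unital⟩

theorem isUnitalModule_invB : IsUnitalModule 𝒜 P.invB := P.swap.isUnitalModule_invA

theorem swap_lam_symm : P.swap.lam.symm.toLinearMap = ℬ.cop.tw P.invA := by
  have : P.swap.lam.symm.toLinearMap = ℬ.cop.tw (P.rA.flip ∘ₗ ℬ.cop.antipode.toLinearMap) := rfl
  rw [this, cop_antipode]
  rfl

theorem comm_rho_symm (w : A ⊗[K] B) :
    TensorProduct.comm K A B (P.rho.symm w) = ℬ.cop.tw P.invA (TensorProduct.comm K A B w) := by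
  obtain ⟨v, rfl⟩ := P.rho.surjective w
  have h : ∀ v, P.swap.lam (TensorProduct.comm K A B v) = TensorProduct.comm K A B (P.rho v) :=
    comm_of_forall_tmul (f := P.swap.lam.toLinearMap ∘ₗ (TensorProduct.comm K A B).toLinearMap)
      (g := (TensorProduct.comm K A B).toLinearMap ∘ₗ P.rho.toLinearMap) fun a b => by
        simp [swap_lam]
  rw [LinearEquiv.symm_apply_apply, ← swap_lam_symm, ← h]
  simp

/-- `R = λ ∘ flip`, which gives the existence and the bijectivity of `R`. -/
theorem smashTwist_eq :
    P.smashTwist = P.lam.toLinearMap ∘ₗ (TensorProduct.comm K B A).toLinearMap := by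
  refine TensorProduct.ext' fun b a => ?_
  apply (TensorProduct.comm K A B).injective
  have h := P.comm_lam a b
  simp only [LinearMap.comp_apply, LinearEquiv.coe_coe, TensorProduct.comm_tmul, h]
  rfl

/-- `T = ρ⁻¹λ ∘ flip`; in particular `T` is bijective. -/
theorem doubleTwist_eq :
    P.doubleTwist = P.exch.toLinearMap ∘ₗ (TensorProduct.comm K B A).toLinearMap := by
  rw [doubleTwist, smashTwist_eq]
  refine LinearMap.ext fun w => ?_
  apply (TensorProduct.comm K A B).injective
  have h := P.comm_rho_symm (P.lam (TensorProduct.comm K B A w))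
  have h2 : TensorProduct.comm K A B (P.exch (TensorProduct.comm K B A w)) =
    TensorProduct.comm K A B (P.rho.symm (P.lam (TensorProduct.comm K B A w))) := rfl
  simp only [LinearMap.comp_apply, LinearEquiv.coe_coe, h2, h]
  rfl

theorem wellDefined : P.WellDefined where
  antipodeA := ⟨𝒜.isCounit_counit, 𝒜.isAntipode_antipode⟩
  antipodeB := ⟨ℬ.isCounit_counit, ℬ.isAntipode_antipode⟩
  smashTwist := P.isUnitalModule_lA.isTw.isTwist_twist
  twistB := P.isUnitalModule_invB.isTw.isTwist_twist
  cotwistA := P.isUnitalModule_invA.of_cop.isTw.isTwist_twist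
  bijective := by
    rw [doubleTwist_eq]
    exact P.exch.bijective.comp (TensorProduct.comm K B A).bijective

/-- `λ` satisfies the hexagon identities: it is the twist map of a left `B`-module and also that of a
right `A`-module. -/
theorem isExchange_lam : IsExchange 𝒜.cop ℬ P.lam :=
  IsExchange.of_mulFst (τ' := ℬ.tw P.lA) (fun a b => (P.comm_lam a b).symm)
    P.isRightModule_rB.of_cop.tw_mulFst P.isUnitalModule_lA.tw_mulFst

theorem invA_lA (b b' : B) (a : A) : P.invA b (P.lA b' a) = P.lA b' (P.invA b a) :=
  (P.lA_rA b' _ a).symm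

/-- `ρ⁻¹λ` satisfies the hexagon identities, since `ρ` and `λ` do and commute on different legs. -/
theorem isExchange_exch : IsExchange 𝒜.cop ℬ P.exch := by
  refine IsExchange.of_mulFst (τ' := ℬ.cop.tw P.invA ∘ₗ ℬ.tw P.lA) (fun a b => ?_) ?_ ?_
  · rw [LinearMap.comp_apply, ← comm_lam, ← comm_rho_symm]
    rfl
  · exact mulFst_comp_right (H := 𝒜.cop) (r := P.rho.symm.toLinearMap) (l := P.lam.toLinearMap)
      P.isUnitalModule_lB.antipode_symm.tw_mulFst P.isRightModule_rB.of_cop.tw_mulFst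
      (P.isUnitalModule_lB.antipode_symm.isTw.lTensor_comp_skip P.isTw_lam
        fun x y z => P.lB_rB _ _ _)
  · exact mulFst_comp_left P.isUnitalModule_invA.of_cop.tw_mulFst P.isUnitalModule_lA.tw_mulFst
      (P.isUnitalModule_lA.isTw.lTensor_comp_skip P.isUnitalModule_invA.of_cop.isTw
        fun x y z => (P.invA_lA _ _ _).symm)

end Pairing

/-! ### Maps that are colinear for two coactions -/

section BiColin

variable {K X Y Z Z' W : Type*} [Field K] [AddCommGroup X] [Module K X] [AddCommGroup Y] [Module K Y]
  [AddCommGroup Z] [Module K Z] [AddCommGroup Z'] [Module K Z'] [AddCommGroup W] [Module K W]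
  {G : RegularMultiplierHopfAlgebra K X} {H : RegularMultiplierHopfAlgebra K Y}

/-- Maps `X ⊗ Y ⊗ Z → X ⊗ Y ⊗ Z'` that are colinear over both `X` and `Y`. -/
structure BiColin (G : RegularMultiplierHopfAlgebra K X) (H : RegularMultiplierHopfAlgebra K Y)
    (t : X ⊗[K] (Y ⊗[K] Z) →ₗ[K] X ⊗[K] (Y ⊗[K] Z')) : Prop where
  fst : G.Colin t
  snd : H.Colin ((TensorProduct.leftComm K X Y Z').toLinearMap ∘ₗ t ∘ₗ
    (TensorProduct.leftComm K Y X Z).toLinearMap)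

@[simp] theorem leftComm_leftComm (w : X ⊗[K] (Y ⊗[K] Z)) :
    TensorProduct.leftComm K Y X Z (TensorProduct.leftComm K X Y Z w) = w :=
  comm_of_forall_tmul (f := (TensorProduct.leftComm K Y X Z).toLinearMap ∘ₗ
    (TensorProduct.leftComm K X Y Z).toLinearMap) (g := LinearMap.id) (fun x v => by
      induction v with
      | zero => simp
      | add a b ha hb => simp only [TensorProduct.tmul_add, map_add, ha, hb]
      | tmul y z => simp) w

theorem counitL_leftComm (w : Y ⊗[K] (X ⊗[K] Z)) :
    G.counitL (Y ⊗[K] Z) (TensorProduct.leftComm K Y X Z w) = (G.counitL Z).lTensor Y w := by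
  induction w with
  | zero => simp
  | add a b ha hb => simp only [map_add, ha, hb]
  | tmul y v =>
    induction v with
    | zero => simp
    | add a b ha hb => simp only [TensorProduct.tmul_add, map_add, ha, hb]
    | tmul x z => simp

/-- A bicolinear map is determined by its composite with `ε ⊗ ε ⊗ ι`. -/
theorem BiColin.ext {t u : X ⊗[K] (Y ⊗[K] Z) →ₗ[K] X ⊗[K] (Y ⊗[K] Z')} (ht : BiColin G H t)
    (hu : BiColin G H u) (h : ∀ x y z, H.counitL Z' (G.counitL (Y ⊗[K] Z') (t (x ⊗ₜ (y ⊗ₜ z)))) =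
      H.counitL Z' (G.counitL (Y ⊗[K] Z') (u (x ⊗ₜ (y ⊗ₜ z))))) : t = u := by
  refine ht.fst.ext hu.fst fun x w => ?_
  have h1 := Colin.ext ((Colin.lTensor (G.counitL Z')).comp ht.snd)
    ((Colin.lTensor (G.counitL Z')).comp hu.snd) fun y v => by
      induction v with
      | zero => simp
      | add a b ha hb => simp only [TensorProduct.tmul_add, map_add, ha, hb]
      | tmul x z =>
        have := h x y z
        simp only [LinearMap.comp_apply, LinearEquiv.coe_coe, TensorProduct.leftComm_tmul]
        rw [← counitL_leftComm, ← counitL_leftComm, leftComm_leftComm, leftComm_leftComm]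
        exact this
  have h2 := LinearMap.congr_fun h1 (TensorProduct.leftComm K X Y Z (x ⊗ₜ w))
  simpa only [LinearMap.comp_apply, LinearEquiv.coe_coe, ← counitL_leftComm, leftComm_leftComm]
    using h2

theorem BiColin.comp {Z'' : Type*} [AddCommGroup Z''] [Module K Z'']
    {u : X ⊗[K] (Y ⊗[K] Z') →ₗ[K] X ⊗[K] (Y ⊗[K] Z'')}
    {t : X ⊗[K] (Y ⊗[K] Z) →ₗ[K] X ⊗[K] (Y ⊗[K] Z')} (hu : BiColin G H u) (ht : BiColin G H t) :
    BiColin G H (u ∘ₗ t) where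
  fst := hu.fst.comp ht.fst
  snd := by
    have h := hu.snd.comp ht.snd
    convert h using 1
    refine LinearMap.ext fun w => ?_
    simp

theorem leftComm_comp_skip (t : X ⊗[K] Z →ₗ[K] X ⊗[K] Z') :
    (TensorProduct.leftComm K X Y Z').toLinearMap ∘ₗ skip Y t ∘ₗ
      (TensorProduct.leftComm K Y X Z).toLinearMap = t.lTensor Y := by
  refine LinearMap.ext fun w => ?_
  simp [skip]

theorem BiColin.skip {α : X →ₗ[K] Z →ₗ[K] Z'} {t : X ⊗[K] Z →ₗ[K] X ⊗[K] Z'} (ht : G.IsTw α t) :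
    BiColin G H (MHA.skip Y t) where
  fst := (ht.skip Y).colin
  snd := by rw [leftComm_comp_skip]; exact Colin.lTensor t

theorem BiColin.lTensor {β : Y →ₗ[K] Z →ₗ[K] Z'} {u : Y ⊗[K] Z →ₗ[K] Y ⊗[K] Z'} (hu : H.IsTw β u) :
    BiColin G H (u.lTensor X) where
  fst := Colin.lTensor u
  snd := (hu.skip X).colin

theorem counit_counit_skip_lTensor {α : X →ₗ[K] Z →ₗ[K] Z} {t : X ⊗[K] Z →ₗ[K] X ⊗[K] Z}
    (ht : G.IsTw α t) {β : Y →ₗ[K] Z →ₗ[K] Z} {u : Y ⊗[K] Z →ₗ[K] Y ⊗[K] Z} (hu : H.IsTw β u)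
    (x : X) (y : Y) (z : Z) :
    H.counitL Z (G.counitL (Y ⊗[K] Z) (skip Y t (u.lTensor X (x ⊗ₜ (y ⊗ₜ z))))) = α x (β y z) := by
  rw [LinearMap.lTensor_tmul, (ht.skip Y).counit]
  simp [counitL_lTensor, hu.counit]

theorem counit_counit_lTensor_skip {α : X →ₗ[K] Z →ₗ[K] Z} {t : X ⊗[K] Z →ₗ[K] X ⊗[K] Z}
    (ht : G.IsTw α t) {β : Y →ₗ[K] Z →ₗ[K] Z} {u : Y ⊗[K] Z →ₗ[K] Y ⊗[K] Z} (hu : H.IsTw β u)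
    (x : X) (y : Y) (z : Z) :
    H.counitL Z (G.counitL (Y ⊗[K] Z) (u.lTensor X (skip Y t (x ⊗ₜ (y ⊗ₜ z))))) = β y (α x z) := by
  rw [counitL_lTensor, (ht.skip Y).counit]
  simp [hu.counit]

/-- `t : X ⊗ Y → X ⊗ Y` applied to the first two legs. -/
def onFst (Z : Type*) [AddCommGroup Z] [Module K Z] (t : X ⊗[K] Y →ₗ[K] X ⊗[K] Y) :
    X ⊗[K] (Y ⊗[K] Z) →ₗ[K] X ⊗[K] (Y ⊗[K] Z) :=
  (TensorProduct.assoc K X Y Z).toLinearMap ∘ₗ t.rTensor Z ∘ₗ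
    (TensorProduct.assoc K X Y Z).symm.toLinearMap

theorem onFst_tmul (t : X ⊗[K] Y →ₗ[K] X ⊗[K] Y) (x : X) (y : Y) (z : Z) :
    onFst Z t (x ⊗ₜ (y ⊗ₜ z)) = TensorProduct.assoc K X Y Z (t (x ⊗ₜ y) ⊗ₜ z) := by simp [onFst]

theorem onFst_comp_apply (t u : X ⊗[K] Y →ₗ[K] X ⊗[K] Y) (w : X ⊗[K] (Y ⊗[K] Z)) :
    onFst Z (t ∘ₗ u) w = onFst Z t (onFst Z u w) := by
  simp [onFst, LinearMap.rTensor_comp]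

theorem onFst_id : onFst Z (LinearMap.id : X ⊗[K] Y →ₗ[K] X ⊗[K] Y) = LinearMap.id := by
  refine LinearMap.ext fun w => ?_
  simp [onFst]

theorem leftComm_comp_onFst (t : X ⊗[K] Y →ₗ[K] X ⊗[K] Y) :
    (TensorProduct.leftComm K X Y Z).toLinearMap ∘ₗ onFst Z t ∘ₗ
      (TensorProduct.leftComm K Y X Z).toLinearMap =
    onFst Z ((TensorProduct.comm K X Y).toLinearMap ∘ₗ t ∘ₗ
      (TensorProduct.comm K Y X).toLinearMap) := by
  have h : ∀ (e : X ⊗[K] Y) (z : Z), TensorProduct.leftComm K X Y Z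
      (TensorProduct.assoc K X Y Z (e ⊗ₜ z)) =
      TensorProduct.assoc K Y X Z (TensorProduct.comm K X Y e ⊗ₜ z) := by
    intro e z
    induction e with
    | zero => simp
    | add a b ha hb => simp only [map_add, TensorProduct.add_tmul, ha, hb]
    | tmul x y => simp
  refine TensorProduct.ext' fun y v => ?_
  induction v with
  | zero => simp
  | add a b ha hb => simp only [TensorProduct.tmul_add, map_add, ha, hb]
  | tmul x z => simp [onFst_tmul, h]

theorem BiColin.onFst {t : X ⊗[K] Y →ₗ[K] X ⊗[K] Y} {γ : X →ₗ[K] Y →ₗ[K] Y} (ht : G.IsTw γ t)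
    {δ : Y →ₗ[K] X →ₗ[K] X} (ht' : H.IsTw δ ((TensorProduct.comm K X Y).toLinearMap ∘ₗ t ∘ₗ
      (TensorProduct.comm K Y X).toLinearMap)) : BiColin G H (MHA.onFst Z t) where
  fst := (ht.rTensor Z).colin
  snd := by
    rw [leftComm_comp_onFst]
    exact (ht'.rTensor Z).colin

theorem counit_counit_onFst {t : X ⊗[K] Y →ₗ[K] X ⊗[K] Y} {γ : X →ₗ[K] Y →ₗ[K] Y}
    (ht : G.IsTw γ t) (x : X) (y : Y) (z : Z) :
    H.counitL Z (G.counitL (Y ⊗[K] Z) (MHA.onFst Z t (x ⊗ₜ (y ⊗ₜ z)))) = H.counit (γ x y) • z := by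
  have := (ht.rTensor Z).counit x (y ⊗ₜ z)
  rw [MHA.onFst, this]
  simp

/-- Maps of the form `x ⊗ y ↦ x₍₁₎ ⊗ γ(x₍₂₎)(y)` commute with `x ⊗ z ↦ x₍₂₎ ⊗ x₍₁₎ z`. -/
theorem onFst_comp_skip {t : X ⊗[K] Y →ₗ[K] X ⊗[K] Y} {γ : X →ₗ[K] Y →ₗ[K] Y} (ht : G.cop.IsTw γ t)
    {α : X →ₗ[K] Z →ₗ[K] Z} (hα : IsUnitalModule G α) :
    MHA.onFst Z t ∘ₗ MHA.skip Y (G.tw α) = MHA.skip Y (G.tw α) ∘ₗ MHA.onFst Z t := by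
  have h1 : G.tw (LinearMap.lTensorHom Y ∘ₗ α) = MHA.skip Y (G.tw α) := (hα.isTw.skip Y).tw_eq
  rw [← h1]
  refine (hα.lTensor Y).tw_comm (hα.lTensor Y) (ht.rTensor Z).colin fun x => ?_
  change MHA.onFst Z t ∘ₗ _ = _ ∘ₗ MHA.onFst Z t
  refine TensorProduct.ext' fun x' v => ?_
  induction v with
  | zero => simp
  | add a b ha hb => simp only [TensorProduct.tmul_add, map_add, ha, hb]
  | tmul y z =>
    simp only [LinearMap.comp_apply, LinearMap.lTensor_tmul, LinearMap.coe_lTensorHom, onFst_tmul]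
    generalize t (x' ⊗ₜ y) = e
    induction e with
    | zero => simp
    | add a b ha hb => simp only [map_add, TensorProduct.add_tmul, ha, hb]
    | tmul x y => simp

end BiColin

/-! ### Exchange rules in terms of twist maps -/

namespace Pairing

variable {K A B Z : Type*} [Field K] [AddCommGroup A] [Module K A] [AddCommGroup B] [Module K B]
  [AddCommGroup Z] [Module K Z]
  {𝒜 : RegularMultiplierHopfAlgebra K A} {ℬ : RegularMultiplierHopfAlgebra K B}
  (P : Pairing 𝒜 ℬ)

theorem biColin_lam : BiColin 𝒜.cop ℬ (onFst Z P.lam.toLinearMap) :=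
  BiColin.onFst P.isTw_lam P.isTw_comm_lam

theorem counit_counit_skip_lTensor' {α : A →ₗ[K] Z →ₗ[K] Z} {t : A ⊗[K] Z →ₗ[K] A ⊗[K] Z}
    (ht : 𝒜.cop.IsTw α t) {β : B →ₗ[K] Z →ₗ[K] Z} {u : B ⊗[K] Z →ₗ[K] B ⊗[K] Z} (hu : ℬ.IsTw β u)
    (e : A ⊗[K] B) (z : Z) :
    ℬ.counitL Z (𝒜.cop.counitL (B ⊗[K] Z) (skip B t (u.lTensor A
      (TensorProduct.assoc K A B Z (e ⊗ₜ z))))) = pairAct α β e z := by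
  induction e with
  | zero => simp
  | add a b ha hb => simp only [map_add, TensorProduct.add_tmul, LinearMap.add_apply, ha, hb]
  | tmul a b =>
    rw [TensorProduct.assoc_tmul, counit_counit_skip_lTensor ht hu, pairAct_tmul]

theorem counit_counit_lTensor_skip' {α : A →ₗ[K] Z →ₗ[K] Z} {t : A ⊗[K] Z →ₗ[K] A ⊗[K] Z}
    (ht : 𝒜.cop.IsTw α t) {β : B →ₗ[K] Z →ₗ[K] Z} {u : B ⊗[K] Z →ₗ[K] B ⊗[K] Z} (hu : ℬ.IsTw β u)
    (e : A ⊗[K] B) (z : Z) :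
    ℬ.counitL Z (𝒜.cop.counitL (B ⊗[K] Z) (u.lTensor A (skip B t
      (TensorProduct.assoc K A B Z (e ⊗ₜ z))))) =
      pairAct β α (TensorProduct.comm K A B e) z := by
  induction e with
  | zero => simp
  | add a b ha hb => simp only [map_add, TensorProduct.add_tmul, LinearMap.add_apply, ha, hb]
  | tmul a b =>
    rw [TensorProduct.assoc_tmul, counit_counit_lTensor_skip ht hu]
    simp

/-- The exchange rule `βα = αβλ` of the Heisenberg double in terms of twist maps. -/
theorem lam_exchange_iff {α : A →ₗ[K] Z →ₗ[K] Z} {t : A ⊗[K] Z →ₗ[K] A ⊗[K] Z}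
    (ht : 𝒜.cop.IsTw α t) {β : B →ₗ[K] Z →ₗ[K] Z} {u : B ⊗[K] Z →ₗ[K] B ⊗[K] Z}
    (hu : ℬ.IsTw β u) :
    (∀ a b z, β b (α a z) = pairAct α β (P.lam (a ⊗ₜ b)) z) ↔
      ∀ w, u.lTensor A (skip B t w) = skip B t (u.lTensor A (onFst Z P.lam.toLinearMap w)) := by
  constructor
  · intro h w
    refine LinearMap.congr_fun (BiColin.ext (t := u.lTensor A ∘ₗ skip B t)
      (u := skip B t ∘ₗ u.lTensor A ∘ₗ onFst Z P.lam.toLinearMap)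
      ((BiColin.lTensor hu).comp (BiColin.skip ht))
      ((BiColin.skip ht).comp ((BiColin.lTensor hu).comp P.biColin_lam)) fun a b z => ?_) w
    simp only [LinearMap.comp_apply]
    rw [counit_counit_lTensor_skip ht hu, onFst_tmul, counit_counit_skip_lTensor' ht hu, h]
    rfl
  · intro h a b z
    rw [← counit_counit_lTensor_skip ht hu, h, onFst_tmul, counit_counit_skip_lTensor' ht hu]
    rfl

/-- The exchange rule `αβ = βαλ` of right modules over the Heisenberg double in terms of twist
maps. -/
theorem lam_exchange_right {α : A →ₗ[K] Z →ₗ[K] Z} {t : A ⊗[K] Z →ₗ[K] A ⊗[K] Z}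
    (ht : 𝒜.cop.IsTw α t) {β : B →ₗ[K] Z →ₗ[K] Z} {u : B ⊗[K] Z →ₗ[K] B ⊗[K] Z}
    (hu : ℬ.IsTw β u)
    (h : ∀ a b z, α a (β b z) = pairAct β α (TensorProduct.comm K A B (P.lam (a ⊗ₜ b))) z)
    (w : A ⊗[K] (B ⊗[K] Z)) :
    skip B t (u.lTensor A w) = u.lTensor A (skip B t (onFst Z P.lam.toLinearMap w)) := by
  refine LinearMap.congr_fun (BiColin.ext (t := skip B t ∘ₗ u.lTensor A)
    (u := u.lTensor A ∘ₗ skip B t ∘ₗ onFst Z P.lam.toLinearMap)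
    ((BiColin.skip ht).comp (BiColin.lTensor hu))
    ((BiColin.lTensor hu).comp ((BiColin.skip ht).comp P.biColin_lam)) fun a b z => ?_) w
  simp only [LinearMap.comp_apply]
  rw [counit_counit_skip_lTensor ht hu, onFst_tmul, counit_counit_lTensor_skip' ht hu, h]
  rfl

theorem onFst_rho_skip {α : A →ₗ[K] Z →ₗ[K] Z} (hα : IsUnitalModule 𝒜.cop α)
    (w : A ⊗[K] (B ⊗[K] Z)) :
    onFst Z P.rho.toLinearMap (skip B (𝒜.cop.tw α) w) =
      skip B (𝒜.cop.tw α) (onFst Z P.rho.toLinearMap w) :=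
  LinearMap.congr_fun (onFst_comp_skip (isTw_cop_cop.2 P.isTw_rho) hα) w

theorem onFst_rho_lTensor {β : B →ₗ[K] Z →ₗ[K] Z} (hβ : IsUnitalModule ℬ β)
    (w : A ⊗[K] (B ⊗[K] Z)) :
    onFst Z P.rho.toLinearMap ((ℬ.tw β).lTensor A w) =
      (ℬ.tw β).lTensor A (onFst Z P.rho.toLinearMap w) := by
  have h := LinearMap.congr_fun (onFst_comp_skip (Z := Z) P.isTw_comm_rho hβ)
    (TensorProduct.leftComm K A B Z w)
  apply (TensorProduct.leftComm K A B Z).injective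
  rw [← leftComm_comp_onFst, ← leftComm_comp_skip] at *
  simpa using h

/-- The maps `λ` and `ρ` commute. -/
theorem lam_rho (e : A ⊗[K] B) : P.lam (P.rho e) = P.rho (P.lam e) := by
  have h := P.isUnitalModule_lB.tw_comm P.isUnitalModule_lB (s := P.lam.toLinearMap)
    P.isTw_lam.colin fun a => ?_
  · exact LinearMap.congr_fun h e
  · have := P.isTw_lam.natural P.isTw_lam (f := P.lB a) (f' := P.lB a) fun x b => P.lB_rB a x b
    exact this.symm

/-- The exchange rule of the Drinfel'd double in terms of twist maps. -/
theorem exch_exchange_iff {α : A →ₗ[K] Z →ₗ[K] Z} (hα : IsUnitalModule 𝒜.cop α)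
    {β : B →ₗ[K] Z →ₗ[K] Z} (hβ : IsUnitalModule ℬ β) :
    (∀ a b z, β b (α a z) = pairAct α β (P.exch (a ⊗ₜ b)) z) ↔
      ∀ w, onFst Z P.lam.toLinearMap ((ℬ.tw β).lTensor A (skip B (𝒜.cop.tw α) w)) =
        skip B (𝒜.cop.tw α) ((ℬ.tw β).lTensor A (onFst Z P.lam.toLinearMap w)) := by
  -- `λ` and `ρ` have the same composite with `ε ⊗ ε ⊗ ι`, and `ρ` commutes with the twist maps.
  have h1 : ∀ w : A ⊗[K] (B ⊗[K] Z),
      ℬ.counitL Z (𝒜.cop.counitL (B ⊗[K] Z) (onFst Z P.lam.toLinearMap w)) =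
      ℬ.counitL Z (𝒜.cop.counitL (B ⊗[K] Z) (onFst Z P.rho.toLinearMap w)) := by
    intro w
    refine comm_of_forall_tmul (f := ℬ.counitL Z ∘ₗ 𝒜.cop.counitL (B ⊗[K] Z) ∘ₗ
      onFst Z P.lam.toLinearMap) (g := ℬ.counitL Z ∘ₗ 𝒜.cop.counitL (B ⊗[K] Z) ∘ₗ
      onFst Z P.rho.toLinearMap) (fun a v => ?_) w
    induction v with
    | zero => simp
    | add a b ha hb => simp only [TensorProduct.tmul_add, map_add, ha, hb]
    | tmul b z =>
      simp only [LinearMap.comp_apply]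
      rw [counit_counit_onFst P.isTw_lam, cop_counitL, counit_counit_onFst P.isTw_rho]
      simp [counit_rB, counit_lB]
  have h2 : ∀ w : A ⊗[K] (B ⊗[K] Z), ℬ.counitL Z (𝒜.cop.counitL (B ⊗[K] Z)
      (onFst Z P.lam.toLinearMap ((ℬ.tw β).lTensor A (skip B (𝒜.cop.tw α) w)))) =
      ℬ.counitL Z (𝒜.cop.counitL (B ⊗[K] Z)
      ((ℬ.tw β).lTensor A (skip B (𝒜.cop.tw α) (onFst Z P.rho.toLinearMap w)))) := by
    intro w
    rw [h1, P.onFst_rho_lTensor hβ, P.onFst_rho_skip hα]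
  have h3 : ∀ e : A ⊗[K] B, P.lam (P.rho.symm e) = P.exch e := by
    intro e
    apply P.rho.injective
    rw [← lam_rho]
    simp [exch]
  constructor
  · intro h w
    refine LinearMap.congr_fun (BiColin.ext
      (t := onFst Z P.lam.toLinearMap ∘ₗ (ℬ.tw β).lTensor A ∘ₗ skip B (𝒜.cop.tw α))
      (u := skip B (𝒜.cop.tw α) ∘ₗ (ℬ.tw β).lTensor A ∘ₗ onFst Z P.lam.toLinearMap)
      (P.biColin_lam.comp ((BiColin.lTensor hβ.isTw).comp (BiColin.skip hα.isTw)))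
      ((BiColin.skip hα.isTw).comp ((BiColin.lTensor hβ.isTw).comp P.biColin_lam))
      fun a b z => ?_) w
    simp only [LinearMap.comp_apply]
    rw [h2, onFst_tmul, onFst_tmul, counit_counit_skip_lTensor' hα.isTw hβ.isTw,
      counit_counit_lTensor_skip' hα.isTw hβ.isTw]
    have h4 : ∀ e, pairAct β α (TensorProduct.comm K A B e) z = pairAct α β (P.exch e) z :=
      comm_of_forall_tmul (f := (pairAct β α).flip z ∘ₗ (TensorProduct.comm K A B).toLinearMap)
        (g := (pairAct α β).flip z ∘ₗ P.exch.toLinearMap) fun a b => by simp [h]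
    simp [h4, ← h3]
  · intro h a b z
    have h4 : ∀ e : A ⊗[K] B, pairAct β α (TensorProduct.comm K A B (P.rho e)) z =
        pairAct α β (P.lam e) z := by
      refine comm_of_forall_tmul (f := (pairAct β α).flip z ∘ₗ
        (TensorProduct.comm K A B).toLinearMap ∘ₗ P.rho.toLinearMap)
        (g := (pairAct α β).flip z ∘ₗ P.lam.toLinearMap) fun a b => ?_
      simp only [LinearMap.comp_apply, LinearMap.flip_apply, LinearEquiv.coe_coe]
      rw [← counit_counit_lTensor_skip' hα.isTw hβ.isTw,
        ← counit_counit_skip_lTensor' hα.isTw hβ.isTw]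
      have h5 := h2 (a ⊗ₜ (b ⊗ₜ z))
      rw [h, onFst_tmul, onFst_tmul] at h5
      exact h5.symm
    have h6 := h4 (P.rho.symm (a ⊗ₜ b))
    rw [h3] at h6
    simpa using h6

/-! ### Convolution of modules over the doubles -/

section Conv

variable {α α' : A →ₗ[K] Z →ₗ[K] Z} {β β' : B →ₗ[K] Z →ₗ[K] Z}

/-- The diagonal action on commuting modules of the Drinfel'd double is again one: if
`λut = tuλ` and `λu't' = t'u'λ`, with `t` and `u'` commuting and `u` and `t'` commuting, then the
relation holds for the composites `t't` and `u'u`. -/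
theorem conv_exch (m : IsExchangeModule 𝒜.cop ℬ P.exch α β)
    (m' : IsExchangeModule 𝒜.cop ℬ P.exch α' β')
    (h1 : ∀ x y z, α x (α' y z) = α' y (α x z)) (h2 : ∀ x y z, α x (β' y z) = β' y (α x z))
    (h3 : ∀ x y z, β x (α' y z) = α' y (β x z)) (h4 : ∀ x y z, β x (β' y z) = β' y (β x z)) :
    IsExchangeModule 𝒜.cop ℬ P.exch (𝒜.cop.conv α α') (ℬ.conv β β') where
  fst := m.fst.conv m'.fst h1
  snd := m.snd.conv m'.snd h4
  exchange := by
    rw [P.exch_exchange_iff (m.fst.conv m'.fst h1) (m.snd.conv m'.snd h4),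
      m.fst.isTw.tw_conv m'.fst.isTw, m.snd.isTw.tw_conv m'.snd.isTw]
    intro w
    have a1 := (P.exch_exchange_iff m.fst m.snd).1 m.exchange
    have a2 := (P.exch_exchange_iff m'.fst m'.snd).1 m'.exchange
    have a3 := fun w => LinearMap.congr_fun (m'.fst.isTw.lTensor_comp_skip m.snd.isTw
      fun x y z => (h3 y x z).symm) w
    have a4 := fun w => LinearMap.congr_fun (m.fst.isTw.lTensor_comp_skip m'.snd.isTw
      fun x y z => h2 x y z) w
    simp only [LinearMap.comp_apply] at a3 a4
    simp only [skip_comp, LinearMap.lTensor_comp, LinearMap.comp_apply, a3, a2, a1, a4]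

/-- The diagonal action of the Drinfel'd double on commuting modules, one of which is a module of the
Heisenberg double, satisfies the exchange rule of the Heisenberg double: from `λut = tuλ` and
`u't' = t'u'λ` follows the second relation for the composites `t't` and `u'u`. -/
theorem conv_lam (m : IsExchangeModule 𝒜.cop ℬ P.exch α β)
    (m' : IsExchangeModule 𝒜.cop ℬ P.lam α' β')
    (h1 : ∀ x y z, α x (α' y z) = α' y (α x z)) (h2 : ∀ x y z, α x (β' y z) = β' y (α x z))
    (h3 : ∀ x y z, β x (α' y z) = α' y (β x z)) (h4 : ∀ x y z, β x (β' y z) = β' y (β x z)) :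
    IsExchangeModule 𝒜.cop ℬ P.lam (𝒜.cop.conv α α') (ℬ.conv β β') where
  fst := m.fst.conv m'.fst h1
  snd := m.snd.conv m'.snd h4
  exchange := by
    rw [P.lam_exchange_iff (m.fst.conv m'.fst h1).isTw (m.snd.conv m'.snd h4).isTw,
      m.fst.isTw.tw_conv m'.fst.isTw, m.snd.isTw.tw_conv m'.snd.isTw]
    intro w
    have a1 := (P.exch_exchange_iff m.fst m.snd).1 m.exchange
    have a2 := (P.lam_exchange_iff m'.fst.isTw m'.snd.isTw).1 m'.exchange
    have a3 := fun w => LinearMap.congr_fun (m'.fst.isTw.lTensor_comp_skip m.snd.isTw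
      fun x y z => (h3 y x z).symm) w
    have a4 := fun w => LinearMap.congr_fun (m.fst.isTw.lTensor_comp_skip m'.snd.isTw
      fun x y z => h2 x y z) w
    simp only [LinearMap.comp_apply] at a3 a4
    simp only [skip_comp, LinearMap.lTensor_comp, LinearMap.comp_apply, a3, a2, a1, a4]

end Conv

end Pairing

/-! ### Regular multiplier Hopf algebras from their canonical maps -/

section OfMaps

variable {K V : Type*} [Field K] [AddCommGroup V] [Module K V]

/-- A regular multiplier Hopf algebra from its four canonical maps. With `Δ(a)(1 ⊗ b) = T₁(a ⊗ b)`,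
`(a ⊗ 1)Δ(b) = T₂(a ⊗ b)`, `Δ(a)(b ⊗ 1) = T₃(a ⊗ b)` and `(1 ⊗ a)Δ(b) = T₄(a ⊗ b)`, the
compatibilities express that these are the coverings of one multiplier. -/
def ofMaps (N : NondegenerateAlgebra K V) (T₁ T₂ T₃ T₄ : V ⊗[K] V ≃ₗ[K] V ⊗[K] V)
    (h13 : ∀ a b c, (N.mul.flip c).rTensor V (T₁ (a ⊗ₜ b)) = (N.mul.flip b).lTensor V (T₃ (a ⊗ₜ c)))
    (h12 : ∀ a b c, (N.mul c).rTensor V (T₁ (a ⊗ₜ b)) = (N.mul.flip b).lTensor V (T₂ (c ⊗ₜ a)))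
    (h14 : ∀ a b c, (N.mul c).lTensor V (T₁ (a ⊗ₜ b)) = (N.mul.flip b).lTensor V (T₄ (c ⊗ₜ a)))
    (L : V →ₗ[K] V ⊗[K] V →ₗ[K] V ⊗[K] V)
    (hL : ∀ a p q, L a (p ⊗ₜ q) = (N.mul.flip p).rTensor V (T₁ (a ⊗ₜ q)))
    (hmul : ∀ a b z, L (N.mul a b) z = L a (L b z))
    (hco : ∀ a b c, TensorProduct.assoc K V V V
        (T₂.toLinearMap.rTensor V ((TensorProduct.assoc K V V V).symm (a ⊗ₜ T₁ (b ⊗ₜ c)))) =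
      T₁.toLinearMap.lTensor V (TensorProduct.assoc K V V V (T₂ (a ⊗ₜ b) ⊗ₜ c))) :
    RegularMultiplierHopfAlgebra K V :=
  have e1 : ∀ (f : V →ₗ[K] V) (u : V ⊗[K] V) (g : V →ₗ[K] V),
      f.lTensor V (g.rTensor V u) = g.rTensor V (f.lTensor V u) := fun f u g =>
    lTensor_rTensor_comm g f u
  have flip_mul : ∀ a b, N.mul.flip (N.mul a b) = N.mul.flip b ∘ₗ N.mul.flip a := fun a b => by
    ext c; simp [N.mul_assoc]
  have mul_mul : ∀ a b, N.mul (N.mul a b) = N.mul a ∘ₗ N.mul b := fun a b => by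
    ext c; simp [N.mul_assoc]
  have mul_flip : ∀ a b, N.mul a ∘ₗ N.mul.flip b = N.mul.flip b ∘ₗ N.mul a := fun a b => by
    ext c; simp [N.mul_assoc]
  have r1 : ∀ a b q, T₁ (a ⊗ₜ N.mul b q) = (N.mul.flip q).lTensor V (T₁ (a ⊗ₜ b)) :=
    fun a b q => N.lTensor_cancel_left fun c => by
      rw [h14, flip_mul, LinearMap.lTensor_comp_apply, ← h14, ← LinearMap.lTensor_comp_apply,
        ← LinearMap.lTensor_comp_apply, mul_flip]
  have r3 : ∀ a c p, T₃ (a ⊗ₜ N.mul c p) = (N.mul.flip p).rTensor V (T₃ (a ⊗ₜ c)) :=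
    fun a c p => N.lTensor_cancel_right fun b => by
      rw [← h13, flip_mul, LinearMap.rTensor_comp_apply, h13, e1]
  have l2 : ∀ p a b, T₂ (N.mul p a ⊗ₜ b) = (N.mul p).rTensor V (T₂ (a ⊗ₜ b)) :=
    fun p a b => N.lTensor_cancel_right fun c => by
      rw [← h12, mul_mul, LinearMap.rTensor_comp_apply, h12, e1]
  have l4 : ∀ p a b, T₄ (N.mul p a ⊗ₜ b) = (N.mul p).lTensor V (T₄ (a ⊗ₜ b)) :=
    fun p a b => N.lTensor_cancel_right fun c => by
      rw [← h14, mul_mul, LinearMap.lTensor_comp_apply, h14, ← LinearMap.lTensor_comp_apply,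
        ← LinearMap.lTensor_comp_apply, mul_flip]
  have h24 : ∀ a b p, (N.mul a).lTensor V (T₂ (p ⊗ₜ b)) = (N.mul p).rTensor V (T₄ (a ⊗ₜ b)) :=
    fun a b p => N.lTensor_cancel_right fun c => by
      rw [e1, ← h14, ← LinearMap.lTensor_comp_apply, ← mul_flip, LinearMap.lTensor_comp_apply,
        ← h12, e1]
  let R : V → V ⊗[K] V →ₗ[K] V ⊗[K] V := fun b =>
    TensorProduct.lift ((LinearMap.lTensorHom V ∘ₗ N.mul).compl₂
      ((TensorProduct.curry T₂.toLinearMap).flip b)).flip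
  have hR : ∀ b p q, R b (p ⊗ₜ q) = (N.mul q).lTensor V (T₂ (p ⊗ₜ b)) := fun b p q => by
    simp [R]
  have hLR : ∀ a v w, tensorMul N.mul v (L a w) = tensorMul N.mul (R a v) w := fun a v w => by
    induction v with
    | zero => simp
    | add x y hx hy => simp only [map_add, LinearMap.add_apply, hx, hy]
    | tmul p q =>
      induction w with
      | zero => simp
      | add x y hx hy => simp only [map_add, hx, hy]
      | tmul p' q' =>
        rw [NondegenerateAlgebra.tensorMul_tmul_left, NondegenerateAlgebra.tensorMul_tmul_right, hL, hR, ← LinearMap.rTensor_comp_apply, mul_flip, LinearMap.rTensor_comp_apply,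
          h12, ← e1, ← LinearMap.lTensor_comp_apply, mul_flip, LinearMap.lTensor_comp_apply,
          ← e1]
  let comul : V →ₗ[K] multiplierAlgebra (tensorMul N.mul) :=
    { toFun := fun a => ⟨(L a, MulOpposite.op (R a)), hLR a⟩
      map_add' := fun a b => by
        apply N.multiplier_ext
        exact L.map_add a b
      map_smul' := fun c a => by
        apply N.multiplier_ext
        exact L.map_smul c a }
  { toNondegenerateAlgebra := N
    comul := comul
    comul_mul := fun a b => by
      apply N.multiplier_ext
      exact LinearMap.ext fun z => hmul a b z
    T₁ := T₁
    T₁_spec := fun a b z => by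
      change _ = L a _
      induction z with
      | zero => simp
      | add x y hx hy => simp only [map_add, hx, hy]
      | tmul p q => rw [NondegenerateAlgebra.tensorMul_tmul_right, LinearMap.lTensor_tmul, hL, r1, e1]
    T₂ := T₂
    T₂_spec := fun a b z => by
      change _ = R b _
      induction z with
      | zero => simp
      | add x y hx hy => simp only [map_add, LinearMap.add_apply, hx, hy]
      | tmul p q =>
        rw [NondegenerateAlgebra.tensorMul_tmul_left, LinearMap.rTensor_tmul, hR, LinearMap.flip_apply, l2]
    coassoc := hco
    T₃ := T₃
    T₃_spec := fun a b z => by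
      change _ = L a _
      induction z with
      | zero => simp
      | add x y hx hy => simp only [map_add, hx, hy]
      | tmul p q =>
        rw [NondegenerateAlgebra.tensorMul_tmul_right, LinearMap.rTensor_tmul, hL, h13, r3]
    T₄ := T₄
    T₄_spec := fun a b z => by
      change _ = R b _
      induction z with
      | zero => simp
      | add x y hx hy => simp only [map_add, LinearMap.add_apply, hx, hy]
      | tmul p q =>
        rw [NondegenerateAlgebra.tensorMul_tmul_left, LinearMap.lTensor_tmul, hR, LinearMap.flip_apply, h24, l4, e1] }

end OfMaps

/-! ### Twist maps over a tensor product -/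

section PairTw

variable {K X Y Z Z' W : Type*} [Field K] [AddCommGroup X] [Module K X] [AddCommGroup Y] [Module K Y]
  [AddCommGroup Z] [Module K Z] [AddCommGroup Z'] [Module K Z'] [AddCommGroup W] [Module K W]
  {G : RegularMultiplierHopfAlgebra K X} {H : RegularMultiplierHopfAlgebra K Y}

/-- The twist map of an `X ⊗ Y`-module, from those of the `X`-module and the `Y`-module; for left
modules, where `Y` acts first. -/
def pairTw (t : X ⊗[K] Z →ₗ[K] X ⊗[K] Z) (u : Y ⊗[K] Z →ₗ[K] Y ⊗[K] Z) :
    (X ⊗[K] Y) ⊗[K] Z →ₗ[K] (X ⊗[K] Y) ⊗[K] Z :=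
  (TensorProduct.assoc K X Y Z).symm.toLinearMap ∘ₗ skip Y t ∘ₗ u.lTensor X ∘ₗ
    (TensorProduct.assoc K X Y Z).toLinearMap

/-- As `pairTw`, for right modules, where `X` acts first. -/
def pairTwRight (t : X ⊗[K] Z →ₗ[K] X ⊗[K] Z) (u : Y ⊗[K] Z →ₗ[K] Y ⊗[K] Z) :
    (X ⊗[K] Y) ⊗[K] Z →ₗ[K] (X ⊗[K] Y) ⊗[K] Z :=
  (TensorProduct.assoc K X Y Z).symm.toLinearMap ∘ₗ u.lTensor X ∘ₗ skip Y t ∘ₗ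
    (TensorProduct.assoc K X Y Z).toLinearMap

theorem pairTw_tmul (t : X ⊗[K] Z →ₗ[K] X ⊗[K] Z) (u : Y ⊗[K] Z →ₗ[K] Y ⊗[K] Z) (x : X) (y : Y)
    (z : Z) : pairTw t u ((x ⊗ₜ y) ⊗ₜ z) =
      (TensorProduct.assoc K X Y Z).symm (skip Y t (x ⊗ₜ u (y ⊗ₜ z))) := by simp [pairTw]

theorem pairTwRight_tmul (t : X ⊗[K] Z →ₗ[K] X ⊗[K] Z) (u : Y ⊗[K] Z →ₗ[K] Y ⊗[K] Z) (x : X) (y : Y)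
    (z : Z) : pairTwRight t u ((x ⊗ₜ y) ⊗ₜ z) =
      (TensorProduct.assoc K X Y Z).symm
        (u.lTensor X (TensorProduct.leftComm K Y X Z (y ⊗ₜ t (x ⊗ₜ z)))) := by
  simp [pairTwRight, skip]

/-- `skip` for an invertible map. -/
def skipEquiv (W : Type*) [AddCommGroup W] [Module K W] (t : X ⊗[K] Z ≃ₗ[K] X ⊗[K] Z) :
    X ⊗[K] (W ⊗[K] Z) ≃ₗ[K] X ⊗[K] (W ⊗[K] Z) :=
  (TensorProduct.leftComm K X W Z).trans ((t.lTensor W).trans (TensorProduct.leftComm K W X Z))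

/-- `pairTw` for invertible maps. -/
def pairTwEquiv (t : X ⊗[K] Z ≃ₗ[K] X ⊗[K] Z) (u : Y ⊗[K] Z ≃ₗ[K] Y ⊗[K] Z) :
    (X ⊗[K] Y) ⊗[K] Z ≃ₗ[K] (X ⊗[K] Y) ⊗[K] Z :=
  (TensorProduct.assoc K X Y Z).trans ((u.lTensor X).trans ((skipEquiv Y t).trans
    (TensorProduct.assoc K X Y Z).symm))

/-- `pairTwRight` for invertible maps. -/
def pairTwRightEquiv (t : X ⊗[K] Z ≃ₗ[K] X ⊗[K] Z) (u : Y ⊗[K] Z ≃ₗ[K] Y ⊗[K] Z) :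
    (X ⊗[K] Y) ⊗[K] Z ≃ₗ[K] (X ⊗[K] Y) ⊗[K] Z :=
  (TensorProduct.assoc K X Y Z).trans ((skipEquiv Y t).trans ((u.lTensor X).trans
    (TensorProduct.assoc K X Y Z).symm))

theorem pairTw_skip (t : X ⊗[K] Z →ₗ[K] X ⊗[K] Z) (u : Y ⊗[K] Z →ₗ[K] Y ⊗[K] Z) (d : X ⊗[K] Y)
    (w : W) (z : Z) : pairTw (skip W t) (skip W u) (d ⊗ₜ (w ⊗ₜ z)) =
      TensorProduct.leftComm K W (X ⊗[K] Y) Z (w ⊗ₜ pairTw t u (d ⊗ₜ z)) := by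
  induction d with
  | zero => simp
  | add a b ha hb => simp only [TensorProduct.add_tmul, map_add, TensorProduct.tmul_add, ha, hb]
  | tmul x y =>
    rw [pairTw_tmul, pairTw_tmul, skip_tmul]
    generalize u (y ⊗ₜ z) = v
    induction v with
    | zero => simp
    | add a b ha hb => simp only [map_add, TensorProduct.tmul_add, ha, hb]
    | tmul y' z' =>
      simp only [TensorProduct.leftComm_tmul, skip_tmul]
      generalize t (x ⊗ₜ z') = v
      induction v with
      | zero => simp
      | add a b ha hb => simp only [map_add, TensorProduct.tmul_add, ha, hb]
      | tmul p q => simp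

theorem pairTw_onFst (t : X ⊗[K] Z →ₗ[K] X ⊗[K] Z) (u : Y ⊗[K] Z →ₗ[K] Y ⊗[K] Z) (d : X ⊗[K] Y)
    (z : Z) (w : W) : pairTw (onFst W t) (onFst W u) (d ⊗ₜ (z ⊗ₜ w)) =
      TensorProduct.assoc K (X ⊗[K] Y) Z W (pairTw t u (d ⊗ₜ z) ⊗ₜ w) := by
  induction d with
  | zero => simp
  | add a b ha hb => simp only [TensorProduct.add_tmul, map_add, ha, hb]
  | tmul x y =>
    rw [pairTw_tmul, pairTw_tmul, onFst_tmul]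
    generalize u (y ⊗ₜ z) = v
    induction v with
    | zero => simp
    | add a b ha hb =>
      simp only [map_add, TensorProduct.tmul_add, TensorProduct.add_tmul, ha, hb]
    | tmul y' z' =>
      simp only [TensorProduct.assoc_tmul, skip_tmul, onFst_tmul]
      generalize t (x ⊗ₜ z') = v
      induction v with
      | zero => simp
      | add a b ha hb =>
        simp only [map_add, TensorProduct.tmul_add, TensorProduct.add_tmul, ha, hb]
      | tmul p q => simp

theorem pairTwRight_onFst (t : X ⊗[K] Z →ₗ[K] X ⊗[K] Z) (u : Y ⊗[K] Z →ₗ[K] Y ⊗[K] Z)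
    (d : X ⊗[K] Y) (z : Z) (w : W) : pairTwRight (onFst W t) (onFst W u) (d ⊗ₜ (z ⊗ₜ w)) =
      TensorProduct.assoc K (X ⊗[K] Y) Z W (pairTwRight t u (d ⊗ₜ z) ⊗ₜ w) := by
  induction d with
  | zero => simp
  | add a b ha hb => simp only [TensorProduct.add_tmul, map_add, ha, hb]
  | tmul x y =>
    rw [pairTwRight_tmul, pairTwRight_tmul, onFst_tmul]
    generalize t (x ⊗ₜ z) = v
    induction v with
    | zero => simp
    | add a b ha hb =>
      simp only [map_add, TensorProduct.tmul_add, TensorProduct.add_tmul, ha, hb]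
    | tmul x' z' =>
      simp only [TensorProduct.assoc_tmul, TensorProduct.leftComm_tmul, LinearMap.lTensor_tmul,
        onFst_tmul]
      generalize u (y ⊗ₜ z') = v
      induction v with
      | zero => simp
      | add a b ha hb =>
        simp only [map_add, TensorProduct.tmul_add, TensorProduct.add_tmul, ha, hb]
      | tmul p q => simp

theorem lift_pairAct_assoc_symm (α : X →ₗ[K] Z →ₗ[K] Z) (β : Y →ₗ[K] Z →ₗ[K] Z)
    (w : X ⊗[K] (Y ⊗[K] Z)) :
    TensorProduct.lift (pairAct α β) ((TensorProduct.assoc K X Y Z).symm w) =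
      TensorProduct.lift α ((TensorProduct.lift β).lTensor X w) := by
  refine comm_of_forall_tmul (f := TensorProduct.lift (pairAct α β) ∘ₗ
    (TensorProduct.assoc K X Y Z).symm.toLinearMap)
    (g := TensorProduct.lift α ∘ₗ (TensorProduct.lift β).lTensor X) (fun x v => ?_) w
  induction v with
  | zero => simp
  | add a b ha hb => simp only [TensorProduct.tmul_add, map_add, ha, hb]
  | tmul y z => simp

theorem lTensor_assoc_symm (f : Z →ₗ[K] Z') (w : X ⊗[K] (Y ⊗[K] Z)) :
    f.lTensor (X ⊗[K] Y) ((TensorProduct.assoc K X Y Z).symm w) =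
      (TensorProduct.assoc K X Y Z').symm ((f.lTensor Y).lTensor X w) := by
  refine comm_of_forall_tmul (f := f.lTensor (X ⊗[K] Y) ∘ₗ
    (TensorProduct.assoc K X Y Z).symm.toLinearMap)
    (g := (TensorProduct.assoc K X Y Z').symm.toLinearMap ∘ₗ (f.lTensor Y).lTensor X)
    (fun x v => ?_) w
  induction v with
  | zero => simp
  | add a b ha hb => simp only [TensorProduct.tmul_add, map_add, ha, hb]
  | tmul y z => simp

/-- The order of two commuting actions in a convolution may be changed at the price of the co-opposite. -/
theorem conv_cop {α β : X →ₗ[K] Z →ₗ[K] Z} (hα : IsUnitalModule G α) (hβ : IsUnitalModule G β)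
    (h : ∀ x y z, α x (β y z) = β y (α x z)) : G.cop.conv β α = G.conv α β := by
  have := hα.lift_tw_eq hβ.of_cop.isTw h
  exact LinearMap.ext fun x => LinearMap.ext fun z => (LinearMap.congr_fun this (x ⊗ₜ z)).symm

section

variable {α α' : X →ₗ[K] Z →ₗ[K] Z} {β β' : Y →ₗ[K] Z →ₗ[K] Z}

/-- The tensor product of two module structures over a twisted tensor product. -/
theorem lift_pairAct_pairTw (hα : IsUnitalModule G α) (h : ∀ x y z, α x (β' y z) = β' y (α x z))
    (d : X ⊗[K] Y) (z : Z) :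
    TensorProduct.lift (pairAct α' β') (pairTw (G.tw α) (H.tw β) (d ⊗ₜ z)) =
      pairAct (G.conv α α') (H.conv β β') d z := by
  induction d with
  | zero => simp
  | add a b ha hb => simp only [TensorProduct.add_tmul, map_add, LinearMap.add_apply, ha, hb]
  | tmul x y =>
    have h1 := (hα.isTw.skip Y).natural hα.isTw (f := TensorProduct.lift β')
      (f' := TensorProduct.lift β') fun x v => by
        refine comm_of_forall_tmul (f := TensorProduct.lift β' ∘ₗ (LinearMap.lTensorHom Y ∘ₗ α) x)
          (g := α x ∘ₗ TensorProduct.lift β') (fun y z => ?_) v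
        simp [h]
    have h2 := LinearMap.congr_fun h1 (x ⊗ₜ (H.tw β (y ⊗ₜ z)))
    rw [pairTw_tmul, lift_pairAct_assoc_symm]
    rw [LinearMap.comp_apply] at h2
    rw [h2, pairAct_tmul, conv_apply, conv_apply]
    rfl

theorem lift_pairAct_pairTw_cop (hα : IsUnitalModule G α) (hβ : IsUnitalModule H β)
    (hα' : IsUnitalModule G α') (hβ' : IsUnitalModule H β')
    (h1 : ∀ x y z, α x (α' y z) = α' y (α x z)) (h2 : ∀ x y z, β x (α' y z) = α' y (β x z))
    (h3 : ∀ x y z, β x (β' y z) = β' y (β x z)) (d : X ⊗[K] Y) (z : Z) :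
    TensorProduct.lift (pairAct α β) (pairTw (G.cop.tw α') (H.cop.tw β') (d ⊗ₜ z)) =
      pairAct (G.conv α α') (H.conv β β') d z := by
  rw [lift_pairAct_pairTw (G := G.cop) (H := H.cop) hα'.of_cop fun x y z => (h2 y x z).symm,
    conv_cop hα hα' h1, conv_cop hβ hβ' h3]

/-- `a₍₁₎` acting from the right and `a₍₂₎` from the left. -/
theorem lift_pairAct_pairTwRight {γ : X →ₗ[K] Z →ₗ[K] Z} {δ : Y →ₗ[K] Z →ₗ[K] Z}
    (hγ : IsRightModule G γ) (hδ : IsRightModule H δ)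
    (hα : IsUnitalModule G α) (hβ : IsUnitalModule H β)
    (h1 : ∀ x y z, γ x (α y z) = α y (γ x z)) (h2 : ∀ x y z, γ x (β y z) = β y (γ x z))
    (h3 : ∀ x y z, δ x (α y z) = α y (δ x z)) (h4 : ∀ x y z, δ x (β y z) = β y (δ x z))
    (d : X ⊗[K] Y) (z : Z) :
    TensorProduct.lift (pairAct δ γ ∘ₗ (TensorProduct.comm K X Y).toLinearMap)
      (pairTw (G.cop.tw α) (H.cop.tw β) (d ⊗ₜ z)) =
    TensorProduct.lift (pairAct α β) (pairTwRight (G.tw γ) (H.tw δ) (d ⊗ₜ z)) := by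
  induction d with
  | zero => simp
  | add a b ha hb => simp only [TensorProduct.add_tmul, map_add, ha, hb]
  | tmul x y =>
    have a1 : ∀ v : Y ⊗[K] Z, TensorProduct.lift (pairAct δ γ ∘ₗ
        (TensorProduct.comm K X Y).toLinearMap) ((TensorProduct.assoc K X Y Z).symm
          (skip Y (G.cop.tw α) (x ⊗ₜ v))) =
        TensorProduct.lift α ((TensorProduct.lift δ).lTensor X (skip Y (G.tw γ) (x ⊗ₜ v))) := by
      intro v
      induction v with
      | zero => simp
      | add a b ha hb => simp only [TensorProduct.tmul_add, map_add, ha, hb]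
      | tmul y' z' =>
        have b1 := LinearMap.congr_fun (hγ.lift_tw_eq hα.of_cop.isTw h1) (x ⊗ₜ z')
        simp only [LinearMap.comp_apply] at b1
        have b2 : ∀ w : X ⊗[K] Z, TensorProduct.lift (pairAct δ γ ∘ₗ
            (TensorProduct.comm K X Y).toLinearMap) ((TensorProduct.assoc K X Y Z).symm
            (TensorProduct.leftComm K Y X Z (y' ⊗ₜ w))) = δ y' (TensorProduct.lift γ w) := by
          intro w
          induction w with
          | zero => simp
          | add a b ha hb => simp only [TensorProduct.tmul_add, map_add, ha, hb]
          | tmul p q => simp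
        have b3 : ∀ w : X ⊗[K] Z, TensorProduct.lift α ((TensorProduct.lift δ).lTensor X
            (TensorProduct.leftComm K Y X Z (y' ⊗ₜ w))) = δ y' (TensorProduct.lift α w) := by
          intro w
          induction w with
          | zero => simp
          | add a b ha hb => simp only [TensorProduct.tmul_add, map_add, ha, hb]
          | tmul p q => simp [h3]
        rw [skip_tmul, skip_tmul, b2, b3, b1]
    have a2 := LinearMap.congr_fun (hγ.isTw.lTensor_comp_skip hβ.of_cop.isTw h2) (x ⊗ₜ (y ⊗ₜ z))
    simp only [LinearMap.comp_apply, LinearMap.lTensor_tmul] at a2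
    have a3 := hδ.lift_tw_eq hβ.of_cop.isTw h4
    rw [pairTw_tmul, a1, ← a2, pairTwRight_tmul, lift_pairAct_assoc_symm, skip_tmul,
      ← LinearMap.lTensor_comp_apply, ← LinearMap.lTensor_comp_apply, ← a3]

/-- Two module structures that agree after composition with `f` give twist maps that agree after
composition with `f`. -/
theorem lTensor_pairTw_eq {γ : X →ₗ[K] Z →ₗ[K] Z} {δ : Y →ₗ[K] Z →ₗ[K] Z}
    (hγ : IsRightModule G γ) (hδ : IsRightModule H δ)
    (hα : IsUnitalModule G α) (hβ : IsUnitalModule H β)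
    (h2 : ∀ x y z, γ x (β y z) = β y (γ x z)) {f : Z →ₗ[K] Z'}
    (h3 : ∀ x z, f (α x z) = f (γ x z)) (h4 : ∀ y z, f (β y z) = f (δ y z))
    (d : X ⊗[K] Y) (z : Z) :
    f.lTensor (X ⊗[K] Y) (pairTw (G.tw α) (H.tw β) (d ⊗ₜ z)) =
      f.lTensor (X ⊗[K] Y) (pairTwRight (G.tw γ) (H.tw δ) (d ⊗ₜ z)) := by
  induction d with
  | zero => simp
  | add a b ha hb => simp only [TensorProduct.add_tmul, map_add, ha, hb]
  | tmul x y =>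
    have a1 := (hα.isTw.skip Y).balanced (hγ.isTw.skip Y) (f := f.lTensor Y) (f' := f.lTensor Y)
      fun x v => by
        refine comm_of_forall_tmul (f := f.lTensor Y ∘ₗ (LinearMap.lTensorHom Y ∘ₗ α) x)
          (g := f.lTensor Y ∘ₗ (LinearMap.lTensorHom Y ∘ₗ γ) x) (fun y z => ?_) v
        simp [h3]
    have a2 := LinearMap.congr_fun (hγ.isTw.lTensor_comp_skip hβ.isTw h2) (x ⊗ₜ (y ⊗ₜ z))
    simp only [LinearMap.comp_apply, LinearMap.lTensor_tmul] at a2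
    have a3 := hβ.isTw.balanced hδ.isTw (f := f) (f' := f) h4
    have a4 := LinearMap.congr_fun a1 (x ⊗ₜ (H.tw β (y ⊗ₜ z)))
    simp only [LinearMap.comp_apply] at a4
    rw [pairTw_tmul, pairTwRight_tmul, lTensor_assoc_symm, lTensor_assoc_symm, a4, ← a2, skip_tmul,
      ← LinearMap.lTensor_comp_apply, ← LinearMap.lTensor_comp_apply, a3]

/-- Twist maps of commuting actions commute when one of them is taken for the co-opposite
comultiplication; this is the source of coassociativity. -/
theorem pairTwRight_comm_pairTw {γ : X →ₗ[K] Z →ₗ[K] Z} {δ : Y →ₗ[K] Z →ₗ[K] Z}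
    (hγ : IsRightModule G γ) (hδ : IsRightModule H δ)
    (hα : IsUnitalModule G α) (hβ : IsUnitalModule H β)
    (h1 : ∀ x y z, γ x (α y z) = α y (γ x z)) (h2 : ∀ x y z, γ x (β y z) = β y (γ x z))
    (h3 : ∀ x y z, δ x (α y z) = α y (δ x z)) (h4 : ∀ x y z, δ x (β y z) = β y (δ x z))
    (w : (X ⊗[K] Y) ⊗[K] Z) :
    pairTwRight (G.tw γ) (H.tw δ) (pairTw (G.cop.tw α) (H.cop.tw β) w) =
      pairTw (G.cop.tw α) (H.cop.tw β) (pairTwRight (G.tw γ) (H.tw δ) w) := by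
  have a1 : G.cop.tw α ∘ₗ G.tw γ = G.tw γ ∘ₗ G.cop.tw α :=
    hγ.tw_comm hγ hα.of_cop.isTw.colin fun x =>
      (hα.of_cop.isTw.natural hα.of_cop.isTw (f := γ x) (f' := γ x) fun y z => h1 x y z).symm
  have a2 : H.cop.tw β ∘ₗ H.tw δ = H.tw δ ∘ₗ H.cop.tw β :=
    hδ.tw_comm hδ hβ.of_cop.isTw.colin fun x =>
      (hβ.of_cop.isTw.natural hβ.of_cop.isTw (f := δ x) (f' := δ x) fun y z => h4 x y z).symm
  have b1 : ∀ v, skip Y (G.tw γ) (skip Y (G.cop.tw α) v) =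
      skip Y (G.cop.tw α) (skip Y (G.tw γ) v) := fun v => by
    rw [← LinearMap.comp_apply, ← skip_comp, ← a1, skip_comp]; rfl
  have b2 : ∀ v : X ⊗[K] (Y ⊗[K] Z), (H.tw δ).lTensor X ((H.cop.tw β).lTensor X v) =
      (H.cop.tw β).lTensor X ((H.tw δ).lTensor X v) := fun v => by
    rw [← LinearMap.lTensor_comp_apply, ← a2, LinearMap.lTensor_comp_apply]
  have b3 := fun v => LinearMap.congr_fun (hγ.isTw.lTensor_comp_skip hβ.of_cop.isTw h2) v
  have b4 := fun v => LinearMap.congr_fun (hα.of_cop.isTw.lTensor_comp_skip hδ.isTw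
    fun x y z => (h3 y x z).symm) v
  simp only [LinearMap.comp_apply] at b3 b4
  simp only [pairTw, pairTwRight, LinearMap.comp_apply, LinearEquiv.coe_coe,
    LinearEquiv.apply_symm_apply]
  rw [b1, b4, ← b3, b2]

end

end PairTw

/-! ### Hopf structure on a twisted tensor product -/

section Hopf

variable {K X Y Z Z' W : Type*} [Field K] [AddCommGroup X] [Module K X] [AddCommGroup Y] [Module K Y]
  [AddCommGroup Z] [Module K Z] [AddCommGroup Z'] [Module K Z'] [AddCommGroup W] [Module K W]
  {G : RegularMultiplierHopfAlgebra K X} {H : RegularMultiplierHopfAlgebra K Y}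

/-- The action `d ↦ d₍₁₎ z ⊗ d₍₂₎ z'` on a tensor product of two modules. -/
def tensorAct (G : RegularMultiplierHopfAlgebra K X) (α : X →ₗ[K] Z →ₗ[K] Z)
    (α' : X →ₗ[K] Z' →ₗ[K] Z') : X →ₗ[K] Z ⊗[K] Z' →ₗ[K] Z ⊗[K] Z' :=
  G.conv (LinearMap.rTensorHom Z' ∘ₗ α) (LinearMap.lTensorHom Z ∘ₗ α')

theorem rTensorHom_lTensorHom_comm (α : X →ₗ[K] Z →ₗ[K] Z) (β : Y →ₗ[K] Z' →ₗ[K] Z') (x : X)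
    (y : Y) (w : Z ⊗[K] Z') : (LinearMap.rTensorHom Z' ∘ₗ α) x ((LinearMap.lTensorHom Z ∘ₗ β) y w) =
      (LinearMap.lTensorHom Z ∘ₗ β) y ((LinearMap.rTensorHom Z' ∘ₗ α) x w) :=
  (lTensor_rTensor_comm (α x) (β y) w).symm

theorem tw_rTensorHom {α : X →ₗ[K] Z →ₗ[K] Z} (h : G.IsTw α (G.tw α)) :
    G.tw (LinearMap.rTensorHom W ∘ₗ α) = onFst W (G.tw α) := (h.rTensor W).tw_eq

theorem tw_lTensorHom {α : X →ₗ[K] Z →ₗ[K] Z} (h : G.IsTw α (G.tw α)) :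
    G.tw (LinearMap.lTensorHom W ∘ₗ α) = skip W (G.tw α) := (h.skip W).tw_eq

theorem pairAct_rTensorHom (α : X →ₗ[K] Z →ₗ[K] Z) (β : Y →ₗ[K] Z →ₗ[K] Z) (d : X ⊗[K] Y)
    (w : Z ⊗[K] W) : pairAct (LinearMap.rTensorHom W ∘ₗ α) (LinearMap.rTensorHom W ∘ₗ β) d w =
      (pairAct α β d).rTensor W w := by
  induction d with
  | zero => simp
  | add a b ha hb => simp only [map_add, LinearMap.add_apply, LinearMap.rTensor_add, ha, hb]
  | tmul x y =>
    have : pairAct α β (x ⊗ₜ y) = α x ∘ₗ β y := LinearMap.ext fun z => by simp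
    rw [this, LinearMap.rTensor_comp]
    simp

theorem pairAct_lTensorHom (α : X →ₗ[K] Z →ₗ[K] Z) (β : Y →ₗ[K] Z →ₗ[K] Z) (d : X ⊗[K] Y)
    (w : W ⊗[K] Z) : pairAct (LinearMap.lTensorHom W ∘ₗ α) (LinearMap.lTensorHom W ∘ₗ β) d w =
      (pairAct α β d).lTensor W w := by
  induction d with
  | zero => simp
  | add a b ha hb => simp only [map_add, LinearMap.add_apply, LinearMap.lTensor_add, ha, hb]
  | tmul x y =>
    have : pairAct α β (x ⊗ₜ y) = α x ∘ₗ β y := LinearMap.ext fun z => by simp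
    rw [this, LinearMap.lTensor_comp]
    simp

variable {τ : X ⊗[K] Y ≃ₗ[K] X ⊗[K] Y}

theorem IsExchangeModule.rTensor {α : X →ₗ[K] Z →ₗ[K] Z} {β : Y →ₗ[K] Z →ₗ[K] Z}
    (m : IsExchangeModule G H τ α β) (W : Type*) [AddCommGroup W] [Module K W] :
    IsExchangeModule G H τ (LinearMap.rTensorHom W ∘ₗ α) (LinearMap.rTensorHom W ∘ₗ β) where
  fst := m.fst.rTensor W
  snd := m.snd.rTensor W
  exchange x y w := by
    rw [pairAct_rTensorHom]
    refine comm_of_forall_tmul (f := (LinearMap.rTensorHom W ∘ₗ β) y ∘ₗ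
      (LinearMap.rTensorHom W ∘ₗ α) x) (g := (pairAct α β (τ (x ⊗ₜ y))).rTensor W) (fun z w => ?_) w
    simp [m.exchange]

theorem IsExchangeModule.lTensor {α : X →ₗ[K] Z →ₗ[K] Z} {β : Y →ₗ[K] Z →ₗ[K] Z}
    (m : IsExchangeModule G H τ α β) (W : Type*) [AddCommGroup W] [Module K W] :
    IsExchangeModule G H τ (LinearMap.lTensorHom W ∘ₗ α) (LinearMap.lTensorHom W ∘ₗ β) where
  fst := m.fst.lTensor W
  snd := m.snd.lTensor W
  exchange x y w := by
    rw [pairAct_lTensorHom]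
    refine comm_of_forall_tmul (f := (LinearMap.lTensorHom W ∘ₗ β) y ∘ₗ
      (LinearMap.lTensorHom W ∘ₗ α) x) (g := (pairAct α β (τ (x ⊗ₜ y))).lTensor W) (fun z w => ?_) w
    simp [m.exchange]

namespace IsExchange

theorem pairAct_right_eq_mul (h : IsExchange G H τ) (d e : X ⊗[K] Y) :
    pairAct (rightSnd H X) (rightFst G τ) (TensorProduct.comm K X Y d) e = h.algebra.mul e d :=
  comm_of_forall_tmul (f := (pairAct (rightSnd H X) (rightFst G τ)).flip e ∘ₗ
    (TensorProduct.comm K X Y).toLinearMap) (g := h.algebra.mul e)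
    (fun x y => by simp [h.algebra_mul_tmul_right]) d

end IsExchange

variable (G H τ) in
/-- `Δ(a)(1 ⊗ b)` for the twisted tensor product. -/
def pairT₁ : (X ⊗[K] Y) ⊗[K] (X ⊗[K] Y) ≃ₗ[K] (X ⊗[K] Y) ⊗[K] (X ⊗[K] Y) :=
  pairTwEquiv (isUnitalModule_leftFst (G := G)).of_cop.twEquiv
    (isUnitalModule_leftSnd (H := H) τ).of_cop.twEquiv

variable (G H τ) in
/-- `(a ⊗ 1)Δ(b)` for the twisted tensor product. -/
def pairT₂ : (X ⊗[K] Y) ⊗[K] (X ⊗[K] Y) ≃ₗ[K] (X ⊗[K] Y) ⊗[K] (X ⊗[K] Y) :=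
  (TensorProduct.comm K _ _).trans ((pairTwRightEquiv (isRightModule_rightFst (G := G) τ).twEquiv
    (isRightModule_rightSnd (H := H)).twEquiv).trans (TensorProduct.comm K _ _))

variable (G H τ) in
/-- `Δ(a)(b ⊗ 1)` for the twisted tensor product. -/
def pairT₃ : (X ⊗[K] Y) ⊗[K] (X ⊗[K] Y) ≃ₗ[K] (X ⊗[K] Y) ⊗[K] (X ⊗[K] Y) :=
  (pairTwEquiv (isUnitalModule_leftFst (G := G)).twEquiv
    (isUnitalModule_leftSnd (H := H) τ).twEquiv).trans (TensorProduct.comm K _ _)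

variable (G H τ) in
/-- `(1 ⊗ a)Δ(b)` for the twisted tensor product. -/
def pairT₄ : (X ⊗[K] Y) ⊗[K] (X ⊗[K] Y) ≃ₗ[K] (X ⊗[K] Y) ⊗[K] (X ⊗[K] Y) :=
  (TensorProduct.comm K _ _).trans
    (pairTwRightEquiv (isRightModule_rightFst (G := G) τ).of_cop.twEquiv
      (isRightModule_rightSnd (H := H)).of_cop.twEquiv)

theorem pairT₁_apply (w : (X ⊗[K] Y) ⊗[K] (X ⊗[K] Y)) :
    pairT₁ G H τ w = pairTw (G.cop.tw (leftFst G Y)) (H.cop.tw (leftSnd H τ)) w := rfl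
theorem pairT₂_tmul (a b : X ⊗[K] Y) : pairT₂ G H τ (a ⊗ₜ b) = TensorProduct.comm K _ _
    (pairTwRight (G.tw (rightFst G τ)) (H.tw (rightSnd H X)) (b ⊗ₜ a)) := rfl
theorem pairT₃_apply (w : (X ⊗[K] Y) ⊗[K] (X ⊗[K] Y)) : pairT₃ G H τ w =
    TensorProduct.comm K _ _ (pairTw (G.tw (leftFst G Y)) (H.tw (leftSnd H τ)) w) := rfl
theorem pairT₄_tmul (a b : X ⊗[K] Y) : pairT₄ G H τ (a ⊗ₜ b) =
    pairTwRight (G.cop.tw (rightFst G τ)) (H.cop.tw (rightSnd H X)) (b ⊗ₜ a) := rfl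

namespace IsExchange

/-- `(Δ(a)(1 ⊗ b))(c ⊗ 1)` is the diagonal action of `a` on `c ⊗ b`. -/
theorem rTensor_pairT₁ (h : IsExchange G H τ) (a b c : X ⊗[K] Y) :
    (h.algebra.mul.flip c).rTensor (X ⊗[K] Y) (pairT₁ G H τ (a ⊗ₜ b)) =
      pairAct (tensorAct G (leftFst G Y) (leftFst G Y)) (tensorAct H (leftSnd H τ) (leftSnd H τ)) a
        (c ⊗ₜ b) := by
  have l := isUnitalModule_leftFst (G := G) (Y := Y)
  have m := isUnitalModule_leftSnd (H := H) τ
  rw [tensorAct, tensorAct, ← lift_pairAct_pairTw_cop (l.rTensor _) (m.rTensor _)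
    (l.lTensor _) (m.lTensor _) (fun _ _ _ => rTensorHom_lTensorHom_comm _ _ _ _ _)
    (fun _ _ _ => rTensorHom_lTensorHom_comm _ _ _ _ _)
    (fun _ _ _ => rTensorHom_lTensorHom_comm _ _ _ _ _), tw_lTensorHom l.of_cop.isTw,
    tw_lTensorHom m.of_cop.isTw, pairTw_skip, pairT₁_apply]
  generalize pairTw (K := K) (X := X) (Y := Y) (Z := X ⊗[K] Y) _ _ _ = u
  induction u with
  | zero => simp
  | add x y hx hy => simp only [map_add, TensorProduct.tmul_add, hx, hy]
  | tmul p q =>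
    rw [TensorProduct.leftComm_tmul, TensorProduct.lift.tmul, pairAct_rTensorHom]
    simp [h.pairAct_eq_mul]

/-- `(Δ(a)(c ⊗ 1))(1 ⊗ b)` is the diagonal action of `a` on `c ⊗ b`. -/
theorem lTensor_pairT₃ (h : IsExchange G H τ) (a b c : X ⊗[K] Y) :
    (h.algebra.mul.flip b).lTensor (X ⊗[K] Y) (pairT₃ G H τ (a ⊗ₜ c)) =
      pairAct (tensorAct G (leftFst G Y) (leftFst G Y)) (tensorAct H (leftSnd H τ) (leftSnd H τ)) a
        (c ⊗ₜ b) := by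
  have l := isUnitalModule_leftFst (G := G) (Y := Y)
  have m := isUnitalModule_leftSnd (H := H) τ
  rw [tensorAct, tensorAct, ← lift_pairAct_pairTw (l.rTensor _)
    (fun _ _ _ => rTensorHom_lTensorHom_comm _ _ _ _ _), tw_rTensorHom l.isTw,
    tw_rTensorHom m.isTw, pairTw_onFst, pairT₃_apply]
  generalize pairTw (K := K) (X := X) (Y := Y) (Z := X ⊗[K] Y) _ _ _ = u
  induction u with
  | zero => simp
  | add x y hx hy => simp only [map_add, TensorProduct.add_tmul, hx, hy]
  | tmul p q =>
    rw [TensorProduct.assoc_tmul, TensorProduct.lift.tmul, pairAct_lTensorHom]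
    simp [h.pairAct_eq_mul]

theorem rTensor_mul_pairT₁ (h : IsExchange G H τ) (a b c : X ⊗[K] Y) :
    (h.algebra.mul c).rTensor (X ⊗[K] Y) (pairT₁ G H τ (a ⊗ₜ b)) =
      (h.algebra.mul.flip b).lTensor (X ⊗[K] Y) (pairT₂ G H τ (c ⊗ₜ a)) := by
  have l := isUnitalModule_leftFst (G := G) (Y := Y)
  have m := isUnitalModule_leftSnd (H := H) τ
  have r := isRightModule_rightFst (G := G) τ
  have s := isRightModule_rightSnd (H := H) (X := X)
  have key := lift_pairAct_pairTwRight (r.rTensor (X ⊗[K] Y)) (s.rTensor (X ⊗[K] Y))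
    (l.lTensor (X ⊗[K] Y)) (m.lTensor (X ⊗[K] Y))
    (fun _ _ _ => rTensorHom_lTensorHom_comm _ _ _ _ _)
    (fun _ _ _ => rTensorHom_lTensorHom_comm _ _ _ _ _)
    (fun _ _ _ => rTensorHom_lTensorHom_comm _ _ _ _ _)
    (fun _ _ _ => rTensorHom_lTensorHom_comm _ _ _ _ _) a (c ⊗ₜ b)
  rw [tw_lTensorHom l.of_cop.isTw, tw_lTensorHom m.of_cop.isTw, pairTw_skip,
    tw_rTensorHom r.isTw, tw_rTensorHom s.isTw, pairTwRight_onFst] at key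
  rw [pairT₁_apply, pairT₂_tmul]
  generalize pairTw (K := K) (X := X) (Y := Y) (Z := X ⊗[K] Y) _ _ _ = u at *
  generalize pairTwRight (K := K) (X := X) (Y := Y) (Z := X ⊗[K] Y) _ _ _ = v at *
  have h1 : (h.algebra.mul c).rTensor (X ⊗[K] Y) u = TensorProduct.lift
      (pairAct (LinearMap.rTensorHom (X ⊗[K] Y) ∘ₗ rightSnd H X)
        (LinearMap.rTensorHom (X ⊗[K] Y) ∘ₗ rightFst G τ) ∘ₗ (TensorProduct.comm K X Y).toLinearMap)
      (TensorProduct.leftComm K (X ⊗[K] Y) (X ⊗[K] Y) (X ⊗[K] Y) (c ⊗ₜ u)) := by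
    clear key
    induction u with
    | zero => simp
    | add x y hx hy => simp only [map_add, TensorProduct.tmul_add, hx, hy]
    | tmul p q =>
      rw [TensorProduct.leftComm_tmul, TensorProduct.lift.tmul, LinearMap.comp_apply,
        pairAct_rTensorHom]
      simp [h.pairAct_right_eq_mul]
  have h2 : (h.algebra.mul.flip b).lTensor (X ⊗[K] Y) (TensorProduct.comm K _ _ v) =
      TensorProduct.lift (pairAct (LinearMap.lTensorHom (X ⊗[K] Y) ∘ₗ leftFst G Y)
        (LinearMap.lTensorHom (X ⊗[K] Y) ∘ₗ leftSnd H τ))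
      (TensorProduct.assoc K (X ⊗[K] Y) (X ⊗[K] Y) (X ⊗[K] Y) (v ⊗ₜ b)) := by
    clear key
    induction v with
    | zero => simp
    | add x y hx hy => simp only [map_add, TensorProduct.add_tmul, hx, hy]
    | tmul p q =>
      rw [TensorProduct.assoc_tmul, TensorProduct.lift.tmul, pairAct_lTensorHom]
      simp [h.pairAct_eq_mul]
  rw [h1, h2, key]

theorem lTensor_mul_pairT₁ (h : IsExchange G H τ) (a b c : X ⊗[K] Y) :
    (h.algebra.mul c).lTensor (X ⊗[K] Y) (pairT₁ G H τ (a ⊗ₜ b)) =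
      (h.algebra.mul.flip b).lTensor (X ⊗[K] Y) (pairT₄ G H τ (c ⊗ₜ a)) := by
  have l := isUnitalModule_leftFst (G := G) (Y := Y)
  have m := isUnitalModule_leftSnd (H := H) τ
  have r := isRightModule_rightFst (G := G) τ
  have s := isRightModule_rightSnd (H := H) (X := X)
  have key := lTensor_pairTw_eq (r.of_cop.rTensor (X ⊗[K] Y)) (s.of_cop.rTensor (X ⊗[K] Y))
    (l.of_cop.lTensor (X ⊗[K] Y)) (m.of_cop.lTensor (X ⊗[K] Y))
    (fun _ _ _ => rTensorHom_lTensorHom_comm _ _ _ _ _) (f := TensorProduct.lift h.algebra.mul)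
    (fun x e => comm_of_forall_tmul (f := TensorProduct.lift h.algebra.mul ∘ₗ
        (LinearMap.lTensorHom (X ⊗[K] Y) ∘ₗ leftFst G Y) x)
      (g := TensorProduct.lift h.algebra.mul ∘ₗ
        (LinearMap.rTensorHom (X ⊗[K] Y) ∘ₗ rightFst G τ) x) (fun p q => by
          have := (h.isExchangeModule.pairAct_rightFst h x p q)
          simpa [h.pairAct_eq_mul] using this.symm) e)
    (fun y e => comm_of_forall_tmul (f := TensorProduct.lift h.algebra.mul ∘ₗ
        (LinearMap.lTensorHom (X ⊗[K] Y) ∘ₗ leftSnd H τ) y)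
      (g := TensorProduct.lift h.algebra.mul ∘ₗ
        (LinearMap.rTensorHom (X ⊗[K] Y) ∘ₗ rightSnd H X) y) (fun p q => by
          have := (h.isExchangeModule.pairAct_rightSnd y p q)
          simpa [h.pairAct_eq_mul] using this.symm) e) a (c ⊗ₜ b)
  rw [tw_lTensorHom l.of_cop.isTw, tw_lTensorHom m.of_cop.isTw, pairTw_skip,
    tw_rTensorHom r.of_cop.isTw, tw_rTensorHom s.of_cop.isTw, pairTwRight_onFst] at key
  rw [pairT₁_apply, pairT₄_tmul]
  generalize pairTw (K := K) (X := X) (Y := Y) (Z := X ⊗[K] Y) _ _ _ = u at *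
  generalize pairTwRight (K := K) (X := X) (Y := Y) (Z := X ⊗[K] Y) _ _ _ = v at *
  have h1 : (h.algebra.mul c).lTensor (X ⊗[K] Y) u =
      (TensorProduct.lift h.algebra.mul).lTensor (X ⊗[K] Y)
      (TensorProduct.leftComm K (X ⊗[K] Y) (X ⊗[K] Y) (X ⊗[K] Y) (c ⊗ₜ u)) := by
    clear key
    induction u with
    | zero => simp
    | add x y hx hy => simp only [map_add, TensorProduct.tmul_add, hx, hy]
    | tmul p q => simp
  have h2 : (h.algebra.mul.flip b).lTensor (X ⊗[K] Y) v =
      (TensorProduct.lift h.algebra.mul).lTensor (X ⊗[K] Y)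
      (TensorProduct.assoc K (X ⊗[K] Y) (X ⊗[K] Y) (X ⊗[K] Y) (v ⊗ₜ b)) := by
    clear key
    induction v with
    | zero => simp
    | add x y hx hy => simp only [map_add, TensorProduct.add_tmul, hx, hy]
    | tmul p q => simp
  rw [h1, h2, key]

/-- Coassociativity: left and right multiplications commute, hence so do their twist maps. -/
theorem pair_coassoc (a b c : X ⊗[K] Y) :
    TensorProduct.assoc K _ _ _ ((pairT₂ G H τ).toLinearMap.rTensor (X ⊗[K] Y)
      ((TensorProduct.assoc K _ _ _).symm (a ⊗ₜ pairT₁ G H τ (b ⊗ₜ c)))) =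
    (pairT₁ G H τ).toLinearMap.lTensor (X ⊗[K] Y)
      (TensorProduct.assoc K _ _ _ (pairT₂ G H τ (a ⊗ₜ b) ⊗ₜ c)) := by
  have l := isUnitalModule_leftFst (G := G) (Y := Y)
  have m := isUnitalModule_leftSnd (H := H) τ
  have r := isRightModule_rightFst (G := G) τ
  have s := isRightModule_rightSnd (H := H) (X := X)
  have key := pairTwRight_comm_pairTw (r.rTensor (X ⊗[K] Y)) (s.rTensor (X ⊗[K] Y))
    (l.lTensor (X ⊗[K] Y)) (m.lTensor (X ⊗[K] Y))
    (fun _ _ _ => rTensorHom_lTensorHom_comm _ _ _ _ _)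
    (fun _ _ _ => rTensorHom_lTensorHom_comm _ _ _ _ _)
    (fun _ _ _ => rTensorHom_lTensorHom_comm _ _ _ _ _)
    (fun _ _ _ => rTensorHom_lTensorHom_comm _ _ _ _ _) (b ⊗ₜ (a ⊗ₜ c))
  rw [tw_lTensorHom l.of_cop.isTw, tw_lTensorHom m.of_cop.isTw, pairTw_skip,
    tw_rTensorHom r.isTw, tw_rTensorHom s.isTw, pairTwRight_onFst] at key
  have h1 : ∀ u, TensorProduct.assoc K _ _ _ ((pairT₂ G H τ).toLinearMap.rTensor (X ⊗[K] Y)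
      ((TensorProduct.assoc K _ _ _).symm (a ⊗ₜ u))) = TensorProduct.leftComm K _ _ _
      (pairTwRight (onFst (X ⊗[K] Y) (G.tw (rightFst G τ))) (onFst (X ⊗[K] Y) (H.tw (rightSnd H X)))
        (TensorProduct.leftComm K (X ⊗[K] Y) (X ⊗[K] Y) (X ⊗[K] Y) (a ⊗ₜ u))) := by
    intro u
    induction u with
    | zero => simp
    | add x y hx hy => simp only [map_add, TensorProduct.tmul_add, hx, hy]
    | tmul p q =>
      rw [TensorProduct.leftComm_tmul, pairTwRight_onFst, TensorProduct.assoc_symm_tmul,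
        LinearMap.rTensor_tmul, LinearEquiv.coe_coe, pairT₂_tmul]
      generalize pairTwRight (K := K) (X := X) (Y := Y) (Z := X ⊗[K] Y) _ _ _ = v
      induction v with
      | zero => simp
      | add x y hx hy => simp only [map_add, TensorProduct.add_tmul, hx, hy]
      | tmul p q => simp
  have h2 : ∀ v, (pairT₁ G H τ).toLinearMap.lTensor (X ⊗[K] Y)
      (TensorProduct.assoc K _ _ _ (TensorProduct.comm K _ _ v ⊗ₜ c)) =
      TensorProduct.leftComm K _ _ _ (pairTw (skip (X ⊗[K] Y) (G.cop.tw (leftFst G Y)))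
        (skip (X ⊗[K] Y) (H.cop.tw (leftSnd H τ)))
        (TensorProduct.assoc K (X ⊗[K] Y) (X ⊗[K] Y) (X ⊗[K] Y) (v ⊗ₜ c))) := by
    intro v
    induction v with
    | zero => simp
    | add x y hx hy => simp only [map_add, TensorProduct.add_tmul, hx, hy]
    | tmul p q =>
      rw [TensorProduct.comm_tmul, TensorProduct.assoc_tmul, TensorProduct.assoc_tmul, pairTw_skip,
        LinearMap.lTensor_tmul, LinearEquiv.coe_coe, pairT₁_apply, leftComm_leftComm]
  rw [h1, pairT₂_tmul, h2, pairT₁_apply, key]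

/-- The regular multiplier Hopf algebra on a twisted tensor product, with `Δ(xy) = Δ(x)Δ(y)`. -/
def hopf (h : IsExchange G H τ) (hc : IsExchangeModule G H τ
    (tensorAct G (leftFst G Y) (leftFst G Y)) (tensorAct H (leftSnd H τ) (leftSnd H τ))) :
    RegularMultiplierHopfAlgebra K (X ⊗[K] Y) :=
  ofMaps h.algebra (pairT₁ G H τ) (pairT₂ G H τ) (pairT₃ G H τ) (pairT₄ G H τ)
    (fun a b c => by rw [h.rTensor_pairT₁, h.lTensor_pairT₃]) h.rTensor_mul_pairT₁
    h.lTensor_mul_pairT₁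
    (pairAct (tensorAct G (leftFst G Y) (leftFst G Y)) (tensorAct H (leftSnd H τ) (leftSnd H τ)))
    (fun a p q => (h.rTensor_pairT₁ a q p).symm) (fun a b z => hc.pairAct_mul h a b z)
    pair_coassoc

end IsExchange

end Hopf

/-! ### Modules over the Hopf structure on a twisted tensor product -/

section

variable {K X Y Z Z' W : Type*} [Field K] [AddCommGroup X] [Module K X] [AddCommGroup Y] [Module K Y]
  [AddCommGroup Z] [Module K Z] [AddCommGroup Z'] [Module K Z'] [AddCommGroup W] [Module K W]
  {G : RegularMultiplierHopfAlgebra K X} {H : RegularMultiplierHopfAlgebra K Y}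

/-- Naturality of the combined twist map, inherited from its two factors. -/
theorem pairTw_natural {t : X ⊗[K] Z →ₗ[K] X ⊗[K] Z} {u : Y ⊗[K] Z →ₗ[K] Y ⊗[K] Z}
    {t' : X ⊗[K] Z' →ₗ[K] X ⊗[K] Z'} {u' : Y ⊗[K] Z' →ₗ[K] Y ⊗[K] Z'} {f : Z →ₗ[K] Z'}
    (ht : f.lTensor X ∘ₗ t = t' ∘ₗ f.lTensor X) (hu : f.lTensor Y ∘ₗ u = u' ∘ₗ f.lTensor Y)
    (d : X ⊗[K] Y) (z : Z) :
    f.lTensor (X ⊗[K] Y) (pairTw t u (d ⊗ₜ z)) = pairTw t' u' (d ⊗ₜ f z) := by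
  induction d with
  | zero => simp
  | add a b ha hb => simp only [TensorProduct.add_tmul, map_add, ha, hb]
  | tmul x y =>
    have a1 := LinearMap.congr_fun hu (y ⊗ₜ z)
    simp only [LinearMap.comp_apply, LinearMap.lTensor_tmul] at a1
    rw [pairTw_tmul, pairTw_tmul, lTensor_assoc_symm, ← a1]
    generalize u (y ⊗ₜ z) = v
    congr 1
    induction v with
    | zero => simp
    | add a b ha hb => simp only [map_add, TensorProduct.tmul_add, ha, hb]
    | tmul y' z' =>
      have a2 := LinearMap.congr_fun ht (x ⊗ₜ z')
      simp only [LinearMap.comp_apply, LinearMap.lTensor_tmul] at a2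
      rw [LinearMap.lTensor_tmul, skip_tmul, skip_tmul, ← a2]
      generalize t (x ⊗ₜ z') = v
      induction v with
      | zero => simp
      | add a b ha hb => simp only [map_add, TensorProduct.tmul_add, ha, hb]
      | tmul p q => simp

theorem swapApply_comm (α : X →ₗ[K] Z →ₗ[K] Z') (z : Z) (u : X ⊗[K] X) :
    swapApply α z (TensorProduct.comm K X X u) = (α.flip z).lTensor X u := by
  induction u with
  | zero => simp
  | add x y hx hy => simp only [map_add, hx, hy]
  | tmul p q => simp

theorem tensorAct_act {α : X →ₗ[K] Z →ₗ[K] Z} {α' : X →ₗ[K] Z' →ₗ[K] Z'} (hα : IsUnitalModule G α)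
    (x y : X) (z : Z) (z' : Z') : tensorAct G α α' x (α y z ⊗ₜ z') =
      TensorProduct.map (α.flip z) (α'.flip z') (G.T₃ (x ⊗ₜ y)) := by
  rw [tensorAct, conv_apply, tw_rTensorHom hα.isTw, onFst_tmul, hα.tw_act]
  generalize G.T₃ (x ⊗ₜ y) = u
  induction u with
  | zero => simp
  | add x y hx hy => simp only [map_add, TensorProduct.add_tmul, hx, hy]
  | tmul p q => simp

theorem tensorAct_act_act {α : X →ₗ[K] Z →ₗ[K] Z} {α' : X →ₗ[K] Z' →ₗ[K] Z'}
    (hα : IsUnitalModule G α) (hα' : IsUnitalModule G α') (x y y' : X) (z : Z) (z' : Z') :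
    tensorAct G α α' x (α y z ⊗ₜ α' y' z') =
      TensorProduct.map (α.flip z) (α'.flip z') (multL (G.comul x) (y ⊗ₜ y')) := by
  rw [tensorAct_act hα, multL_comul_eq₃]
  generalize G.T₃ (x ⊗ₜ y) = u
  induction u with
  | zero => simp
  | add x y hx hy => simp only [map_add, hx, hy]
  | tmul p q => simp [hα'.mul_act]

variable {τ : X ⊗[K] Y ≃ₗ[K] X ⊗[K] Y}

/-- `Δ(d)` acting on a tensor product of two modules, from the covering `Δ(d)(e ⊗ 1)`. -/
theorem lTensor_pairAct_pairT₃ {α : X →ₗ[K] Z →ₗ[K] Z} {β : Y →ₗ[K] Z →ₗ[K] Z} (d e : X ⊗[K] Y)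
    (z : Z) : ((pairAct α β).flip z).lTensor (X ⊗[K] Y) (pairT₃ G H τ (d ⊗ₜ e)) =
      pairAct (tensorAct G (leftFst G Y) α) (tensorAct H (leftSnd H τ) β) d (e ⊗ₜ z) := by
  have l := isUnitalModule_leftFst (G := G) (Y := Y)
  have m := isUnitalModule_leftSnd (H := H) τ
  rw [tensorAct, tensorAct, ← lift_pairAct_pairTw (l.rTensor _)
    (fun _ _ _ => rTensorHom_lTensorHom_comm _ _ _ _ _), tw_rTensorHom l.isTw,
    tw_rTensorHom m.isTw, pairTw_onFst, pairT₃_apply]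
  generalize pairTw (K := K) (X := X) (Y := Y) (Z := X ⊗[K] Y) _ _ _ = u
  induction u with
  | zero => simp
  | add x y hx hy => simp only [map_add, TensorProduct.add_tmul, hx, hy]
  | tmul p q =>
    rw [TensorProduct.assoc_tmul, TensorProduct.lift.tmul, pairAct_lTensorHom]
    simp

namespace IsExchange

variable (h : IsExchange G H τ) (hc : IsExchangeModule G H τ
    (tensorAct G (leftFst G Y) (leftFst G Y)) (tensorAct H (leftSnd H τ) (leftSnd H τ)))

theorem hopf_T₃ : (h.hopf hc).T₃ = pairT₃ G H τ := rfl
theorem multL_hopf_comul (d : X ⊗[K] Y) : multL ((h.hopf hc).comul d) =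
    pairAct (tensorAct G (leftFst G Y) (leftFst G Y)) (tensorAct H (leftSnd H τ) (leftSnd H τ)) d :=
  rfl

end IsExchange

namespace IsExchangeModule

variable {h : IsExchange G H τ} {hc : IsExchangeModule G H τ
    (tensorAct G (leftFst G Y) (leftFst G Y)) (tensorAct H (leftSnd H τ) (leftSnd H τ))}
  {α : X →ₗ[K] Z →ₗ[K] Z} {β : Y →ₗ[K] Z →ₗ[K] Z}

theorem isUnitalModule (m : IsExchangeModule G H τ α β) :
    IsUnitalModule (h.hopf hc) (pairAct α β) where
  mul_act d e z := m.pairAct_mul h d e z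
  unital := m.unital

/-- The twist map of a module over the Hopf structure on the twisted tensor product is composed from
those of its restrictions to `X` and `Y`. -/
theorem tw_hopf (m : IsExchangeModule G H τ α β) :
    (h.hopf hc).tw (pairAct α β) = pairTw (G.tw α) (H.tw β) := by
  have m' : IsUnitalModule (h.hopf hc) (pairAct α β) := IsExchangeModule.isUnitalModule m
  refine tmul_ext_of_span m.unital fun d e z => ?_
  rw [m'.tw_act, h.hopf_T₃, pairT₃_apply, swapApply_comm]
  refine pairTw_natural ?_ ?_ d e
  · exact isUnitalModule_leftFst.isTw.natural m.fst.isTw fun x e => m.pairAct_leftFst x e z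
  · exact (isUnitalModule_leftSnd τ).isTw.natural m.snd.isTw fun y e => m.pairAct_leftSnd h y e z

end IsExchangeModule

end

/-! ### The regular coaction -/

section

variable {K D V : Type*} [Field K] [AddCommGroup D] [Module K D] [AddCommGroup V] [Module K V]

/-- The comultiplication, as a coaction of a multiplier Hopf algebra on its underlying space. -/
def regularCoaction (𝒟 : RegularMultiplierHopfAlgebra K D) : D →ₗ[K] completedModule 𝒟.mul D :=
  LinearMap.codRestrict _ ((TensorProduct.curry 𝒟.T₃.toLinearMap).prod
    (TensorProduct.curry 𝒟.T₂.toLinearMap).flip) fun v d d' => 𝒟.T₃_left₁ d v d'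

variable (𝒟 : RegularMultiplierHopfAlgebra K D)

@[simp] theorem rightCover_regularCoaction (v d : D) :
    rightCover (regularCoaction 𝒟) v d = 𝒟.T₃ (v ⊗ₜ d) := rfl

@[simp] theorem leftCover_regularCoaction (v d : D) :
    leftCover (regularCoaction 𝒟) v d = 𝒟.T₂ (d ⊗ₜ v) := rfl

theorem isComodule_regularCoaction : IsComodule 𝒟 (regularCoaction 𝒟) where
  injective v w h := by
    rcases subsingleton_or_nontrivial D with hD | hD
    · exact Subsingleton.elim _ _
    obtain ⟨u, hu⟩ := 𝒟.exists_counit_eq_one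
    have h1 : 𝒟.T₃ (v ⊗ₜ u) = 𝒟.T₃ (w ⊗ₜ u) := by
      rw [← rightCover_regularCoaction, ← rightCover_regularCoaction, rightCover,
        LinearMap.comp_apply, LinearMap.comp_apply, h]
      rfl
    have h2 := congrArg (𝒟.counitL D) h1
    simpa [counitL_T₃, hu] using h2
  coassoc v d d' := by
    apply eq_of_forall_lTensor (fun c => (𝒟.mul.flip c).lTensor D)
      (fun x hx => 𝒟.lTensor_cancel_right fun c => by rw [hx c, map_zero])
    intro c
    have h1 : ∀ u : D ⊗[K] D, ((𝒟.mul.flip c).lTensor D).lTensor D (TensorProduct.assoc K D D D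
        ((𝒟.T₁.toLinearMap ∘ₗ (TensorProduct.mk K D D).flip d').rTensor D u)) =
        TensorProduct.assoc K D D D ((𝒟.T₁.toLinearMap ∘ₗ (TensorProduct.mk K D D).flip d').rTensor D
          ((𝒟.mul.flip c).lTensor D u)) := by
      intro u
      induction u with
      | zero => simp
      | add x y hx hy => simp only [map_add, hx, hy]
      | tmul p q =>
        simp only [LinearMap.rTensor_tmul, LinearMap.lTensor_tmul]
        generalize (𝒟.T₁.toLinearMap ∘ₗ (TensorProduct.mk K D D).flip d') p = w
        induction w with
        | zero => simp
        | add x y hx hy => simp only [map_add, TensorProduct.add_tmul, hx, hy]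
        | tmul p q => simp
    have h2 : ∀ u : D ⊗[K] D, TensorProduct.assoc K D D D
        ((𝒟.T₁.toLinearMap ∘ₗ (TensorProduct.mk K D D).flip d').rTensor D
          ((𝒟.mul.flip d).rTensor D u)) = TensorProduct.assoc K D D D
        ((𝒟.comulHom.flip (𝒟.T₁ (d ⊗ₜ d'))).rTensor D u) := by
      intro u
      congr 1
      rw [← LinearMap.rTensor_comp_apply]
      congr 2
      refine LinearMap.ext fun x => ?_
      simp [T₁_mul_left]
    rw [h1, rightCover_regularCoaction, T₃_right₂, h2]
    generalize 𝒟.T₁ (d ⊗ₜ d') = w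
    induction w with
    | zero => simp
    | add x y hx hy => simp only [map_add, LinearMap.rTensor_add, LinearMap.add_apply, hx, hy]
    | tmul p q =>
      have h3 : ((𝒟.mul.flip c).lTensor D).lTensor D (TensorProduct.lift
          ((LinearMap.lTensorHom D ∘ₗ (rightCover (regularCoaction 𝒟)).flip).flip ∘ₗ
            rightCover (regularCoaction 𝒟) v) (p ⊗ₜ q)) =
          ((𝒟.mul.flip q).rTensor D).lTensor D ((𝒟.right₁ c).lTensor D (𝒟.T₃ (v ⊗ₜ p))) := by
        simp only [TensorProduct.lift.tmul, LinearMap.comp_apply, LinearMap.flip_apply,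
          rightCover_regularCoaction, LinearMap.coe_lTensorHom]
        rw [← LinearMap.lTensor_comp_apply, ← LinearMap.lTensor_comp_apply]
        congr 2
        refine LinearMap.ext fun x => ?_
        simp [T₃_right₂]
      rw [h3, ← coassoc_right₃_right₁]
      generalize 𝒟.T₁ (v ⊗ₜ c) = u
      induction u with
      | zero => simp
      | add x y hx hy => simp only [map_add, hx, hy]
      | tmul x y =>
        simp only [LinearMap.rTensor_tmul, LinearMap.flip_apply, comulHom_apply, multL_comul_eq₃,
          right₃_apply]
        generalize 𝒟.T₃ (x ⊗ₜ p) = s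
        induction s with
        | zero => simp
        | add x y hx hy => simp only [map_add, TensorProduct.add_tmul, hx, hy]
        | tmul x y => simp
  counit v d := 𝒟.counitL_T₃ v d

variable {𝒟}

theorem completedModule_compat (Γ : V →ₗ[K] completedModule 𝒟.mul V) (v : V) (d d' : D) :
    (𝒟.mul d).rTensor V (rightCover Γ v d') = (𝒟.mul.flip d').rTensor V (leftCover Γ v d) :=
  (Γ v).2 d d'

/-- Multiplicativity of a coaction needs to be checked on one side only. -/
theorem leftCover_mul_of_rightCover_mul {ℋ : NondegenerateAlgebra K V}
    {Γ : V →ₗ[K] completedModule 𝒟.mul V}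
    (h : ∀ x y d, rightCover Γ (ℋ.mul x y) d =
      TensorProduct.lift ((LinearMap.lTensorHom D ∘ₗ ℋ.mul.flip).flip ∘ₗ rightCover Γ x)
        (rightCover Γ y d)) (x y : V) (d : D) : leftCover Γ (ℋ.mul x y) d =
    TensorProduct.lift ((LinearMap.lTensorHom D ∘ₗ ℋ.mul).flip ∘ₗ leftCover Γ y)
      (leftCover Γ x d) := by
  apply 𝒟.rTensor_cancel_right
  intro e
  rw [← completedModule_compat, h]
  have h1 : ∀ u : D ⊗[K] V, (𝒟.mul d).rTensor V (TensorProduct.lift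
      ((LinearMap.lTensorHom D ∘ₗ ℋ.mul.flip).flip ∘ₗ rightCover Γ x) u) =
      TensorProduct.map₂ 𝒟.mul ℋ.mul (leftCover Γ x d) u := by
    intro u
    induction u with
    | zero => simp
    | add x y hx hy => simp only [map_add, hx, hy]
    | tmul p w =>
      simp only [TensorProduct.lift.tmul, LinearMap.comp_apply, LinearMap.flip_apply,
        LinearMap.coe_lTensorHom]
      rw [← lTensor_rTensor_comm, completedModule_compat]
      generalize leftCover Γ x d = s
      induction s with
      | zero => simp
      | add x y hx hy => simp only [map_add, LinearMap.add_apply, hx, hy]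
      | tmul x y => simp
  rw [h1]
  generalize leftCover Γ x d = u
  induction u with
  | zero => simp
  | add x y hx hy => simp only [map_add, LinearMap.add_apply, hx, hy]
  | tmul p w =>
    simp only [TensorProduct.lift.tmul, LinearMap.comp_apply, LinearMap.flip_apply,
      LinearMap.coe_lTensorHom]
    rw [← lTensor_rTensor_comm, ← completedModule_compat]
    generalize rightCover Γ y e = s
    induction s with
    | zero => simp
    | add x y hx hy => simp only [map_add, hx, hy]
    | tmul x y => simp

end

namespace Pairing

variable {K A B Z Z' : Type*} [Field K] [AddCommGroup A] [Module K A] [AddCommGroup B] [Module K B]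
  [AddCommGroup Z] [Module K Z] [AddCommGroup Z'] [Module K Z']
  {𝒜 : RegularMultiplierHopfAlgebra K A} {ℬ : RegularMultiplierHopfAlgebra K B}
  (P : Pairing 𝒜 ℬ)

/-! ### The Drinfel'd double -/

variable {α : A →ₗ[K] Z →ₗ[K] Z} {β : B →ₗ[K] Z →ₗ[K] Z} {α' : A →ₗ[K] Z' →ₗ[K] Z'}
  {β' : B →ₗ[K] Z' →ₗ[K] Z'}

theorem exchangeModule_tensor (m : IsExchangeModule 𝒜.cop ℬ P.exch α β)
    (m' : IsExchangeModule 𝒜.cop ℬ P.exch α' β') :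
    IsExchangeModule 𝒜.cop ℬ P.exch (tensorAct 𝒜.cop α α') (tensorAct ℬ β β') :=
  P.conv_exch (m.rTensor Z') (m'.lTensor Z) (fun _ _ _ => rTensorHom_lTensorHom_comm _ _ _ _ _)
    (fun _ _ _ => rTensorHom_lTensorHom_comm _ _ _ _ _)
    (fun _ _ _ => rTensorHom_lTensorHom_comm _ _ _ _ _)
    (fun _ _ _ => rTensorHom_lTensorHom_comm _ _ _ _ _)

theorem exchangeModule_tensor_lam (m : IsExchangeModule 𝒜.cop ℬ P.exch α β)
    (m' : IsExchangeModule 𝒜.cop ℬ P.lam α' β') :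
    IsExchangeModule 𝒜.cop ℬ P.lam (tensorAct 𝒜.cop α α') (tensorAct ℬ β β') :=
  P.conv_lam (m.rTensor Z') (m'.lTensor Z) (fun _ _ _ => rTensorHom_lTensorHom_comm _ _ _ _ _)
    (fun _ _ _ => rTensorHom_lTensorHom_comm _ _ _ _ _)
    (fun _ _ _ => rTensorHom_lTensorHom_comm _ _ _ _ _)
    (fun _ _ _ => rTensorHom_lTensorHom_comm _ _ _ _ _)

/-- The Drinfel'd double. -/
def double : RegularMultiplierHopfAlgebra K (A ⊗[K] B) :=
  P.isExchange_exch.hopf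
    (P.exchangeModule_tensor P.isExchange_exch.isExchangeModule P.isExchange_exch.isExchangeModule)

theorem double_mul : P.double.mul = P.isExchange_exch.algebra.mul := rfl
theorem double_T₂ : P.double.T₂ = pairT₂ 𝒜.cop ℬ P.exch := rfl
theorem double_T₃ : P.double.T₃ = pairT₃ 𝒜.cop ℬ P.exch := rfl

theorem double_mul_eq : P.double.mul = P.drinfeldMul := by
  rw [drinfeldMul, doubleTwist_eq]; rfl

theorem doubleTwist_mul (b p : B) (a : A) : P.doubleTwist (ℬ.mul b p ⊗ₜ a) =
    leftSnd ℬ P.exch b (P.doubleTwist (p ⊗ₜ a)) := by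
  simp [doubleTwist_eq, leftSnd_apply]

theorem isDrinfeldDouble : P.IsDrinfeldDouble P.double where
  mul_eq := P.double_mul_eq
  comul_eq a b z := by
    have h1 : ∀ w, tensorAct 𝒜.cop (leftFst 𝒜.cop B) (leftFst 𝒜.cop B) a w = onFirstLegs
        ((TensorProduct.comm K A A).toLinearMap ∘ₗ multL (𝒜.comul a) ∘ₗ
          (TensorProduct.comm K A A).toLinearMap) w := by
      refine comm_of_forall_tmul fun d d' => ?_
      induction d with
      | zero => simp
      | add a b ha hb => simp only [map_add, TensorProduct.add_tmul, ha, hb]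
      | tmul p r =>
        induction d' with
        | zero => simp
        | add a b ha hb => simp only [map_add, TensorProduct.tmul_add, ha, hb]
        | tmul q s =>
          obtain ⟨p', hp⟩ := 𝒜.exists_mul_eq_self p
          obtain ⟨q', hq⟩ := 𝒜.exists_mul_eq_self q
          have h2 : (p ⊗ₜ[K] r : A ⊗[K] B) = leftFst 𝒜.cop B p (p' ⊗ₜ r) := by simp [hp]
          have h3 : (q ⊗ₜ[K] s : A ⊗[K] B) = leftFst 𝒜.cop B q (q' ⊗ₜ s) := by simp [hq]
          have h4 : TensorProduct.comm K A A (multL (𝒜.comul a) (q ⊗ₜ p)) =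
              tensorMul 𝒜.cop.mul (multL (𝒜.cop.comul a) (p ⊗ₜ q)) (p' ⊗ₜ q') := by
            refine Eq.trans ?_ (NondegenerateAlgebra.multL_tensorMul (H := 𝒜.cop.toNondegenerateAlgebra)
              (𝒜.cop.comul a) (p ⊗ₜ q) (p' ⊗ₜ q'))
            rw [multL_cop_comul]
            simp [tensorMul, hp, hq]
          conv_lhs => rw [h2, h3]
          rw [tensorAct_act_act isUnitalModule_leftFst isUnitalModule_leftFst, onFirstLegs]
          simp only [LinearMap.comp_apply, LinearEquiv.coe_coe,
            TensorProduct.tensorTensorTensorComm_tmul, LinearMap.rTensor_tmul,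
            TensorProduct.comm_tmul, h4]
          generalize multL (𝒜.cop.comul a) (p ⊗ₜ q) = u
          induction u with
          | zero => simp
          | add a b ha hb => simp only [map_add, LinearMap.add_apply, TensorProduct.add_tmul, ha, hb]
          | tmul x y => simp [tensorMul]
    have h5 : ∀ z, tensorAct ℬ (leftSnd ℬ P.exch) (leftSnd ℬ P.exch) b
        (TensorProduct.map P.doubleTwist P.doubleTwist z) =
        TensorProduct.map P.doubleTwist P.doubleTwist (onFirstLegs (multL (ℬ.comul b)) z) := by
      refine comm_of_forall_tmul (f := tensorAct ℬ (leftSnd ℬ P.exch) (leftSnd ℬ P.exch) b ∘ₗ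
        TensorProduct.map P.doubleTwist P.doubleTwist)
        (g := TensorProduct.map P.doubleTwist P.doubleTwist ∘ₗ onFirstLegs (multL (ℬ.comul b)))
        fun d d' => ?_
      induction d with
      | zero => simp
      | add a b ha hb => simp only [map_add, TensorProduct.add_tmul, ha, hb]
      | tmul p r =>
        induction d' with
        | zero => simp
        | add a b ha hb => simp only [map_add, TensorProduct.tmul_add, ha, hb]
        | tmul q s =>
          obtain ⟨p', hp⟩ := ℬ.exists_mul_eq_self p
          obtain ⟨q', hq⟩ := ℬ.exists_mul_eq_self q
          have h2 : P.doubleTwist (p ⊗ₜ[K] r) =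
              leftSnd ℬ P.exch p (P.doubleTwist (p' ⊗ₜ r)) := by rw [← doubleTwist_mul, hp]
          have h3 : P.doubleTwist (q ⊗ₜ[K] s) =
              leftSnd ℬ P.exch q (P.doubleTwist (q' ⊗ₜ s)) := by rw [← doubleTwist_mul, hq]
          have h4 : multL (ℬ.comul b) (p ⊗ₜ q) =
              tensorMul ℬ.mul (multL (ℬ.comul b) (p ⊗ₜ q)) (p' ⊗ₜ q') := by
            rw [← NondegenerateAlgebra.multL_tensorMul]
            simp [tensorMul, hp, hq]
          rw [LinearMap.comp_apply, TensorProduct.map_tmul, h2, h3,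
            tensorAct_act_act (isUnitalModule_leftSnd _) (isUnitalModule_leftSnd _), onFirstLegs]
          simp only [LinearMap.comp_apply, LinearEquiv.coe_coe,
            TensorProduct.tensorTensorTensorComm_tmul, LinearMap.rTensor_tmul]
          conv_rhs => rw [h4]
          generalize multL (ℬ.comul b) (p ⊗ₜ q) = u
          induction u with
          | zero => simp
          | add a b ha hb => simp only [map_add, LinearMap.add_apply, TensorProduct.add_tmul, ha, hb]
          | tmul x y => simp [tensorMul, doubleTwist_mul]
    rw [double, IsExchange.multL_hopf_comul, pairAct_tmul, h1, h5]

/-! ### The Heisenberg double and its coaction -/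

/-- The Heisenberg double. -/
def heisenberg : NondegenerateAlgebra K (A ⊗[K] B) := P.isExchange_lam.algebra

theorem heisenberg_mul : P.heisenberg.mul = P.heisenbergMul := by
  rw [heisenbergMul, smashTwist_eq]; rfl

/-- The diagonal left multiplications on `𝒟 ⊗ ℋ` satisfy the exchange rule of `ℋ`; this is the
multiplicativity of `Γ`. -/
theorem exchangeModule_op : IsExchangeModule 𝒜.cop ℬ P.lam
    (tensorAct 𝒜.cop (leftFst 𝒜.cop B) (leftFst 𝒜.cop B))
    (tensorAct ℬ (leftSnd ℬ P.exch) (leftSnd ℬ P.lam)) :=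
  P.exchangeModule_tensor_lam P.isExchange_exch.isExchangeModule P.isExchange_lam.isExchangeModule

/-- Left multiplication by `Γ(v)` on `𝒟 ⊗ ℋ`. -/
def op : A ⊗[K] B →ₗ[K] (A ⊗[K] B) ⊗[K] (A ⊗[K] B) →ₗ[K] (A ⊗[K] B) ⊗[K] (A ⊗[K] B) :=
  pairAct (tensorAct 𝒜.cop (leftFst 𝒜.cop B) (leftFst 𝒜.cop B))
    (tensorAct ℬ (leftSnd ℬ P.exch) (leftSnd ℬ P.lam))

/-- `(Γ(v)(d ⊗ 1))(1 ⊗ h)` is `op v (d ⊗ h)`. -/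
theorem lTensor_T₃ (v d h : A ⊗[K] B) :
    (P.heisenberg.mul.flip h).lTensor (A ⊗[K] B) (P.double.T₃ (v ⊗ₜ d)) = P.op v (d ⊗ₜ h) := by
  rw [op, ← lTensor_pairAct_pairT₃, double_T₃]
  congr 2
  exact LinearMap.ext fun e => (P.isExchange_lam.pairAct_eq_mul e h).symm

theorem op_mul (v w : A ⊗[K] B) (z) : P.op (P.heisenberg.mul v w) z = P.op v (P.op w z) :=
  P.exchangeModule_op.pairAct_mul P.isExchange_lam v w z

theorem isComoduleAlgebra : IsComoduleAlgebra P.double P.heisenberg (regularCoaction P.double) := by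
  have h : ∀ x y d, rightCover (regularCoaction P.double) (P.heisenberg.mul x y) d =
      TensorProduct.lift ((LinearMap.lTensorHom (A ⊗[K] B) ∘ₗ P.heisenberg.mul.flip).flip ∘ₗ
        rightCover (regularCoaction P.double) x) (rightCover (regularCoaction P.double) y d) := by
    intro x y d
    apply P.heisenberg.lTensor_cancel_right
    intro h
    rw [rightCover_regularCoaction, lTensor_T₃, op_mul, ← lTensor_T₃, rightCover_regularCoaction]
    generalize P.double.T₃ (y ⊗ₜ d) = u
    induction u with
    | zero => simp
    | add a b ha hb => simp only [map_add, ha, hb]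
    | tmul p w =>
      simp only [LinearMap.lTensor_tmul, TensorProduct.lift.tmul, LinearMap.comp_apply,
        LinearMap.flip_apply, LinearMap.coe_lTensorHom, rightCover_regularCoaction]
      rw [← lTensor_T₃, ← LinearMap.lTensor_comp_apply]
      congr 2
      exact LinearMap.ext fun e => by simp [P.heisenberg.mul_assoc]
  exact { isComodule_regularCoaction P.double with
    rightCover_mul := h
    leftCover_mul := leftCover_mul_of_rightCover_mul h }

/-- The comultiplication of the double, regarded as a map on the common space `A ⊗ B`, is given by the
formula for `Γ`: both covered elements are computed from `(x ⊗ 1)Δ(a)` and `Δ(b)(1 ⊗ y)`. -/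
theorem isHeisenbergCoaction :
    IsHeisenbergCoaction 𝒜 ℬ P.double (regularCoaction P.double) := by
  intro a b d x y
  rw [leftCover_regularCoaction, double_T₂, pairT₂_tmul, pairTwRight_tmul]
  have r := (isRightModule_rightFst (G := 𝒜.cop) P.exch).isTw.cover_left a d x
  have s := fun z => (isRightModule_rightSnd (H := ℬ) (X := A)).isTw.cover b z y
  rw [cop_T₄, cop_mul] at r
  have h1 : ∀ w : A ⊗[K] (A ⊗[K] B),
      (TensorProduct.map (𝒜.mul x) (ℬ.mul.flip y)).lTensor (A ⊗[K] B) (TensorProduct.comm K _ _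
        ((TensorProduct.assoc K A B _).symm ((ℬ.tw (rightSnd ℬ A)).lTensor A
          (TensorProduct.leftComm K B A _ (b ⊗ₜ w))))) =
      TensorProduct.comm K _ _ ((TensorProduct.assoc K A B _).symm
        ((swapApply (rightSnd ℬ A) : _ →ₗ[K] _ →ₗ[K] _).flip (ℬ.T₁ (b ⊗ₜ y)) |>.lTensor A
          ((𝒜.mul x).rTensor _ w))) := by
    intro w
    induction w with
    | zero => simp
    | add a b ha hb => simp only [map_add, TensorProduct.tmul_add, ha, hb]
    | tmul p z =>
      simp only [TensorProduct.leftComm_tmul, LinearMap.lTensor_tmul, LinearMap.rTensor_tmul,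
        LinearMap.flip_apply, ← s]
      generalize ℬ.tw (rightSnd ℬ A) (b ⊗ₜ z) = u
      induction u with
      | zero => simp
      | add a b ha hb => simp only [map_add, TensorProduct.tmul_add, ha, hb]
      | tmul q e => simp
  rw [h1, r]
  generalize 𝒜.T₂ (x ⊗ₜ a) = u
  generalize ℬ.T₁ (b ⊗ₜ y) = v
  induction u with
  | zero => simp
  | add a b ha hb => simp only [map_add, TensorProduct.add_tmul, ha, hb]
  | tmul p q =>
    induction v with
    | zero => simp
    | add a b ha hb => simp only [map_add, TensorProduct.tmul_add, LinearMap.add_apply, LinearMap.lTensor_add, ha, hb]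
    | tmul r s => simp [double_mul, P.isExchange_exch.algebra_mul_tmul_right]

end Pairing

/-! ### Inner actions -/

section

variable {K X D E Z Z' : Type*} [Field K] [AddCommGroup X] [Module K X] [AddCommGroup D] [Module K D]
  [AddCommGroup E] [Module K E] [AddCommGroup Z] [Module K Z] [AddCommGroup Z'] [Module K Z']
  {G : RegularMultiplierHopfAlgebra K X} {l r : X →ₗ[K] E →ₗ[K] E}

/-- The inner action `x ⊗ e ↦ x₍₁₎ e S(x₍₂₎)` on a bimodule, with left action `l` and right
action `r`. -/
def inner (G : RegularMultiplierHopfAlgebra K X) (l r : X →ₗ[K] E →ₗ[K] E) : X →ₗ[K] E →ₗ[K] E :=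
  G.conv l (r ∘ₗ G.antipode.toLinearMap)

theorem isUnitalModule_inner (hl : IsUnitalModule G l) (hr : IsRightModule G r)
    (h : ∀ x y e, l x (r y e) = r y (l x e)) : IsUnitalModule G (inner G l r) :=
  hl.conv hr.antipode fun x _ e => h x _ e

theorem isTw_inner (hl : IsUnitalModule G l) (hr : IsRightModule G r) :
    G.IsTw (inner G l r) (G.tw (r ∘ₗ G.antipode.toLinearMap) ∘ₗ G.tw l) :=
  hl.isTw.conv hr.antipode.isTw

theorem tw_inner (hl : IsUnitalModule G l) (hr : IsRightModule G r) :
    G.tw (inner G l r) = G.tw (r ∘ₗ G.antipode.toLinearMap) ∘ₗ G.tw l :=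
  (isTw_inner hl hr).tw_eq

theorem isTw_tensorAct {α : X →ₗ[K] Z →ₗ[K] Z} {α' : X →ₗ[K] Z' →ₗ[K] Z'}
    (hα : G.IsTw α (G.tw α)) (hα' : G.IsTw α' (G.tw α')) :
    G.IsTw (tensorAct G α α') (skip Z (G.tw α') ∘ₗ onFst Z' (G.tw α)) := by
  have h := IsTw.conv (H := G) (hα.rTensor Z').isTw_tw (hα'.lTensor Z).isTw_tw
  rwa [tw_rTensorHom hα, tw_lTensorHom hα'] at h

theorem skip_comp_apply {W : Type*} [AddCommGroup W] [Module K W] (t u : X ⊗[K] Z →ₗ[K] X ⊗[K] Z)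
    (w : X ⊗[K] (W ⊗[K] Z)) : skip W (t ∘ₗ u) w = skip W t (skip W u w) := by
  rw [skip_comp]; rfl

/-- The inner action is an action by derivations in the sense of module algebras. -/
theorem mul_tensorAct_inner (hl : IsUnitalModule G l) (hr : IsRightModule G r)
    {f : E ⊗[K] E →ₗ[K] E} (h1 : ∀ x e e', f (l x e ⊗ₜ e') = l x (f (e ⊗ₜ e')))
    (h2 : ∀ x e e', f (e ⊗ₜ r x e') = r x (f (e ⊗ₜ e')))
    (h3 : ∀ x e e', f (r x e ⊗ₜ e') = f (e ⊗ₜ l x e')) (x : X) (w : E ⊗[K] E) :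
    f (tensorAct G (inner G l r) (inner G l r) x w) = inner G l r x (f w) := by
  have i := isTw_inner hl hr
  have a1 := fun w => LinearMap.congr_fun ((hr.antipode.isTw.skip E).natural hr.antipode.isTw
    (f := f) (f' := f) fun x => comm_of_forall_tmul (f := f ∘ₗ (LinearMap.lTensorHom E ∘ₗ
        (r ∘ₗ G.antipode.toLinearMap)) x) (g := (r ∘ₗ G.antipode.toLinearMap) x ∘ₗ f)
      fun e e' => by simp [h2]) w
  have a2 := fun w => LinearMap.congr_fun ((hl.isTw.skip E).balanced (hr.isTw.rTensor E)
    (f := f) (f' := f) fun x => comm_of_forall_tmul (f := f ∘ₗ (LinearMap.lTensorHom E ∘ₗ l) x)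
      (g := f ∘ₗ (LinearMap.rTensorHom E ∘ₗ r) x) fun e e' => by simp [h3]) w
  have a3 : ∀ w : X ⊗[K] (E ⊗[K] E), onFst E (G.tw r)
      (onFst E (G.tw (r ∘ₗ G.antipode.toLinearMap)) w) = w := fun w => by
    rw [← onFst_comp_apply, hr.tw_comp_antipode, onFst_id]; rfl
  have a4 := fun w => LinearMap.congr_fun ((hl.isTw.rTensor E).natural hl.isTw
    (f := f) (f' := f) fun x => comm_of_forall_tmul (f := f ∘ₗ (LinearMap.rTensorHom E ∘ₗ l) x)
      (g := l x ∘ₗ f) fun e e' => by simp [h1]) w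
  change ∀ w, f.lTensor X (skip E (G.tw l) w) = f.lTensor X (onFst E (G.tw r) w) at a2
  change ∀ w, f.lTensor X (onFst E (G.tw l) w) = G.tw l (f.lTensor X w) at a4
  simp only [LinearMap.comp_apply] at a1
  have key : f.lTensor X ((skip E (G.tw (inner G l r)) ∘ₗ onFst E (G.tw (inner G l r)))
      (x ⊗ₜ w)) = G.tw (inner G l r) (f.lTensor X (x ⊗ₜ w)) := by
    rw [tw_inner hl hr, LinearMap.comp_apply, onFst_comp_apply, skip_comp_apply, a1, a2, a3, a4]
    rfl
  have h := congrArg (G.counitL E) key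
  rw [counitL_lTensor, (isTw_tensorAct i.isTw_tw i.isTw_tw).counit, LinearMap.lTensor_tmul,
    i.isTw_tw.counit] at h
  exact h

/-- The compatibility of the inner action with a coaction-like map `F`, from the behaviour of `F`
under left and right multiplication. -/
theorem tensorAct_inner_comm (hl : IsUnitalModule G l) (hr : IsRightModule G r)
    {lD : X →ₗ[K] D →ₗ[K] D} (hD : IsUnitalModule G lD) {F : E ⊗[K] D →ₗ[K] D ⊗[K] E}
    (h1 : ∀ x w, F ((LinearMap.rTensorHom D ∘ₗ l) x w) = tensorAct G lD l x (F w))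
    (h2 : ∀ x w, F ((LinearMap.rTensorHom D ∘ₗ r) x w) =
      TensorProduct.lift (LinearMap.lTensorHom D ∘ₗ r) (F.lTensor X (skip E (G.tw lD) (x ⊗ₜ w))))
    (x : X) (w : E ⊗[K] D) :
    F (tensorAct G (inner G l r) lD x w) = tensorAct G lD (inner G l r) x (F w) := by
  have i := isTw_inner hl hr
  have a1 := fun w => LinearMap.congr_fun ((hl.isTw.rTensor D).natural
    (isTw_tensorAct hD.isTw hl.isTw) (f := F) (f' := F) h1) w
  have a2 : F.lTensor X ∘ₗ onFst D (G.tw r) =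
      skip D (G.tw r) ∘ₗ F.lTensor X ∘ₗ skip E (G.tw lD) := by
    refine ((Colin.lTensor F).comp (hr.isTw.rTensor D).colin).ext
      ((hr.isTw.skip D).colin.comp ((Colin.lTensor F).comp (hD.isTw.skip E).colin)) fun x w => ?_
    have b1 := (hr.isTw.rTensor D).counit x w
    simp only [LinearMap.comp_apply, counitL_lTensor, (hr.isTw.skip D).counit_apply] at b1 ⊢
    rw [← h2]
    exact congrArg F b1
  have a2' := fun w => LinearMap.congr_fun a2 w
  have a3 : ∀ w : X ⊗[K] (E ⊗[K] D), onFst D (G.tw r)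
      (onFst D (G.tw (r ∘ₗ G.antipode.toLinearMap)) w) = w := fun w => by
    rw [← onFst_comp_apply, hr.tw_comp_antipode, onFst_id]; rfl
  have a4 : ∀ w : X ⊗[K] (D ⊗[K] E), skip D (G.tw (r ∘ₗ G.antipode.toLinearMap))
      (skip D (G.tw r) w) = w := fun w => by
    rw [← skip_comp_apply, hr.tw_antipode_comp]
    simp [skip]
  change ∀ w, F.lTensor X (onFst D (G.tw l) w) =
    skip D (G.tw l) (onFst E (G.tw lD) (F.lTensor X w)) at a1
  simp only [LinearMap.comp_apply] at a2'
  have key : F.lTensor X ((skip E (G.tw lD) ∘ₗ onFst D (G.tw (inner G l r))) (x ⊗ₜ w)) =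
      (skip D (G.tw (inner G l r)) ∘ₗ onFst E (G.tw lD)) (F.lTensor X (x ⊗ₜ w)) := by
    rw [tw_inner hl hr, LinearMap.comp_apply, LinearMap.comp_apply, onFst_comp_apply,
      skip_comp_apply, ← a1, ← a4 (F.lTensor X _), ← a2', a3]
  have h := congrArg (G.counitL (D ⊗[K] E)) key
  rw [counitL_lTensor, (isTw_tensorAct i.isTw_tw hD.isTw).counit, LinearMap.lTensor_tmul,
    (isTw_tensorAct hD.isTw i.isTw_tw).counit] at h
  exact h

theorem lTensor_tensorAct {α : X →ₗ[K] Z →ₗ[K] Z} (hα : IsUnitalModule G α)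
    {α' : X →ₗ[K] Z' →ₗ[K] Z'} {f : Z' →ₗ[K] Z'} (hf : ∀ x z, f (α' x z) = α' x (f z)) (x : X)
    (w : Z ⊗[K] Z') : f.lTensor Z (tensorAct G α α' x w) = tensorAct G α α' x (f.lTensor Z w) := by
  obtain ⟨w, rfl⟩ := LinearMap.rTensor_surjective Z' (lift_surjective hα.unital) w
  induction w with
  | zero => simp
  | add a b ha hb => simp only [map_add, ha, hb]
  | tmul u z' =>
    induction u with
    | zero => simp
    | add a b ha hb => simp only [map_add, TensorProduct.add_tmul, ha, hb]
    | tmul y z =>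
      simp only [LinearMap.rTensor_tmul, TensorProduct.lift.tmul, LinearMap.lTensor_tmul,
        tensorAct_act hα]
      generalize G.T₃ (x ⊗ₜ y) = u
      induction u with
      | zero => simp
      | add a b ha hb => simp only [map_add, ha, hb]
      | tmul p q => simp [hf]

variable {N : NondegenerateAlgebra K E} {lD : X →ₗ[K] D →ₗ[K] D} {F : E ⊗[K] D →ₗ[K] D ⊗[K] E}
  {op : E →ₗ[K] D ⊗[K] E →ₗ[K] D ⊗[K] E}

/-- `Γ(xv)(d ⊗ 1) = Δ(x)Γ(v)(d ⊗ 1)`, for `F (v ⊗ d) = Γ(v)(d ⊗ 1)`. -/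
theorem cover_left_mul (hD : IsUnitalModule G lD)
    (hF : ∀ v d h, (N.mul.flip h).lTensor D (F (v ⊗ₜ d)) = op v (d ⊗ₜ h))
    (hop : ∀ x v z, op (l x v) z = tensorAct G lD l x (op v z))
    (hN : ∀ x e h, N.mul (l x e) h = l x (N.mul e h)) (x : X) (w : E ⊗[K] D) :
    F ((LinearMap.rTensorHom D ∘ₗ l) x w) = tensorAct G lD l x (F w) := by
  refine comm_of_forall_tmul (f := F ∘ₗ (LinearMap.rTensorHom D ∘ₗ l) x)
    (g := tensorAct G lD l x ∘ₗ F) (fun v d => N.lTensor_cancel_right fun h => ?_) w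
  have h1 : (LinearMap.rTensorHom D ∘ₗ l) x (v ⊗ₜ d) = l x v ⊗ₜ d := by simp
  rw [LinearMap.comp_apply, h1, LinearMap.comp_apply, hF,
    lTensor_tensorAct hD (f := N.mul.flip h) (fun x e => hN x e h), hF, hop]

/-- `Γ(vx)(d ⊗ 1) = Γ(v)Δ(x)(d ⊗ 1)`, for `F (v ⊗ d) = Γ(v)(d ⊗ 1)`. -/
theorem cover_right_mul (hD : IsUnitalModule G lD)
    (hF : ∀ v d h, (N.mul.flip h).lTensor D (F (v ⊗ₜ d)) = op v (d ⊗ₜ h))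
    (hop : ∀ x v z, op (r x v) z = op v (tensorAct G lD l x z))
    (hN : ∀ x e h, N.mul (r x e) h = N.mul e (l x h)) (x : X) (w : E ⊗[K] D) :
    F ((LinearMap.rTensorHom D ∘ₗ r) x w) =
      TensorProduct.lift (LinearMap.lTensorHom D ∘ₗ r) (F.lTensor X (skip E (G.tw lD) (x ⊗ₜ w))) := by
  refine comm_of_forall_tmul (f := F ∘ₗ (LinearMap.rTensorHom D ∘ₗ r) x)
    (g := TensorProduct.lift (LinearMap.lTensorHom D ∘ₗ r) ∘ₗ F.lTensor X ∘ₗ skip E (G.tw lD) ∘ₗ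
      TensorProduct.mk K X (E ⊗[K] D) x) (fun v d => N.lTensor_cancel_right fun h => ?_) w
  have h1 : (LinearMap.rTensorHom D ∘ₗ r) x (v ⊗ₜ d) = r x v ⊗ₜ d := by simp
  have h2 : tensorAct G lD l x (d ⊗ₜ h) = TensorProduct.lift (LinearMap.lTensorHom D ∘ₗ l)
      (TensorProduct.assoc K X D E (G.tw lD (x ⊗ₜ d) ⊗ₜ h)) := by
    rw [tensorAct, conv_apply, tw_rTensorHom hD.isTw, onFst_tmul]
  rw [LinearMap.comp_apply, h1, hF, hop, h2]
  simp only [LinearMap.comp_apply, TensorProduct.mk_apply, skip_tmul]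
  generalize G.tw lD (x ⊗ₜ d) = u
  induction u with
  | zero => simp
  | add a b ha hb => simp only [map_add, TensorProduct.add_tmul, TensorProduct.tmul_add, ha, hb]
  | tmul y d =>
    simp only [TensorProduct.assoc_tmul, TensorProduct.leftComm_tmul, LinearMap.lTensor_tmul,
      TensorProduct.lift.tmul, LinearMap.comp_apply, LinearMap.coe_lTensorHom]
    rw [← hF, ← LinearMap.lTensor_comp_apply]
    congr 2
    exact LinearMap.ext fun e => by simp [hN]

theorem conv_assoc {α β γ : X →ₗ[K] Z →ₗ[K] Z} (hα : G.IsTw α (G.tw α)) (hβ : G.IsTw β (G.tw β)) :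
    G.conv (G.conv α β) γ = G.conv α (G.conv β γ) := by
  refine LinearMap.ext fun x => LinearMap.ext fun z => ?_
  rw [conv_apply, hα.tw_conv hβ, conv_apply]
  have h : TensorProduct.lift (G.conv β γ) = TensorProduct.lift γ ∘ₗ G.tw β :=
    TensorProduct.ext' fun x z => by simp [conv_apply]
  rw [h]
  rfl

theorem tw_mul (x y : X) : G.tw G.mul (x ⊗ₜ y) = TensorProduct.comm K X X (G.T₃ (x ⊗ₜ y)) := by
  obtain ⟨e, he⟩ := G.exists_mul_eq_self y
  conv_lhs => rw [← he]
  rw [isUnitalModule_mul.tw_act]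
  conv_rhs => rw [← he, T₃_mul_right, comm_rTensor]
  generalize G.T₃ (x ⊗ₜ y) = u
  induction u with
  | zero => simp
  | add a b ha hb => simp only [map_add, ha, hb]
  | tmul p q => simp

/-- The adjoint action `x₍₁₎ y S(x₍₂₎)` is the inner action on `X` itself. -/
theorem adj_eq : G.adj = inner G G.mul G.mul.flip := by
  refine LinearMap.ext fun x => LinearMap.ext fun y => ?_
  rw [inner, conv_apply, tw_mul, adj]
  simp only [TensorProduct.curry_apply, LinearMap.comp_apply, LinearEquiv.coe_coe]
  generalize G.T₃ (x ⊗ₜ y) = u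
  induction u with
  | zero => simp
  | add a b ha hb => simp only [map_add, ha, hb]
  | tmul p q => simp

theorem coadj_eq : G.coadj = G.cop.adj := by
  refine LinearMap.ext fun x => LinearMap.ext fun y => ?_
  rw [coadj, adj, cop_antipode]
  simp only [TensorProduct.curry_apply, LinearMap.comp_apply, LinearEquiv.coe_coe, cop_T₃, cop_mul]
  generalize G.T₁ (x ⊗ₜ y) = u
  induction u with
  | zero => simp
  | add a b ha hb => simp only [map_add, ha, hb]
  | tmul p q => simp

theorem conv_lTensorHom {α β : X →ₗ[K] Z →ₗ[K] Z} (hα : G.IsTw α (G.tw α)) (W : Type*)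
    [AddCommGroup W] [Module K W] :
    G.conv (LinearMap.lTensorHom W ∘ₗ α) (LinearMap.lTensorHom W ∘ₗ β) =
      LinearMap.lTensorHom W ∘ₗ G.conv α β := by
  refine LinearMap.ext fun x => TensorProduct.ext' fun w z => ?_
  rw [conv_apply, tw_lTensorHom hα, skip_tmul]
  simp only [LinearMap.comp_apply, LinearMap.coe_lTensorHom, LinearMap.lTensor_tmul, conv_apply]
  generalize G.tw α (x ⊗ₜ z) = u
  induction u with
  | zero => simp
  | add a b ha hb => simp only [map_add, TensorProduct.tmul_add, ha, hb]
  | tmul p q => simp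

theorem conv_rTensorHom {α β : X →ₗ[K] Z →ₗ[K] Z} (hα : G.IsTw α (G.tw α)) (W : Type*)
    [AddCommGroup W] [Module K W] :
    G.conv (LinearMap.rTensorHom W ∘ₗ α) (LinearMap.rTensorHom W ∘ₗ β) =
      LinearMap.rTensorHom W ∘ₗ G.conv α β := by
  refine LinearMap.ext fun x => TensorProduct.ext' fun z w => ?_
  rw [conv_apply, tw_rTensorHom hα, onFst_tmul]
  simp only [LinearMap.comp_apply, LinearMap.coe_rTensorHom, LinearMap.rTensor_tmul, conv_apply]
  generalize G.tw α (x ⊗ₜ z) = u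
  induction u with
  | zero => simp
  | add a b ha hb => simp only [map_add, TensorProduct.add_tmul, ha, hb]
  | tmul p q => simp

/-- The antipode reverses convolutions of right actions. -/
theorem conv_antipode {γ δ : X →ₗ[K] Z →ₗ[K] Z} (hγ : IsRightModule G γ) (hδ : IsRightModule G δ)
    (hc : IsRightModule G (G.conv γ δ)) : G.conv γ δ ∘ₗ G.antipode.toLinearMap =
      G.conv (δ ∘ₗ G.antipode.toLinearMap) (γ ∘ₗ G.antipode.toLinearMap) := by
  have h1 : G.tw (G.conv γ δ ∘ₗ G.antipode.toLinearMap) =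
      G.tw (γ ∘ₗ G.antipode.toLinearMap) ∘ₗ G.tw (δ ∘ₗ G.antipode.toLinearMap) := by
    refine LinearMap.ext fun w => ?_
    have b1 := LinearMap.congr_fun hc.tw_antipode_comp
      (G.tw (γ ∘ₗ G.antipode.toLinearMap) (G.tw (δ ∘ₗ G.antipode.toLinearMap) w))
    have b2 := LinearMap.congr_fun hγ.tw_comp_antipode (G.tw (δ ∘ₗ G.antipode.toLinearMap) w)
    have b3 := LinearMap.congr_fun hδ.tw_comp_antipode w
    simp only [LinearMap.comp_apply, LinearMap.id_apply] at b1 b2 b3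
    rw [hγ.isTw.tw_conv hδ.isTw] at b1
    simp only [LinearMap.comp_apply, b2, b3] at b1
    exact b1
  refine LinearMap.ext fun x => LinearMap.ext fun z => ?_
  rw [← hc.antipode.isTw.counit, h1, conv_apply, LinearMap.comp_apply, hγ.antipode.isTw.counit_apply]

end

section

variable {K X Y Z Z' : Type*} [Field K] [AddCommGroup X] [Module K X] [AddCommGroup Y] [Module K Y]
  [AddCommGroup Z] [Module K Z] [AddCommGroup Z'] [Module K Z']
  {G : RegularMultiplierHopfAlgebra K X} {H : RegularMultiplierHopfAlgebra K Y}

theorem skip_id : skip Y (LinearMap.id : X ⊗[K] Z →ₗ[K] X ⊗[K] Z) = LinearMap.id := by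
  refine LinearMap.ext fun w => ?_
  simp [skip]

/-- `x₍₁₎y ⊗ x₍₂₎z` in terms of `Δ(x)(y ⊗ 1)`; only the left leg needs a covering. -/
theorem tensorAct_mul_left {α : X →ₗ[K] Z →ₗ[K] Z} (x y : X) (z : Z) :
    tensorAct G G.mul α x (y ⊗ₜ z) = (α.flip z).lTensor X (G.T₃ (x ⊗ₜ y)) := by
  obtain ⟨e, he⟩ := G.exists_mul_eq_self y
  conv_lhs => rw [← he]
  rw [tensorAct_act isUnitalModule_mul]
  conv_rhs => rw [← he, T₃_mul_right]
  generalize G.T₃ (x ⊗ₜ y) = u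
  induction u with
  | zero => simp
  | add a b ha hb => simp only [map_add, ha, hb]
  | tmul p q => simp

/-- `x₍₁₎z ⊗ x₍₂₎y` in terms of `Δ(x)(1 ⊗ y)`; only the right leg needs a covering. -/
theorem tensorAct_mul_right {α : X →ₗ[K] Z →ₗ[K] Z} (hα : IsUnitalModule G α) (x y : X) (z : Z) :
    tensorAct G α G.mul x (z ⊗ₜ y) = (α.flip z).rTensor X (G.T₁ (x ⊗ₜ y)) := by
  obtain ⟨e, he⟩ := G.exists_mul_eq_self y
  have h : tensorAct G α G.mul x ∘ₗ (TensorProduct.mk K Z X).flip y =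
      (LinearMap.rTensorHom X ∘ₗ α.flip).flip (G.T₁ (x ⊗ₜ y)) := by
    refine hom_ext_of_span hα.unital fun q z => ?_
    have h1 := tensorAct_act_act hα (isUnitalModule_mul (G := G)) x q y z e
    rw [he, multL_comul_eq₁] at h1
    simp only [LinearMap.comp_apply, LinearMap.flip_apply, TensorProduct.mk_apply, h1,
      LinearMap.coe_rTensorHom]
    conv_rhs => rw [← he, T₁_mul_right]
    generalize G.T₁ (x ⊗ₜ y) = u
    induction u with
    | zero => simp
    | add a b ha hb => simp only [map_add, ha, hb]
    | tmul p q => simp [hα.mul_act]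
  exact LinearMap.congr_fun h z

variable {τ : X ⊗[K] Y ≃ₗ[K] X ⊗[K] Y} {h : IsExchange G H τ} {hc : IsExchangeModule G H τ
    (tensorAct G (leftFst G Y) (leftFst G Y)) (tensorAct H (leftSnd H τ) (leftSnd H τ))}
  {α : X →ₗ[K] Z →ₗ[K] Z} {β : Y →ₗ[K] Z →ₗ[K] Z} {α' : X →ₗ[K] Z' →ₗ[K] Z'}
  {β' : Y →ₗ[K] Z' →ₗ[K] Z'}

/-- The diagonal action of the twisted tensor product restricts to the diagonal actions of `X` and `Y`,
because `Δ(xy) = Δ(x)Δ(y)`. -/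
theorem tensorAct_hopf (m : IsExchangeModule G H τ α β) (d : X ⊗[K] Y) (w : Z ⊗[K] Z') :
    tensorAct (h.hopf hc) (pairAct α β) (pairAct α' β') d w =
      pairAct (tensorAct G α α') (tensorAct H β β') d w := by
  have m' : IsUnitalModule (h.hopf hc) (pairAct α β) := IsExchangeModule.isUnitalModule m
  have h1 : LinearMap.lTensorHom Z ∘ₗ pairAct α' β' =
      pairAct (LinearMap.lTensorHom Z ∘ₗ α') (LinearMap.lTensorHom Z ∘ₗ β') :=
    LinearMap.ext fun d => LinearMap.ext fun w => (pairAct_lTensorHom α' β' d w).symm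
  refine comm_of_forall_tmul (fun z z' => ?_) w
  rw [tensorAct, conv_apply, tw_rTensorHom m'.isTw, onFst_tmul, IsExchangeModule.tw_hopf m,
    ← pairTw_onFst, ← tw_rTensorHom m.fst.isTw, ← tw_rTensorHom m.snd.isTw, h1,
    lift_pairAct_pairTw (m.fst.rTensor Z') fun _ _ _ => rTensorHom_lTensorHom_comm _ _ _ _ _]
  rfl

end

namespace Pairing

variable {K A B : Type*} [Field K] [AddCommGroup A] [Module K A] [AddCommGroup B] [Module K B]
  {𝒜 : RegularMultiplierHopfAlgebra K A} {ℬ : RegularMultiplierHopfAlgebra K B}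
  (P : Pairing 𝒜 ℬ)

/-! ### The action on the Heisenberg double -/

/-- The inner action `a ⊗ v ↦ a₍₂₎ v S⁻¹(a₍₁₎)` of `A` on the Heisenberg double. -/
def actA : A →ₗ[K] A ⊗[K] B →ₗ[K] A ⊗[K] B :=
  inner 𝒜.cop (leftFst 𝒜.cop B) (rightFst 𝒜.cop P.lam)

/-- The inner action `b ⊗ v ↦ b₍₁₎ v S(b₍₂₎)` of `B` on the Heisenberg double. -/
def actB : B →ₗ[K] A ⊗[K] B →ₗ[K] A ⊗[K] B :=
  inner ℬ (leftSnd ℬ P.lam) (rightSnd ℬ A)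

/-- If `b a = a b t` for left multiplications and `r s = s r t` for right multiplications, with `p`
and `q` inverse to `r` and `s`, then the inner actions `q b` and `p a` satisfy the exchange rule of
the Drinfel'd double. -/
theorem comp_exchange {V : Type*} {a b p q r s t : V → V} (hba : ∀ w, b (a w) = a (b (t w)))
    (hrs : ∀ w, r (s w) = s (r (t w))) (hbp : ∀ w, b (p w) = p (b w)) (haq : ∀ w, q (a w) = a (q w))
    (hpr : ∀ w, p (r w) = w) (hrp : ∀ w, r (p w) = w) (hqs : ∀ w, q (s w) = w)
    (hsq : ∀ w, s (q w) = w) (w : V) : t (q (b (p (a w)))) = p (a (q (b (t w)))) := by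
  have h : ∀ w, t (q (p w)) = p (q w) := fun w => by
    have h1 := hrs (q (p w))
    rw [hsq, hrp] at h1
    conv_rhs => rw [h1, hqs, hpr]
  rw [hbp, hba, h, haq]

theorem rightFst_rightSnd_lam (a : A) (b : B) (e : A ⊗[K] B) :
    rightFst 𝒜.cop P.lam a (rightSnd ℬ A b e) = pairAct (rightSnd ℬ A) (rightFst 𝒜.cop P.lam)
      (TensorProduct.comm K A B (P.lam (a ⊗ₜ b))) e := by
  rw [P.isExchange_lam.pairAct_right_eq_mul]
  refine comm_of_forall_tmul (f := rightFst 𝒜.cop P.lam a ∘ₗ rightSnd ℬ A b)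
    (g := P.isExchange_lam.algebra.mul.flip (P.lam (a ⊗ₜ b))) (fun x y => ?_) e
  simp [P.isExchange_lam.algebra_mul_tmul, P.isExchange_lam.rightFst_tmul, leftSnd_apply]

theorem lTensor_leftSnd_skip_rightFst (w : A ⊗[K] (B ⊗[K] (A ⊗[K] B))) :
    (ℬ.tw (leftSnd ℬ P.lam)).lTensor A (skip B (𝒜.cop.tw (rightFst 𝒜.cop P.lam ∘ₗ
      𝒜.cop.antipode.toLinearMap)) w) = skip B (𝒜.cop.tw (rightFst 𝒜.cop P.lam ∘ₗ
      𝒜.cop.antipode.toLinearMap)) ((ℬ.tw (leftSnd ℬ P.lam)).lTensor A w) := by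
  have r : 𝒜.cop.IsTw (rightFst 𝒜.cop P.lam ∘ₗ 𝒜.cop.antipode.toLinearMap) _ :=
    (isRightModule_rightFst P.lam).antipode.isTw
  have h (x : A) (y : B) (z : A ⊗[K] B) :
      (rightFst 𝒜.cop P.lam ∘ₗ 𝒜.cop.antipode.toLinearMap) x (leftSnd ℬ P.lam y z) =
        leftSnd ℬ P.lam y ((rightFst 𝒜.cop P.lam ∘ₗ 𝒜.cop.antipode.toLinearMap) x z) := by
    rw [LinearMap.comp_apply]
    exact (leftSnd_rightFst P.lam _ y z).symm
  exact LinearMap.congr_fun (r.lTensor_comp_skip (isUnitalModule_leftSnd P.lam).isTw h) w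

theorem lTensor_rightSnd_skip_leftFst (w : A ⊗[K] (B ⊗[K] (A ⊗[K] B))) :
    (ℬ.tw (rightSnd ℬ A ∘ₗ ℬ.antipode.toLinearMap)).lTensor A
      (skip B (𝒜.cop.tw (leftFst 𝒜.cop B)) w) = skip B (𝒜.cop.tw (leftFst 𝒜.cop B))
      ((ℬ.tw (rightSnd ℬ A ∘ₗ ℬ.antipode.toLinearMap)).lTensor A w) := by
  have r : ℬ.IsTw (rightSnd ℬ A ∘ₗ ℬ.antipode.toLinearMap) _ :=
    isRightModule_rightSnd.antipode.isTw
  have l : 𝒜.cop.IsTw (leftFst 𝒜.cop B) _ := isUnitalModule_leftFst.isTw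
  have h (x : A) (y : B) (z : A ⊗[K] B) :
      leftFst 𝒜.cop B x ((rightSnd ℬ A ∘ₗ ℬ.antipode.toLinearMap) y z) =
        (rightSnd ℬ A ∘ₗ ℬ.antipode.toLinearMap) y (leftFst 𝒜.cop B x z) := by
    rw [LinearMap.comp_apply]
    exact leftFst_rightSnd x _ z
  exact LinearMap.congr_fun (l.lTensor_comp_skip r h) w

/-- The inner actions of `A` and `B` on the Heisenberg double make up a module over the Drinfel'd
double. -/
theorem exchangeModule_act : IsExchangeModule 𝒜.cop ℬ P.exch P.actA P.actB := by
  have e := P.isExchange_lam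
  have l := isUnitalModule_leftFst (G := 𝒜.cop) (Y := B)
  have r := isRightModule_rightFst (G := 𝒜.cop) P.lam
  have l' := isUnitalModule_leftSnd (H := ℬ) P.lam
  have r' := isRightModule_rightSnd (H := ℬ) (X := A)
  have i := isUnitalModule_inner l r e.leftFst_rightFst
  have i' := isUnitalModule_inner l' r' e.leftSnd_rightSnd
  refine ⟨i, i', (P.exch_exchange_iff i i').2 fun w => ?_⟩
  have hba := (P.lam_exchange_iff l.isTw l'.isTw).1 e.isExchangeModule.exchange
  have hPQ := P.lam_exchange_right r.isTw r'.isTw P.rightFst_rightSnd_lam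
  have pP : ∀ w, skip B (𝒜.cop.tw (rightFst 𝒜.cop P.lam ∘ₗ 𝒜.cop.antipode.toLinearMap))
      (skip B (𝒜.cop.tw (rightFst 𝒜.cop P.lam)) w) = w := fun w => by
    rw [← skip_comp_apply, r.tw_antipode_comp, skip_id]; rfl
  have Pp : ∀ w, skip B (𝒜.cop.tw (rightFst 𝒜.cop P.lam)) (skip B
      (𝒜.cop.tw (rightFst 𝒜.cop P.lam ∘ₗ 𝒜.cop.antipode.toLinearMap)) w) = w := fun w => by
    rw [← skip_comp_apply, r.tw_comp_antipode, skip_id]; rfl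
  have qQ : ∀ w : A ⊗[K] (B ⊗[K] (A ⊗[K] B)),
      (ℬ.tw (rightSnd ℬ A ∘ₗ ℬ.antipode.toLinearMap)).lTensor A
      ((ℬ.tw (rightSnd ℬ A)).lTensor A w) = w := fun w => by
    rw [← LinearMap.lTensor_comp_apply, r'.tw_antipode_comp, LinearMap.lTensor_id]; rfl
  have Qq : ∀ w : A ⊗[K] (B ⊗[K] (A ⊗[K] B)), (ℬ.tw (rightSnd ℬ A)).lTensor A
      ((ℬ.tw (rightSnd ℬ A ∘ₗ ℬ.antipode.toLinearMap)).lTensor A w) = w := fun w => by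
    rw [← LinearMap.lTensor_comp_apply, r'.tw_comp_antipode, LinearMap.lTensor_id]; rfl
  have key := comp_exchange hba hPQ P.lTensor_leftSnd_skip_rightFst lTensor_rightSnd_skip_leftFst
    pP Pp qQ Qq w
  rw [tw_inner l r, tw_inner l' r', skip_comp_apply, skip_comp_apply,
    LinearMap.lTensor_comp_apply, LinearMap.lTensor_comp_apply]
  exact key

/-- `b · (a' # b') = b₍₁₎ ▶ a' # b₍₂₎ b'`. -/
theorem leftSnd_lam : leftSnd ℬ P.lam = tensorAct ℬ P.lA ℬ.mul := by
  refine LinearMap.ext fun y => TensorProduct.ext' fun a b => ?_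
  rw [P.isExchange_lam.leftSnd_tmul, tensorAct, conv_apply, tw_rTensorHom P.isUnitalModule_lA.isTw,
    onFst_tmul, ← comm_lam]
  generalize P.lam (a ⊗ₜ y) = u
  induction u with
  | zero => simp
  | add a b ha hb => simp only [map_add, TensorProduct.add_tmul, ha, hb]
  | tmul p q => simp

/-- `(a' # b') · a = a' a₍₁₎ # b' ◀ a₍₂₎`. -/
theorem rightFst_lam : rightFst 𝒜.cop P.lam = 𝒜.cop.conv (LinearMap.lTensorHom A ∘ₗ P.rB.flip)
    (LinearMap.rTensorHom B ∘ₗ 𝒜.mul.flip) := by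
  refine LinearMap.ext fun x => TensorProduct.ext' fun a b => ?_
  rw [P.isExchange_lam.rightFst_tmul, conv_apply, tw_lTensorHom P.isRightModule_rB.of_cop.isTw,
    skip_tmul]
  change leftFst 𝒜.cop B a (𝒜.cop.tw P.rB.flip (x ⊗ₜ b)) = _
  generalize 𝒜.cop.tw P.rB.flip (x ⊗ₜ b) = u
  induction u with
  | zero => simp
  | add a b ha hb => simp only [map_add, TensorProduct.tmul_add, ha, hb]
  | tmul p q => simp

/-- `b · (a' # b') = b₍₁₎ ▶ a' # b₍₂₎ b' S(b₍₃₎)` for the inner action. -/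
theorem actB_eq : P.actB = tensorAct ℬ P.lA ℬ.adj := by
  have h : rightSnd ℬ A ∘ₗ ℬ.antipode.toLinearMap =
    LinearMap.lTensorHom A ∘ₗ (ℬ.mul.flip ∘ₗ ℬ.antipode.toLinearMap) := rfl
  rw [actB, inner, leftSnd_lam, h, tensorAct, conv_assoc (P.isUnitalModule_lA.rTensor B).isTw
    (isUnitalModule_mul.lTensor A).isTw, conv_lTensorHom isUnitalModule_mul.isTw, adj_eq]
  rfl

theorem isUnitalModule_coadj : IsUnitalModule 𝒜 𝒜.coadj := by
  rw [coadj_eq, adj_eq]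
  have h := isUnitalModule_inner (isUnitalModule_mul (G := 𝒜.cop))
    (isRightModule_mul_flip (G := 𝒜.cop)) fun x y e => by simp [𝒜.mul_assoc]
  exact ⟨h.mul_act, h.unital⟩

/-- `a · (a' # b') = a₍₃₎ a' S⁻¹(a₍₂₎) # b' ◀ S⁻¹(a₍₁₎)` for the inner action. -/
theorem actA_eq : P.actA = 𝒜.conv (LinearMap.lTensorHom A ∘ₗ P.invB)
    (LinearMap.rTensorHom B ∘ₗ 𝒜.coadj) := by
  have r := isRightModule_rightFst (G := 𝒜.cop) P.lam
  have r1 := P.isRightModule_rB.of_cop.lTensor A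
  have r2 := (isRightModule_mul_flip (G := 𝒜.cop)).rTensor B
  have h1 : rightFst 𝒜.cop P.lam ∘ₗ 𝒜.cop.antipode.toLinearMap =
      𝒜.cop.conv (LinearMap.rTensorHom B ∘ₗ (𝒜.cop.mul.flip ∘ₗ 𝒜.cop.antipode.toLinearMap))
        (LinearMap.lTensorHom A ∘ₗ P.invB) := by
    have h := conv_antipode r1 r2 (P.rightFst_lam ▸ r)
    rw [rightFst_lam]
    refine h.trans ?_
    have h2 : (LinearMap.lTensorHom A ∘ₗ P.rB.flip) ∘ₗ 𝒜.cop.antipode.toLinearMap =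
        LinearMap.lTensorHom A ∘ₗ P.invB := by
      rw [cop_antipode]; rfl
    rw [h2]
    rfl
  rw [actA, inner, h1, ← conv_cop (P.isUnitalModule_invB.lTensor A) (isUnitalModule_coadj.rTensor B)
    (fun _ _ _ => (rTensorHom_lTensorHom_comm _ _ _ _ _).symm), coadj_eq, adj_eq, inner,
    ← conv_rTensorHom isUnitalModule_mul.isTw, conv_assoc (isUnitalModule_mul.rTensor B).isTw
      (isRightModule_mul_flip.antipode.rTensor B).isTw]
  rfl

/-- The action of the Drinfel'd double consists of the inner actions of `A` and `B` on the Heisenberg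
double. -/
theorem heisenbergAction_eq : P.heisenbergAction = pairAct P.actA P.actB := by
  refine TensorProduct.ext' fun a b => TensorProduct.ext' fun a' b' => ?_
  rw [pairAct_tmul, actB_eq, actA_eq, tensorAct, conv_apply (H := ℬ),
    tw_rTensorHom P.isUnitalModule_lA.isTw, onFst_tmul, ← comm_lam, heisenbergAction, smashTwist_eq]
  simp only [middleTwist, TensorProduct.curry_apply, LinearMap.comp_apply, LinearEquiv.coe_coe,
    TensorProduct.assoc_tmul, LinearMap.lTensor_tmul, TensorProduct.assoc_symm_tmul,
    LinearMap.rTensor_tmul, TensorProduct.comm_tmul]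
  generalize P.lam (a' ⊗ₜ b) = u
  induction u with
  | zero => simp
  | add a b ha hb => simp only [map_add, TensorProduct.add_tmul, TensorProduct.tmul_add, ha, hb]
  | tmul x y =>
    simp only [TensorProduct.assoc_tmul, TensorProduct.leftComm_tmul, LinearMap.lTensor_tmul,
      TensorProduct.comm_tmul, TensorProduct.lift.tmul, LinearMap.comp_apply,
      LinearMap.coe_lTensorHom]
    rw [conv_apply, tw_lTensorHom P.isUnitalModule_invB.isTw, skip_tmul, tw, LinearMap.comp_apply]
    generalize 𝒜.twist P.invB _ = v
    induction v with
    | zero => simp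
    | add a b ha hb => simp only [map_add, TensorProduct.tmul_add, ha, hb]
    | tmul p q => simp

/-! ### The Yetter-Drinfel'd structure -/

theorem mul_leftFst (a : A) (e f : A ⊗[K] B) : P.heisenberg.mul (leftFst 𝒜.cop B a e) f =
    leftFst 𝒜.cop B a (P.heisenberg.mul e f) := by
  have h := P.isExchange_lam.isExchangeModule.pairAct_leftFst a e f
  rwa [P.isExchange_lam.pairAct_eq_mul, P.isExchange_lam.pairAct_eq_mul] at h

theorem mul_leftSnd (b : B) (e f : A ⊗[K] B) : P.heisenberg.mul (leftSnd ℬ P.lam b e) f =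
    leftSnd ℬ P.lam b (P.heisenberg.mul e f) := by
  have h := P.isExchange_lam.isExchangeModule.pairAct_leftSnd P.isExchange_lam b e f
  rwa [P.isExchange_lam.pairAct_eq_mul, P.isExchange_lam.pairAct_eq_mul] at h

theorem mul_rightFst (a : A) (e f : A ⊗[K] B) : P.heisenberg.mul (rightFst 𝒜.cop P.lam a e) f =
    P.heisenberg.mul e (leftFst 𝒜.cop B a f) := by
  have h := P.isExchange_lam.isExchangeModule.pairAct_rightFst P.isExchange_lam a e f
  rwa [P.isExchange_lam.pairAct_eq_mul, P.isExchange_lam.pairAct_eq_mul] at h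

theorem mul_rightSnd (b : B) (e f : A ⊗[K] B) : P.heisenberg.mul (rightSnd ℬ A b e) f =
    P.heisenberg.mul e (leftSnd ℬ P.lam b f) := by
  have h := P.isExchange_lam.isExchangeModule.pairAct_rightSnd b e f
  rwa [P.isExchange_lam.pairAct_eq_mul, P.isExchange_lam.pairAct_eq_mul] at h

theorem rightFst_mul (a : A) (e f : A ⊗[K] B) : P.heisenberg.mul e (rightFst 𝒜.cop P.lam a f) =
    rightFst 𝒜.cop P.lam a (P.heisenberg.mul e f) := by
  refine comm_of_forall_tmul (f := P.heisenberg.mul.flip (rightFst 𝒜.cop P.lam a f))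
    (g := rightFst 𝒜.cop P.lam a ∘ₗ P.heisenberg.mul.flip f) (fun x y => ?_) e
  simp [heisenberg, P.isExchange_lam.algebra_mul_tmul, leftSnd_rightFst,
    P.isExchange_lam.leftFst_rightFst]

theorem rightSnd_mul (b : B) (e f : A ⊗[K] B) : P.heisenberg.mul e (rightSnd ℬ A b f) =
    rightSnd ℬ A b (P.heisenberg.mul e f) := by
  refine comm_of_forall_tmul (f := P.heisenberg.mul.flip (rightSnd ℬ A b f))
    (g := rightSnd ℬ A b ∘ₗ P.heisenberg.mul.flip f) (fun x y => ?_) e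
  simp [heisenberg, P.isExchange_lam.algebra_mul_tmul, leftFst_rightSnd,
    P.isExchange_lam.leftSnd_rightSnd]

theorem isUnitalModule_heisenbergAction : IsUnitalModule P.double P.heisenbergAction := by
  rw [heisenbergAction_eq]
  exact IsExchangeModule.isUnitalModule P.exchangeModule_act

/-- `(d₍₁₎ · v)(d₍₂₎ · w) = d · (vw)`. -/
theorem mul_tensorAct (d : A ⊗[K] B) (w : (A ⊗[K] B) ⊗[K] (A ⊗[K] B)) :
    TensorProduct.lift P.heisenberg.mul (tensorAct P.double P.heisenbergAction P.heisenbergAction d w) =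
      P.heisenbergAction d (TensorProduct.lift P.heisenberg.mul w) := by
  rw [heisenbergAction_eq, double, tensorAct_hopf P.exchangeModule_act]
  refine comm_of_forall_tmul (f := TensorProduct.lift P.heisenberg.mul ∘ₗ
      (pairAct (tensorAct 𝒜.cop P.actA P.actA) (tensorAct ℬ P.actB P.actB)).flip w)
    (g := (pairAct P.actA P.actB).flip (TensorProduct.lift P.heisenberg.mul w)) (fun a b => ?_) d
  simp only [LinearMap.comp_apply, LinearMap.flip_apply, pairAct_tmul]
  rw [actA, actB, mul_tensorAct_inner isUnitalModule_leftFst (isRightModule_rightFst _)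
    (fun x e f => by simp [mul_leftFst]) (fun x e f => by simp [rightFst_mul])
    (fun x e f => by simp [mul_rightFst]),
    mul_tensorAct_inner (isUnitalModule_leftSnd _) isRightModule_rightSnd
    (fun x e f => by simp [mul_leftSnd]) (fun x e f => by simp [rightSnd_mul])
    (fun x e f => by simp [mul_rightSnd])]

theorem isModuleAlgebra : IsModuleAlgebra P.double P.heisenberg P.heisenbergAction :=
  { P.isUnitalModule_heisenbergAction with
    act_mul := fun d d' x y => by
      have h := P.mul_tensorAct d (P.heisenbergAction d' x ⊗ₜ y)
      rw [tensorAct_act P.isUnitalModule_heisenbergAction, TensorProduct.lift.tmul] at h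
      rw [← h]
      generalize P.double.T₃ (d ⊗ₜ d') = u
      induction u with
      | zero => simp
      | add a b ha hb => simp only [map_add, ha, hb]
      | tmul p q => simp }

/-- The Yetter-Drinfel'd condition: `v ⊗ d' ↦ Γ(v)(d' ⊗ 1)` intertwines the diagonal actions
`d₍₁₎ · v ⊗ d₍₂₎d'` and `d₍₁₎d' ⊗ d₍₂₎ · v`. It suffices to treat `d` in `A` or in `B`, which act by
inner actions. -/
theorem T₃_tensorAct (d : A ⊗[K] B) (w : (A ⊗[K] B) ⊗[K] (A ⊗[K] B)) :
    P.double.T₃ (tensorAct P.double P.heisenbergAction P.double.mul d w) =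
      tensorAct P.double P.double.mul P.heisenbergAction d (P.double.T₃ w) := by
  have hmul : P.double.mul = pairAct (leftFst 𝒜.cop B) (leftSnd ℬ P.exch) :=
    LinearMap.ext fun d => LinearMap.ext fun e => (P.isExchange_exch.pairAct_eq_mul d e).symm
  have hF : ∀ v d h : A ⊗[K] B, (P.heisenberg.mul.flip h).lTensor (A ⊗[K] B)
      (P.double.T₃.toLinearMap (v ⊗ₜ d)) = P.op v (d ⊗ₜ h) := P.lTensor_T₃
  have m := P.exchangeModule_op
  have l := isUnitalModule_leftFst (G := 𝒜.cop) (Y := B)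
  have l' := isUnitalModule_leftSnd (H := ℬ) P.exch
  have hA := fun a w => tensorAct_inner_comm l (isRightModule_rightFst P.lam) l
    (cover_left_mul l hF (m.pairAct_leftFst) P.mul_leftFst)
    (cover_right_mul l hF (m.pairAct_rightFst P.isExchange_lam) P.mul_rightFst) a w
  have hB := fun b w => tensorAct_inner_comm (isUnitalModule_leftSnd P.lam) isRightModule_rightSnd l'
    (cover_left_mul l' hF (m.pairAct_leftSnd P.isExchange_lam) P.mul_leftSnd)
    (cover_right_mul l' hF m.pairAct_rightSnd P.mul_rightSnd) b w
  rw [hmul, heisenbergAction_eq]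
  have h1 := tensorAct_hopf (h := P.isExchange_exch) (hc := P.exchangeModule_tensor
    P.isExchange_exch.isExchangeModule P.isExchange_exch.isExchangeModule) P.exchangeModule_act
    (α' := leftFst 𝒜.cop B) (β' := leftSnd ℬ P.exch) d w
  have h2 := tensorAct_hopf (h := P.isExchange_exch) (hc := P.exchangeModule_tensor
    P.isExchange_exch.isExchangeModule P.isExchange_exch.isExchangeModule)
    P.isExchange_exch.isExchangeModule (α' := P.actA) (β' := P.actB) d (P.double.T₃ w)
  refine (congrArg P.double.T₃ h1).trans (Eq.trans ?_ h2.symm)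
  refine comm_of_forall_tmul (f := P.double.T₃.toLinearMap ∘ₗ
      (pairAct (tensorAct 𝒜.cop P.actA (leftFst 𝒜.cop B))
        (tensorAct ℬ P.actB (leftSnd ℬ P.exch))).flip w)
    (g := (pairAct (tensorAct 𝒜.cop (leftFst 𝒜.cop B) P.actA)
        (tensorAct ℬ (leftSnd ℬ P.exch) P.actB)).flip (P.double.T₃ w)) (fun a b => ?_) d
  simp only [LinearMap.comp_apply, LinearMap.flip_apply, pairAct_tmul]
  exact (hA a _).trans (congrArg _ (hB b w))

theorem isYetterDrinfeldModuleAlgebra : IsYetterDrinfeldModuleAlgebra P.double P.heisenberg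
    P.heisenbergAction (regularCoaction P.double) where
  moduleAlgebra := P.isModuleAlgebra
  comoduleAlgebra := P.isComoduleAlgebra
  compatible d d' v := by
    have h := P.T₃_tensorAct d (v ⊗ₜ d')
    rw [tensorAct_mul_right P.isUnitalModule_heisenbergAction] at h
    have h1 : ∀ u, TensorProduct.lift (rightCover (regularCoaction P.double) ∘ₗ
        P.heisenbergAction.flip v) u =
        P.double.T₃ ((P.heisenbergAction.flip v).rTensor (A ⊗[K] B) u) := by
      intro u
      induction u with
      | zero => simp
      | add a b ha hb => simp only [map_add, ha, hb]
      | tmul p q => simp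
    rw [h1, h, rightCover_regularCoaction]
    generalize P.double.T₃ (v ⊗ₜ d') = u
    induction u with
    | zero => simp
    | add a b ha hb => simp only [map_add, ha, hb]
    | tmul p q => simp [tensorAct_mul_left]

end Pairing

end MHA

end

theorem theorem3p6 {K A B : Type*} [Field K] [AddCommGroup A] [Module K A]
    [AddCommGroup B] [Module K B]
    (𝒜 : MHA.RegularMultiplierHopfAlgebra K A) (ℬ : MHA.RegularMultiplierHopfAlgebra K B)
    (P : MHA.Pairing 𝒜 ℬ) :
    P.WellDefined ∧
    ∃ (𝒟 : MHA.RegularMultiplierHopfAlgebra K (A ⊗[K] B))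
      (ℋ : MHA.NondegenerateAlgebra K (A ⊗[K] B))
      (Γ : A ⊗[K] B →ₗ[K] MHA.completedModule 𝒟.mul (A ⊗[K] B)),
      P.IsDrinfeldDouble 𝒟 ∧
      ℋ.mul = P.heisenbergMul ∧
      MHA.IsHeisenbergCoaction 𝒜 ℬ 𝒟 Γ ∧
      MHA.IsYetterDrinfeldModuleAlgebra 𝒟 ℋ P.heisenbergAction Γ :=
  ⟨P.wellDefined, P.double, P.heisenberg, MHA.regularCoaction P.double, P.isDrinfeldDouble,
    P.heisenberg_mul, P.isHeisenbergCoaction, P.isYetterDrinfeldModuleAlgebra⟩
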